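/- Let $A\in\mathbb R^{n\times n}$, $G\in\mathbb R^{n\times m}$, $c_1,\dots,c_N\in\mathbb R^{n\times p}$, with $(A,[c_1,\dots,c_N])$ observable and $(A,G)$ controllable. Let $r_1,\dots,r_N\ge 1$ be integers and $r_{\rm tot}=r_1+\dots+r_N\geq 1$. *Sampled system.* For $\tau>0$ put $\tau_0=\tau/r_{\rm tot}$ and $\bar c_i=\sqrt\tau\,c_i$. Consider $dx=Ax\,dt+G\,dw$, with $w$ a standard Brownian motion and $x(0)$ Gaussian with covariance $\Sigma_0\ge 0$; at the end of each slot of length $\tau_0$ one sensor $i$ delivers the sample $\bar c_i^\top x+v$, with $v$ standard normal, and the noises, the Brownian motion and $x(0)$ are independent. An allocation strategy $R\in\{1,\dots,N\}^{r_{\rm tot}}$, in which each sensor $i$ occurs exactly $r_i$ times, is repeated in every period of length $\tau$; $R_l$ is the sensor used in slot $l$. Let $$\phi_i(\Sigma)=\Big(\Big(e^{A\tau_0}\Sigma e^{A^\top\tau_0}+\int_0^{\tau_0}e^{As}GG^\top e^{A^\top s}ds\Big)^{-1}+\bar c_i\bar c_i^\top\Big)^{-1},\qquad \Phi_R=\phi_{R_{r_{\rm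 tot}}}\circ\cdots\circ\phi_{R_1}.$$ *Continuous-time system.* Consider the Kalman–Bucy problem for $dx=Ax\,dt+G\,dw$, $dz_i=\sqrt{r_i}\,c_i^\top x\,dt+d\nu_i$, $z_i(0)=0$, $i=1,\dots,N$, with standard Brownian motions $w,\nu_1,\dots,\nu_N$ and a Gaussian $x(0)$ of covariance $\Sigma_0\ge0$, all independent. Then there is a positive semidefinite matrix $\Sigma(\infty)$, depending only on $A,G,c_1,\dots,c_N$ and $r_1,\dots,r_N$, such that the following hold. 1. $\Sigma(\infty)$ is the unique positive semidefinite solution of $A\Sigma+\Sigma A^\top-\sum_i r_i\Sigma c_ic_i^\top\Sigma+GG^\top=0$. 2. For every $\Sigma_0\ge0$, the equation $\dot\Sigma=A\Sigma+\Sigma A^\top-\sum_i r_i\Sigma c_ic_i^\top\Sigma+GG^\top$, $\Sigma(0)=\Sigma_0$, has a unique solution on $[0,\infty)$; for all $t\ge0$, $\Sigma(t)$ is the covariance (conditioned on the observations) of the error $x(t)-\mathbb E[x(t)\mid z_i(s),\,s\le t,\,1\le i\le N]$ of the continuous-time system, and $\Sigma(t)\to\Sigma(\infty)$ as $t\to\infty$.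 So $\operatorname{tr}\Sigma(\infty)$ is the steady-state error of the Kalman–Bucy problem with observation gains $\sqrt{r_i}\,c_i$. 3. For every strategy $R$ with slot counts $r_1,\dots,r_N$, every $\tau>0$, $\Sigma_0\ge 0$ and $k\ge0$, the matrix $\Phi_R^k(\Sigma_0)$ is the covariance (conditioned on the samples) of the error $x(k\tau)-\mathbb E[x(k\tau)\mid\text{samples received in the first }k\text{ periods}]$ of the sampled system. For all sufficiently small $\tau>0$, the limit $\Sigma(\infty;\tau,R)=\lim_{k\to\infty}\Phi_R^k(\Sigma_0)$ exists for every $\Sigma_0\ge0$ and does not depend on $\Sigma_0$. The steady-state error $\overline\eta(\tau;R)=\operatorname{tr}\Sigma(\infty;\tau,R)$ satisfies $$\lim_{\tau\to0^+}\overline\eta(\tau;R)=\operatorname{tr}\Sigma(\infty).$$ In particular, the limit depends only on the slot counts $r_i$ and not on the order of the slots. -/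

import Mathlib

open Filter Topology MeasureTheory ProbabilityTheory
open scoped Matrix NNReal

namespace KalmanSampling

/-! ### Linear systems -/

/-- The pair `(A, [c₁, …, c_N])` is observable: the observability matrix with blocks
`cᵢᵀ Aᵏ`, `0 ≤ k < n`, has trivial kernel. -/
def IsObservable {n p N : ℕ} (A : Matrix (Fin n) (Fin n) ℝ)
    (c : Fin N → Matrix (Fin n) (Fin p) ℝ) : Prop :=
  (⨅ k : Fin n, ⨅ i : Fin N, LinearMap.ker ((c i)ᵀ * A ^ (k : ℕ)).mulVecLin) = ⊥

/-- The pair `(A, G)` is controllable: the columns of `G, A G, …, Aⁿ⁻¹ G` span `ℝⁿ`. -/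
def IsControllable {n m : ℕ} (A : Matrix (Fin n) (Fin n) ℝ)
    (G : Matrix (Fin n) (Fin m) ℝ) : Prop :=
  (⨆ k : Fin n, LinearMap.range (A ^ (k : ℕ) * G).mulVecLin) = ⊤

/-! ### The covariance recursion of the sampled system -/

/-- `H(h) = ∫₀ʰ e^{As} G Gᵀ e^{Aᵀs} ds`, computed entrywise. -/
noncomputable def noiseGramian {n m : ℕ} (A : Matrix (Fin n) (Fin n) ℝ)
    (G : Matrix (Fin n) (Fin m) ℝ) (h : ℝ) : Matrix (Fin n) (Fin n) ℝ :=
  Matrix.of fun a b =>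
    ∫ s in (0 : ℝ)..h, (NormedSpace.exp (s • A) * (G * Gᵀ) * NormedSpace.exp (s • Aᵀ)) a b

/-- Covariance of the prediction error after a time slot of length `h` without a new sample. -/
noncomputable def predictCov {n m : ℕ} (A : Matrix (Fin n) (Fin n) ℝ)
    (G : Matrix (Fin n) (Fin m) ℝ) (h : ℝ) (S : Matrix (Fin n) (Fin n) ℝ) :
    Matrix (Fin n) (Fin n) ℝ :=
  NormedSpace.exp (h • A) * S * NormedSpace.exp (h • Aᵀ) + noiseGramian A G h

/-- The update `φᵢ` of the error covariance over one slot of length `h`, when the sample of a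
sensor with observation matrix `cbar` arrives at the end of the slot. -/
noncomputable def slotUpdate {n m p : ℕ} (A : Matrix (Fin n) (Fin n) ℝ)
    (G : Matrix (Fin n) (Fin m) ℝ) (h : ℝ) (cbar : Matrix (Fin n) (Fin p) ℝ)
    (S : Matrix (Fin n) (Fin n) ℝ) : Matrix (Fin n) (Fin n) ℝ :=
  ((predictCov A G h S)⁻¹ + cbar * cbarᵀ)⁻¹

/-- The update `Φ_R = φ_{R_{rtot}} ∘ ⋯ ∘ φ_{R₁}` over one period `τ`, divided into `rtot` equal
slots, for the allocation strategy `R` (sensor `R l` is used in slot `l`). -/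
noncomputable def periodUpdate {n m p N rtot : ℕ} (A : Matrix (Fin n) (Fin n) ℝ)
    (G : Matrix (Fin n) (Fin m) ℝ) (cbar : Fin N → Matrix (Fin n) (Fin p) ℝ) (τ : ℝ)
    (R : Fin rtot → Fin N) (S : Matrix (Fin n) (Fin n) ℝ) : Matrix (Fin n) (Fin n) ℝ :=
  (List.ofFn R).foldl (fun T i => slotUpdate A G (τ / rtot) (cbar i) T) S

/-- The number `rᵢ` of slots that the strategy `R` assigns to sensor `i`. -/
def slotCount {N rtot : ℕ} (R : Fin rtot → Fin N) (i : Fin N) : ℕ :=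
  (Finset.univ.filter fun l => R l = i).card

/-- The scaled observation matrices `c̄ᵢ = √τ cᵢ`. -/
noncomputable def scaledGain {n p N : ℕ} (c : Fin N → Matrix (Fin n) (Fin p) ℝ) (τ : ℝ) :
    Fin N → Matrix (Fin n) (Fin p) ℝ :=
  fun i => Real.sqrt τ • c i

/-- The steady state `Σ(∞; τ, R) = lim_k Φ_R^k(Σ(0))`, written with `Σ(0) = 0`. It is meaningful
when the limit exists and does not depend on `Σ(0)`. -/
noncomputable def steadyCov {n m p N rtot : ℕ} (A : Matrix (Fin n) (Fin n) ℝ)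
    (G : Matrix (Fin n) (Fin m) ℝ) (cbar : Fin N → Matrix (Fin n) (Fin p) ℝ) (τ : ℝ)
    (R : Fin rtot → Fin N) : Matrix (Fin n) (Fin n) ℝ :=
  limUnder atTop fun k : ℕ => (periodUpdate A G cbar τ R)^[k] 0

/-- The steady-state estimation error `η̄(τ; R) = tr Σ(∞; τ, R)`. -/
noncomputable def steadyError {n m p N rtot : ℕ} (A : Matrix (Fin n) (Fin n) ℝ)
    (G : Matrix (Fin n) (Fin m) ℝ) (cbar : Fin N → Matrix (Fin n) (Fin p) ℝ) (τ : ℝ)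
    (R : Fin rtot → Fin N) : ℝ :=
  (steadyCov A G cbar τ R).trace

/-! ### The Riccati equation of the continuous-time system -/

/-- `A S + S Aᵀ - ∑ᵢ S dᵢ dᵢᵀ S + G Gᵀ`. -/
def riccati {n m p N : ℕ} (A : Matrix (Fin n) (Fin n) ℝ) (G : Matrix (Fin n) (Fin m) ℝ)
    (d : Fin N → Matrix (Fin n) (Fin p) ℝ) (S : Matrix (Fin n) (Fin n) ℝ) :
    Matrix (Fin n) (Fin n) ℝ :=
  A * S + S * Aᵀ - (∑ i, S * (d i * (d i)ᵀ) * S) + G * Gᵀ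

/-- `S` solves the Riccati differential equation on `[0, ∞)` with `S(0) = S0`. -/
def IsRiccatiSolution {n m p N : ℕ} (A : Matrix (Fin n) (Fin n) ℝ)
    (G : Matrix (Fin n) (Fin m) ℝ) (d : Fin N → Matrix (Fin n) (Fin p) ℝ)
    (S0 : Matrix (Fin n) (Fin n) ℝ) (S : ℝ → Matrix (Fin n) (Fin n) ℝ) : Prop :=
  S 0 = S0 ∧ ∀ t : ℝ, 0 ≤ t → ∀ a b,
    HasDerivWithinAt (fun s => S s a b) (riccati A G d (S t) a b) (Set.Ici 0) t

/-! ### The stochastic systems and the mean squared error estimate -/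

/-- `x` is a solution of `dx = A x dt + G dw`, driven by independent standard Brownian motions
`w j`, with Gaussian initial state of covariance `S0` (and arbitrary mean). Since the noise is
additive, the equation is the pathwise integral equation
`x(t) = x(0) + ∫₀ᵗ A x(s) ds + G w(t)`. -/
structure IsStateProcess {n m : ℕ} {Ω : Type*} [MeasurableSpace Ω] (P : Measure Ω)
    (A : Matrix (Fin n) (Fin n) ℝ) (G : Matrix (Fin n) (Fin m) ℝ)
    (S0 : Matrix (Fin n) (Fin n) ℝ) (w : Fin m → ℝ≥0 → Ω → ℝ)
    (x : ℝ≥0 → Ω → Fin n → ℝ) : Prop where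
  brownian : ∀ j, IsBrownianReal (w j) P
  noise_measurable : ∀ j t, Measurable (w j t)
  indep : iIndepFun (fun j ω t => w j t ω) P
  measurable : ∀ t, Measurable (x t)
  gaussian_init : HasGaussianLaw (x 0) P
  cov_init : ∀ a b, cov[fun ω => x 0 ω a, fun ω => x 0 ω b; P] = S0 a b
  path : ∀ᵐ ω ∂P, Continuous (fun t => x t ω) ∧ ∀ t a,
    x t ω a = x 0 ω a + (∫ s in (0 : ℝ)..t, (A *ᵥ x s.toNNReal ω) a)
      + (G *ᵥ fun j => w j t ω) a

/-- The sampled system: the slots have length `h`, slot number `q = 0, 1, 2, …` ends at time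
`(q + 1) h`, and the sample of sensor `i` there is `yᵢ = c̄ᵢᵀ x + vᵢ`, with independent standard
normal noises that are independent of the Brownian motions and of the initial state. -/
structure IsSampledSystem {n m p N : ℕ} {Ω : Type*} [MeasurableSpace Ω] (P : Measure Ω)
    (A : Matrix (Fin n) (Fin n) ℝ) (G : Matrix (Fin n) (Fin m) ℝ)
    (cbar : Fin N → Matrix (Fin n) (Fin p) ℝ) (h : ℝ) (S0 : Matrix (Fin n) (Fin n) ℝ)
    (w : Fin m → ℝ≥0 → Ω → ℝ) (v : Fin N → ℕ → Fin p → Ω → ℝ)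
    (x : ℝ≥0 → Ω → Fin n → ℝ) (y : Fin N → ℕ → Ω → Fin p → ℝ) : Prop where
  state : IsStateProcess P A G S0 w x
  noise_measurable : ∀ i q a, Measurable (v i q a)
  noise_law : ∀ i q a, HasLaw (v i q a) (gaussianReal 0 1) P
  noise_indep : iIndepFun (fun (u : Fin N × ℕ × Fin p) ω => v u.1 u.2.1 u.2.2 ω) P
  indep_noises : IndepFun (fun ω j t => w j t ω) (fun ω i q a => v i q a ω) P
  indep_init : IndepFun (x 0)
    (fun ω => ((fun j t => w j t ω), (fun i q a => v i q a ω))) P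
  measurable : ∀ i q, Measurable (y i q)
  output : ∀ᵐ ω ∂P, ∀ i q,
    y i q ω = (cbar i)ᵀ *ᵥ x (((q : ℝ) + 1) * h).toNNReal ω + fun a => v i q a ω

/-- The information of the network manager after `k` periods: the samples received in the
first `k * rtot` slots, slot `q` being used by sensor `R (q mod rtot)`. -/
@[reducible] def sampledInfo {p N rtot : ℕ} [NeZero rtot] {Ω : Type*} (R : Fin rtot → Fin N)
    (y : Fin N → ℕ → Ω → Fin p → ℝ) (k : ℕ) : MeasurableSpace Ω :=
  ⨆ q : Fin (k * rtot), MeasurableSpace.comap (y (R (Fin.ofNat rtot q)) q) inferInstance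

/-- The continuous-time system `dx = A x dt + G dw`, `dzᵢ = dᵢᵀ x dt + dνᵢ`, `zᵢ(0) = 0`, with
standard Brownian motions `w`, `ν` and the initial state all independent. -/
structure IsContinuousSystem {n m p N : ℕ} {Ω : Type*} [MeasurableSpace Ω] (P : Measure Ω)
    (A : Matrix (Fin n) (Fin n) ℝ) (G : Matrix (Fin n) (Fin m) ℝ)
    (d : Fin N → Matrix (Fin n) (Fin p) ℝ) (S0 : Matrix (Fin n) (Fin n) ℝ)
    (w : Fin m → ℝ≥0 → Ω → ℝ) (ν : Fin N → Fin p → ℝ≥0 → Ω → ℝ)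
    (x : ℝ≥0 → Ω → Fin n → ℝ) (z : Fin N → ℝ≥0 → Ω → Fin p → ℝ) : Prop where
  state : IsStateProcess P A G S0 w x
  noise_brownian : ∀ i a, IsBrownianReal (ν i a) P
  noise_measurable : ∀ i a t, Measurable (ν i a t)
  noise_indep : iIndepFun (fun (u : Fin N × Fin p) ω t => ν u.1 u.2 t ω) P
  indep_noises : IndepFun (fun ω j t => w j t ω) (fun ω i a t => ν i a t ω) P
  indep_init : IndepFun (x 0)
    (fun ω => ((fun j t => w j t ω), (fun i a t => ν i a t ω))) P
  measurable : ∀ i t, Measurable (z i t)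
  output : ∀ᵐ ω ∂P, ∀ i t a,
    z i t ω a = (∫ s in (0 : ℝ)..t, ((d i)ᵀ *ᵥ x s.toNNReal ω) a) + ν i a t ω

/-- The information `σ(zᵢ(s) : s ≤ t, i = 1, …, N)`. -/
@[reducible] def continuousInfo {p N : ℕ} {Ω : Type*} (z : Fin N → ℝ≥0 → Ω → Fin p → ℝ) (t : ℝ≥0) :
    MeasurableSpace Ω :=
  ⨆ s : Set.Iic t, ⨆ i : Fin N, MeasurableSpace.comap (z i s) inferInstance

/-- The error `X - E[X | 𝓕]` of the mean squared error estimate of the random vector `X`. -/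
noncomputable def estimationError {n : ℕ} {Ω : Type*} (F : MeasurableSpace Ω)
    [mΩ : MeasurableSpace Ω] (P : Measure Ω) (X : Ω → Fin n → ℝ) (ω : Ω) (a : Fin n) : ℝ :=
  X ω a - condExp F P (fun ω' => X ω' a) ω

/-- `S` is the covariance matrix, conditioned on the information `F`, of the error of the mean
squared error estimate of `X`. (For the Gaussian systems here it is not random.) -/
def IsErrorCov {n : ℕ} {Ω : Type*} (F : MeasurableSpace Ω) [mΩ : MeasurableSpace Ω]
    (P : Measure Ω) (X : Ω → Fin n → ℝ) (S : Matrix (Fin n) (Fin n) ℝ) : Prop :=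
  F ≤ mΩ ∧ ∀ a b,
    condExp F P (fun ω => estimationError F P X ω a * estimationError F P X ω b)
      =ᵐ[P] fun _ => S a b

end KalmanSampling

namespace KalmanSampling

/-! ### The Loewner order on real matrices -/

section Loewner

open Matrix
open scoped MatrixOrder

variable {ι : Type*} [Fintype ι]

set_option linter.unusedSectionVars false

/-! Write D = ∑ rᵢ cᵢcᵢᵀ, Q = GGᵀ and ric S = AS + SAᵀ - SDS + Q. The asymptotics rest on one
order-theoretic fact. A map Φ of positive semidefinite matrices that has at each point an affine
majorant touching it there, with a congruence as linear part (`IsSupported`), is monotone and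
concave; if moreover Φ(0) > 0, a fixed point attracts every orbit geometrically
(`IsSupported.tendsto_iterate`). The time-t Riccati flow and one slot of the sampled filter are both
of this kind, because keeping the gain that is optimal at one covariance gives an affine upper bound
at every other (`isSupported_flow`, `isSupported_slotUpdate`).

Continuous time: the Hamiltonian system X' = -AᵀX + DY, Y' = QX + AY linearises the Riccati equation
through S = YX⁻¹. Its energy XᵀY has derivative YᵀDY + XᵀQX ≥ 0, which prevents X from becoming
singular, so the flow is global and stays positive semidefinite. Observability provides U > 0 with
ric U < 0 (`exists_strict_supersolution`). The orbit of 0 increases and stays below U; its limit F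
solves ric F = 0, and by the contraction principle it attracts all orbits (`exists_tendsto_flow`).
Stationary orbits must then equal F, which is uniqueness.

Sampling: since c̄c̄ᵀ = τ ccᵀ, the quotient (Φ_R(S) - S)/τ tends to ric L whenever τ → 0+ and S → L
(`tendsto_foldl_slope`, `sum_map_slots`); the contributions of the slots add up, so their order is
lost. As ric U < 0, for small τ the period map sends U below itself and therefore has a fixed point
below U, which is globally attracting. These fixed points lie in the compact order interval [0, U],
and each of their cluster points as τ → 0+ annihilates ric, hence equals F (`tendsto_steadyCov`).

Filtering: the processes are treated as curves in L²(P). Integrals of deterministic C¹ weights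
against Brownian motion are defined by parts, so no stochastic calculus is needed. The Kalman-Bucy
error is written down explicitly with weights from X and Y; it is orthogonal to the observations and
its covariance is YX⁻¹ (`IsHilbertSystem.exists_error`). In the sampled problem a slot is a
Kalman-Bucy problem without observations followed by a projection onto the innovation
(`IsHilbertSampled.exists_slotError`). All variables lie in a closed subspace of L² made of Gaussian
variables, where a centred error orthogonal to the data is independent of them; the linear estimate
is thus the conditional expectation, and the conditional covariance is deterministic
(`IsGaussianSpace.isErrorCov`). -/

theorem posSemidef_iff_quadForm {M : Matrix ι ι ℝ} :
    M.PosSemidef ↔ Mᵀ = M ∧ ∀ v : ι → ℝ, 0 ≤ v ⬝ᵥ M *ᵥ v := by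
  rw [posSemidef_iff_dotProduct_mulVec]
  simp [IsHermitian, conjTranspose_eq_transpose_of_trivial]

theorem posDef_iff_quadForm {M : Matrix ι ι ℝ} :
    M.PosDef ↔ Mᵀ = M ∧ ∀ v : ι → ℝ, v ≠ 0 → 0 < v ⬝ᵥ M *ᵥ v := by
  rw [posDef_iff_dotProduct_mulVec]
  simp [IsHermitian, conjTranspose_eq_transpose_of_trivial]

theorem transpose_eq_of_posSemidef {M : Matrix ι ι ℝ} (h : M.PosSemidef) : Mᵀ = M :=
  (posSemidef_iff_quadForm.1 h).1

theorem quadForm_nonneg {M : Matrix ι ι ℝ} (h : M.PosSemidef) (v : ι → ℝ) :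
    0 ≤ v ⬝ᵥ M *ᵥ v :=
  (posSemidef_iff_quadForm.1 h).2 v

theorem posSemidef_of_le {S T : Matrix ι ι ℝ} (hS : S.PosSemidef) (h : S ≤ T) :
    T.PosSemidef := by
  simpa using hS.add (Matrix.le_iff.1 h)

theorem posDef_of_le {S T : Matrix ι ι ℝ} (hS : S.PosDef) (h : S ≤ T) : T.PosDef := by
  simpa using hS.add_posSemidef (Matrix.le_iff.1 h)

theorem quadForm_le_of_le {S T : Matrix ι ι ℝ} (h : S ≤ T) (v : ι → ℝ) :
    v ⬝ᵥ S *ᵥ v ≤ v ⬝ᵥ T *ᵥ v := by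
  have := quadForm_nonneg (Matrix.le_iff.1 h) v
  rw [Matrix.sub_mulVec, dotProduct_sub] at this
  linarith

theorem le_iff_quadForm {S T : Matrix ι ι ℝ} (hS : Sᵀ = S) (hT : Tᵀ = T) :
    S ≤ T ↔ ∀ v, v ⬝ᵥ S *ᵥ v ≤ v ⬝ᵥ T *ᵥ v := by
  rw [Matrix.le_iff, posSemidef_iff_quadForm]
  simp [hS, hT, Matrix.sub_mulVec, dotProduct_sub]

theorem posSemidef_conj {κ : Type*} [Fintype κ] {S : Matrix ι ι ℝ} (h : S.PosSemidef)
    (B : Matrix κ ι ℝ) : (B * S * Bᵀ).PosSemidef := by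
  simpa [conjTranspose_eq_transpose_of_trivial] using h.mul_mul_conjTranspose_same B

theorem posSemidef_conj' {κ : Type*} [Fintype κ] {S : Matrix ι ι ℝ} (h : S.PosSemidef)
    (B : Matrix ι κ ℝ) : (Bᵀ * S * B).PosSemidef := by
  simpa using posSemidef_conj h Bᵀ

theorem posSemidef_mul_transpose {κ : Type*} [Fintype κ] (B : Matrix ι κ ℝ) :
    (B * Bᵀ).PosSemidef := by
  simpa [conjTranspose_eq_transpose_of_trivial] using posSemidef_self_mul_conjTranspose B

theorem conj_le_conj {κ : Type*} [Fintype κ] {S T : Matrix ι ι ℝ} (h : S ≤ T)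
    (B : Matrix κ ι ℝ) : B * S * Bᵀ ≤ B * T * Bᵀ := by
  rw [Matrix.le_iff] at *
  simpa [Matrix.mul_sub, Matrix.sub_mul] using posSemidef_conj h B

theorem le_of_conj_le [DecidableEq ι] {S T X : Matrix ι ι ℝ} (hX : IsUnit X)
    (h : Xᵀ * S * X ≤ Xᵀ * T * X) : S ≤ T := by
  rw [Matrix.le_iff] at *
  have h1 := posSemidef_conj' h X⁻¹
  have hd : IsUnit X.det := (Matrix.isUnit_iff_isUnit_det X).1 hX
  have h2 : X * X⁻¹ = 1 := Matrix.mul_nonsing_inv X hd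
  have h3 : X⁻¹ᵀ * Xᵀ = 1 := by rw [← Matrix.transpose_mul, h2, Matrix.transpose_one]
  have h4 : X⁻¹ᵀ * (Xᵀ * T * X - Xᵀ * S * X) * X⁻¹
      = X⁻¹ᵀ * Xᵀ * (T - S) * (X * X⁻¹) := by noncomm_ring
  rw [h4, h2, h3] at h1
  simpa using h1

/-- Polarisation: it reduces limits of symmetric matrices to limits of real quadratic forms, where
order arguments apply. -/
theorem entry_eq_quadForm [DecidableEq ι] {M : Matrix ι ι ℝ} (h : Mᵀ = M) (i j : ι) :
    M i j = ((Pi.single i 1 + Pi.single j 1) ⬝ᵥ M *ᵥ (Pi.single i 1 + Pi.single j 1)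
      - (Pi.single i 1) ⬝ᵥ M *ᵥ (Pi.single i 1) - (Pi.single j 1) ⬝ᵥ M *ᵥ (Pi.single j 1)) / 2 := by
  have h1 : M j i = M i j := by conv_lhs => rw [← h, Matrix.transpose_apply]
  simp only [Matrix.mulVec_add, dotProduct_add, add_dotProduct, single_dotProduct, one_mul,
    Matrix.mulVec_single_one, Matrix.col_apply, h1]
  ring

theorem tendsto_of_tendsto_quadForm {α : Type*} {l : Filter α} {S : α → Matrix ι ι ℝ}
    {L : Matrix ι ι ℝ} (hS : ∀ᶠ a in l, (S a)ᵀ = S a) (hL : Lᵀ = L)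
    (h : ∀ v, Tendsto (fun a => v ⬝ᵥ S a *ᵥ v) l (𝓝 (v ⬝ᵥ L *ᵥ v))) : Tendsto S l (𝓝 L) := by
  classical
  refine tendsto_pi_nhds.2 fun i => tendsto_pi_nhds.2 fun j => ?_
  rw [entry_eq_quadForm hL]
  refine Tendsto.congr' ?_ ((((h _).sub (h (Pi.single i 1))).sub (h (Pi.single j 1))).div_const 2)
  filter_upwards [hS] with a ha
  exact (entry_eq_quadForm ha i j).symm

theorem continuous_quadForm (v : ι → ℝ) : Continuous fun M : Matrix ι ι ℝ => v ⬝ᵥ M *ᵥ v :=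
  continuous_const.dotProduct (continuous_id.matrix_mulVec continuous_const)

theorem isClosed_posSemidef : IsClosed {M : Matrix ι ι ℝ | M.PosSemidef} := by
  simp only [posSemidef_iff_quadForm, Set.ofPred_and, Set.ofPred_forall]
  exact (isClosed_eq (continuous_id.matrix_transpose) continuous_id).inter
    (isClosed_iInter fun v => isClosed_le continuous_const (continuous_quadForm v))

theorem le_of_tendsto_matrix {α : Type*} {l : Filter α} [l.NeBot] {S T : α → Matrix ι ι ℝ}
    {S' T' : Matrix ι ι ℝ} (hS : Tendsto S l (𝓝 S')) (hT : Tendsto T l (𝓝 T'))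
    (h : ∀ᶠ a in l, S a ≤ T a) : S' ≤ T' :=
  isClosed_posSemidef.mem_of_tendsto (hT.sub hS) h

theorem tendsto_of_le_of_le {α : Type*} {l : Filter α} {S T U : α → Matrix ι ι ℝ}
    {L : Matrix ι ι ℝ} (hL : Lᵀ = L) (hT : ∀ᶠ a in l, (T a)ᵀ = T a) (hS' : Tendsto S l (𝓝 L))
    (hU' : Tendsto U l (𝓝 L)) (h1 : ∀ᶠ a in l, S a ≤ T a) (h2 : ∀ᶠ a in l, T a ≤ U a) :
    Tendsto T l (𝓝 L) := by
  refine tendsto_of_tendsto_quadForm hT hL fun v => ?_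
  refine tendsto_of_tendsto_of_tendsto_of_le_of_le'
    (((continuous_quadForm v).tendsto L).comp hS') (((continuous_quadForm v).tendsto L).comp hU')
    ?_ ?_
  · filter_upwards [h1] with a ha using quadForm_le_of_le ha v
  · filter_upwards [h2] with a ha using quadForm_le_of_le ha v

/-- Positive definiteness is an open condition among symmetric matrices: by compactness of the unit
sphere, positivity of the form at K persists near K uniformly in the direction, and scaling extends
it to all nonzero vectors. -/
theorem eventually_posDef_of_tendsto {α : Type*} {l : Filter α} {S : α → Matrix ι ι ℝ}
    {K : Matrix ι ι ℝ} (hK : K.PosDef) (hS : ∀ᶠ a in l, (S a)ᵀ = S a)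
    (h : Tendsto S l (𝓝 K)) : ∀ᶠ a in l, (S a).PosDef := by
  have h1 : ∀ᶠ M in 𝓝 K, ∀ v ∈ Metric.sphere (0 : ι → ℝ) 1, 0 < v ⬝ᵥ M *ᵥ v := by
    refine (isCompact_sphere (0 : ι → ℝ) 1).eventually_forall_of_forall_eventually ?_
    intro v hv
    have hv0 : v ≠ 0 := by rintro rfl; simp at hv
    have hc : Continuous fun z : Matrix ι ι ℝ × (ι → ℝ) => z.2 ⬝ᵥ z.1 *ᵥ z.2 :=
      continuous_snd.dotProduct (continuous_fst.matrix_mulVec continuous_snd)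
    exact hc.continuousAt.eventually (lt_mem_nhds ((posDef_iff_quadForm.1 hK).2 v hv0))
  filter_upwards [hS, h.eventually h1] with a ha1 ha2
  refine posDef_iff_quadForm.2 ⟨ha1, fun v hv => ?_⟩
  have hn : 0 < ‖v‖ := norm_pos_iff.2 hv
  have := ha2 (‖v‖⁻¹ • v) (by simp [norm_smul, hn.ne'])
  rw [Matrix.mulVec_smul, smul_dotProduct, dotProduct_smul, smul_smul, smul_eq_mul] at this
  exact pos_of_mul_pos_right this (by positivity)

theorem exists_smul_le {K B : Matrix ι ι ℝ} (hK : K.PosDef) (hB : Bᵀ = B) :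
    ∃ δ : ℝ, 0 < δ ∧ δ ≤ 1 ∧ δ • B ≤ K ∧ (K - δ • B).PosDef := by
  have h : Tendsto (fun δ : ℝ => K - δ • B) (𝓝[>] 0) (𝓝 K) := by
    have h0 : Continuous fun δ : ℝ => K - δ • B := by fun_prop
    simpa using (h0.tendsto 0).mono_left nhdsWithin_le_nhds
  have hKt := transpose_eq_of_posSemidef hK.posSemidef
  have h1 := eventually_posDef_of_tendsto hK (.of_forall fun δ => by simp [hKt, hB]) h
  have h2 : ∀ᶠ δ : ℝ in 𝓝[>] 0, δ ∈ Set.Ioc (0 : ℝ) 1 := Ioc_mem_nhdsGT one_pos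
  obtain ⟨δ, hd, hδ⟩ := (h1.and h2).exists
  exact ⟨δ, hδ.1, hδ.2, Matrix.le_iff.2 hd.posSemidef, hd⟩

theorem exists_le_smul {K B : Matrix ι ι ℝ} (hK : K.PosDef) (hB : Bᵀ = B) :
    ∃ μ : ℝ, 1 ≤ μ ∧ B ≤ μ • K := by
  obtain ⟨δ, h0, h1, h2, -⟩ := exists_smul_le hK hB
  refine ⟨δ⁻¹, (one_le_inv₀ h0).2 h1, ?_⟩
  rw [Matrix.le_iff] at *
  have := h2.smul (inv_nonneg.2 h0.le)
  rwa [smul_sub, smul_smul, inv_mul_cancel₀ h0.ne', one_smul] at this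

theorem smul_le_smul_matrix {S T : Matrix ι ι ℝ} (h : S ≤ T) {a : ℝ} (ha : 0 ≤ a) :
    a • S ≤ a • T := by
  rw [Matrix.le_iff] at *
  simpa [smul_sub] using h.smul ha

/-- Each quadratic form converges as a bounded monotone real function, and polarisation assembles
the limits. Monotonicity is required only beyond `a₀`, since the Riccati flow is controlled only at
nonnegative times. -/
theorem exists_tendsto_of_monotone {α : Type*} [Preorder α] [IsDirectedOrder α] [Nonempty α]
    {S : α → Matrix ι ι ℝ} {a₀ : α} (hmono : ∀ a b, a₀ ≤ a → a ≤ b → S a ≤ S b)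
    {U : Matrix ι ι ℝ} (hU : ∀ a, a₀ ≤ a → S a ≤ U) (hS : ∀ a, a₀ ≤ a → (S a)ᵀ = S a) :
    ∃ L, Lᵀ = L ∧ Tendsto S atTop (𝓝 L) ∧ (∀ a, a₀ ≤ a → S a ≤ L) ∧ L ≤ U := by
  classical
  have hq : ∀ v : ι → ℝ, ∃ x, Tendsto (fun a => v ⬝ᵥ S a *ᵥ v) atTop (𝓝 x) := by
    intro v
    obtain ⟨g, hg⟩ : ∃ g : Set.Ici a₀ → ℝ, g = fun a => v ⬝ᵥ S a.1 *ᵥ v := ⟨_, rfl⟩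
    have hm : Monotone g := by
      intro a b hab
      simp only [hg]
      exact quadForm_le_of_le (hmono a b a.2 hab) v
    have hb : BddAbove (Set.range g) := by
      refine ⟨v ⬝ᵥ U *ᵥ v, ?_⟩
      rintro _ ⟨a, rfl⟩
      simp only [hg]
      exact quadForm_le_of_le (hU a a.2) v
    have ht := tendsto_atTop_ciSup hm hb
    refine ⟨⨆ a, g a, ?_⟩
    rw [← map_val_Ici_atTop a₀, tendsto_map'_iff]
    exact ht.congr fun a => by rw [hg]; rfl
  choose x hx using hq
  obtain ⟨L, hLdef⟩ : ∃ L : Matrix ι ι ℝ, L = Matrix.of fun i j =>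
    (x (Pi.single i 1 + Pi.single j 1) - x (Pi.single i 1) - x (Pi.single j 1)) / 2 := ⟨_, rfl⟩
  have hT : Tendsto S atTop (𝓝 L) := by
    refine tendsto_pi_nhds.2 fun i => tendsto_pi_nhds.2 fun j => ?_
    rw [hLdef]
    refine Tendsto.congr' ?_ ((((hx _).sub (hx (Pi.single i 1))).sub
      (hx (Pi.single j 1))).div_const 2)
    filter_upwards [eventually_ge_atTop a₀] with a ha
    exact (entry_eq_quadForm (hS a ha) i j).symm
  have hLt : Lᵀ = L := by
    have h1 : Tendsto (fun a => (S a)ᵀ) atTop (𝓝 Lᵀ) :=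
      (continuous_id.matrix_transpose.tendsto L).comp hT
    refine tendsto_nhds_unique (h1.congr' ?_) hT
    filter_upwards [eventually_ge_atTop a₀] with a ha using hS a ha
  refine ⟨L, hLt, hT, fun a ha => ?_, ?_⟩
  · refine le_of_tendsto_matrix tendsto_const_nhds hT ?_
    filter_upwards [eventually_ge_atTop a] with b hb using hmono a b ha hb
  · refine le_of_tendsto_matrix hT tendsto_const_nhds ?_
    filter_upwards [eventually_ge_atTop a₀] with b hb using hU b hb

/-- Nonnegativity of the form at eᵢ ± eⱼ bounds an off-diagonal entry by the mean of two diagonal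
ones. This makes order intervals bounded. -/
theorem abs_entry_le {S U : Matrix ι ι ℝ} (hS : S.PosSemidef) (h : S ≤ U) (i j : ι) :
    |S i j| ≤ (U i i + U j j) / 2 := by
  classical
  have hd : ∀ k, S k k ≤ U k k := fun k => by
    have := quadForm_le_of_le h (Pi.single k 1)
    simpa using this
  have ht := transpose_eq_of_posSemidef hS
  have h1 : S j i = S i j := by conv_lhs => rw [← ht, Matrix.transpose_apply]
  have h2 := quadForm_nonneg hS (Pi.single i 1 + Pi.single j 1)
  have h3 := quadForm_nonneg hS (Pi.single i 1 - Pi.single j 1)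
  simp only [Matrix.mulVec_add, Matrix.mulVec_sub, dotProduct_add, add_dotProduct,
    dotProduct_sub, sub_dotProduct, single_dotProduct, one_mul, Matrix.mulVec_single_one,
    Matrix.col_apply, h1] at h2 h3
  rw [abs_le]
  constructor <;> linarith [hd i, hd j]

theorem isCompact_Icc_matrix (U : Matrix ι ι ℝ) :
    IsCompact {S : Matrix ι ι ℝ | S.PosSemidef ∧ S ≤ U} := by
  have hb : IsCompact (Set.pi Set.univ fun i : ι => Set.pi Set.univ fun j : ι =>
      Set.Icc (-((U i i + U j j) / 2)) ((U i i + U j j) / 2)) :=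
    isCompact_univ_pi fun i => isCompact_univ_pi fun j => isCompact_Icc
  refine hb.of_isClosed_subset ?_ ?_
  · have h2 : IsClosed {S : Matrix ι ι ℝ | S ≤ U} :=
      isClosed_posSemidef.preimage (continuous_const.sub continuous_id)
    exact isClosed_posSemidef.inter h2
  · rintro S ⟨h1, h2⟩ i - j -
    exact abs_le.1 (abs_entry_le h1 h2 i j)

/-! ### Maps supported by affine positive maps -/

/-- At every positive semidefinite matrix the map `Φ` is dominated, with equality there, by an
affine map whose linear part is a congruence; such maps are monotone and concave. -/
def IsSupported (Φ : Matrix ι ι ℝ → Matrix ι ι ℝ) : Prop :=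
  (∀ S, S.PosSemidef → (Φ S).PosSemidef) ∧
    ∀ S, S.PosSemidef → ∃ B : Matrix ι ι ℝ, ∀ T, T.PosSemidef → Φ T ≤ Φ S + B * (T - S) * Bᵀ

/-- A chain rule: the majorant of Φ at Ψ S composed with the majorant of Ψ at S is again affine, and
a composite of congruences is a congruence. -/
theorem IsSupported.comp {Φ Ψ : Matrix ι ι ℝ → Matrix ι ι ℝ} (hΦ : IsSupported Φ)
    (hΨ : IsSupported Ψ) : IsSupported (Φ ∘ Ψ) := by
  refine ⟨fun S hS => hΦ.1 _ (hΨ.1 _ hS), fun S hS => ?_⟩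
  obtain ⟨B, hB⟩ := hΨ.2 S hS
  obtain ⟨C, hC⟩ := hΦ.2 (Ψ S) (hΨ.1 S hS)
  refine ⟨C * B, fun T hT => (hC (Ψ T) (hΨ.1 T hT)).trans ?_⟩
  have h1 : Ψ T - Ψ S ≤ B * (T - S) * Bᵀ := sub_le_iff_le_add'.2 (hB T hT)
  have h2 := conj_le_conj h1 C
  calc Φ (Ψ S) + C * (Ψ T - Ψ S) * Cᵀ ≤ Φ (Ψ S) + C * (B * (T - S) * Bᵀ) * Cᵀ := by gcongr
    _ = _ := by simp only [Function.comp, Matrix.transpose_mul, Matrix.mul_assoc]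

theorem isSupported_id [DecidableEq ι] : IsSupported (id : Matrix ι ι ℝ → Matrix ι ι ℝ) :=
  ⟨fun _ h => h, fun S _ => ⟨1, fun T _ => by simp⟩⟩

/-- The majorant at the larger matrix T is used: its linear part sends S - T ≤ 0 to a nonpositive
matrix. -/
theorem IsSupported.mono {Φ : Matrix ι ι ℝ → Matrix ι ι ℝ} (hΦ : IsSupported Φ)
    {S T : Matrix ι ι ℝ} (hS : S.PosSemidef) (h : S ≤ T) : Φ S ≤ Φ T := by
  obtain ⟨B, hB⟩ := hΦ.2 T (posSemidef_of_le hS h)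
  refine (hB S hS).trans ?_
  have h1 := conj_le_conj h B
  have : B * (S - T) * Bᵀ ≤ 0 := by
    rw [Matrix.mul_sub, Matrix.sub_mul]
    exact sub_nonpos.2 h1
  simpa using add_le_add_right this (Φ T)

/-- The majorant at aS is evaluated at S and at 0; in the convex combination the linear terms cancel
because aS is the barycentre. -/
theorem IsSupported.concave_zero {Φ : Matrix ι ι ℝ → Matrix ι ι ℝ} (hΦ : IsSupported Φ)
    {S : Matrix ι ι ℝ} (hS : S.PosSemidef) {a : ℝ} (h0 : 0 ≤ a) (h1 : a ≤ 1) :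
    a • Φ S + (1 - a) • Φ 0 ≤ Φ (a • S) := by
  obtain ⟨B, hB⟩ := hΦ.2 (a • S) (hS.smul h0)
  have e1 := smul_le_smul_matrix (hB S hS) h0
  have e2 := smul_le_smul_matrix (hB 0 .zero) (sub_nonneg.2 h1)
  refine (add_le_add e1 e2).trans_eq ?_
  simp only [Matrix.mul_sub, Matrix.sub_mul, smul_add, smul_sub, Matrix.mul_smul, Matrix.smul_mul,
    Matrix.mul_zero, Matrix.zero_mul, smul_zero, sub_smul, one_smul, smul_smul]
  module

/-- A concave monotone map with `Φ 0 > 0` contracts geometrically to its fixed point. -/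
theorem IsSupported.iterate_bounds {Φ : Matrix ι ι ℝ → Matrix ι ι ℝ} (hΦ : IsSupported Φ)
    {F : Matrix ι ι ℝ} (hF : F.PosSemidef) (hfix : Φ F = F) {δ : ℝ} (hδ0 : 0 < δ) (hδ1 : δ ≤ 1)
    (hδ : δ • F ≤ Φ 0) {μ : ℝ} (hμ : 1 ≤ μ) {T : Matrix ι ι ℝ} (hT : T.PosSemidef)
    (hTμ : T ≤ μ • F) (k : ℕ) :
    (1 - (1 - δ) ^ k) • F ≤ Φ^[k] T ∧ Φ^[k] T ≤ (1 + (1 - δ) ^ k * (μ - 1)) • F := by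
  have hp : ∀ k : ℕ, (Φ^[k] T).PosSemidef := fun k => by
    induction k with
    | zero => exact hT
    | succ k ih => rw [Function.iterate_succ_apply']; exact hΦ.1 _ ih
  have hδ' : 0 ≤ 1 - δ := by linarith
  have hpow0 : ∀ k : ℕ, 0 ≤ (1 - δ) ^ k := fun k => pow_nonneg hδ' k
  have hpow1 : ∀ k : ℕ, (1 - δ) ^ k ≤ 1 := fun k => pow_le_one₀ hδ' (by linarith)
  induction k with
  | zero =>
    refine ⟨?_, by simpa using hTμ⟩
    simpa [Matrix.le_iff] using hT
  | succ k ih =>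
    rw [Function.iterate_succ_apply']
    constructor
    -- With a = 1 - (1-δ)^k: Φ(aF) ≥ aF + (1-a)Φ(0) ≥ (a + (1-a)δ)F, and the missing fraction is
    -- (1-a)(1-δ) = (1-δ)^(k+1).
    · have h1 := hΦ.mono (hF.smul (sub_nonneg.2 (hpow1 k))) ih.1
      have h2 := hΦ.concave_zero hF (a := 1 - (1 - δ) ^ k) (by linarith [hpow1 k])
        (by linarith [hpow0 k])
      rw [hfix] at h2
      have h3 := smul_le_smul_matrix hδ (hpow0 k)
      refine le_trans ?_ (h2.trans h1)
      refine le_trans (le_of_eq ?_) (add_le_add_right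
        (h3.trans_eq (by congr 1; ring : (1 - δ) ^ k • Φ 0 = (1 - (1 - (1 - δ) ^ k)) • Φ 0)) _)
      rw [smul_smul, ← add_smul]
      congr 1
      ring
    -- Concavity is applied at mF with weight 1/m, so that F = Φ(F) ≥ Φ(mF)/m + (1 - 1/m)Φ(0). Hence
    -- Φ(mF) ≤ (m - (m-1)δ)F: the excess m - 1 shrinks by the factor 1 - δ.
    · set m : ℝ := 1 + (1 - δ) ^ k * (μ - 1) with hm
      have hm1 : 1 ≤ m := by
        have := mul_nonneg (hpow0 k) (sub_nonneg.2 hμ)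
        linarith
      have h1 := hΦ.mono (hp k) ih.2
      have hm0 : 0 < m := by linarith
      have h2 := hΦ.concave_zero (hF.smul hm0.le) (a := m⁻¹) (by positivity)
        (inv_le_one_of_one_le₀ hm1)
      rw [smul_smul, inv_mul_cancel₀ hm0.ne', one_smul, hfix] at h2
      have h3 := smul_le_smul_matrix hδ (sub_nonneg.2 (inv_le_one_of_one_le₀ hm1))
      have h4 : m⁻¹ • Φ (m • F) ≤ F - ((1 - m⁻¹) * δ) • F := by
        rw [le_sub_iff_add_le, ← smul_smul]
        exact (add_le_add_right h3 _).trans h2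
      have h5 := smul_le_smul_matrix h4 hm0.le
      rw [smul_smul, mul_inv_cancel₀ hm0.ne', one_smul] at h5
      refine h1.trans (h5.trans_eq ?_)
      rw [smul_sub, smul_smul, ← sub_smul]
      congr 1
      field_simp
      rw [hm]
      ring

/-- Since F = Φ(F) ≥ Φ(0) > 0, the initial matrix lies below a multiple of F, and a multiple of F
lies below Φ(0). The geometric bounds then squeeze the orbit. -/
theorem IsSupported.tendsto_iterate {Φ : Matrix ι ι ℝ → Matrix ι ι ℝ} (hΦ : IsSupported Φ)
    (h0 : (Φ 0).PosDef) {F : Matrix ι ι ℝ} (hF : F.PosSemidef) (hfix : Φ F = F)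
    {T : Matrix ι ι ℝ} (hT : T.PosSemidef) : Tendsto (fun k => Φ^[k] T) atTop (𝓝 F) := by
  have hFp : F.PosDef := by
    rw [← hfix]
    exact posDef_of_le h0 (hΦ.mono .zero (by simpa [Matrix.le_iff] using hF))
  have hFt := transpose_eq_of_posSemidef hF
  obtain ⟨δ, hδ0, hδ1, hδ, -⟩ := exists_smul_le h0 hFt
  obtain ⟨μ, hμ, hTμ⟩ := exists_le_smul hFp (transpose_eq_of_posSemidef hT)
  have hb := hΦ.iterate_bounds hF hfix hδ0 hδ1 hδ hμ hT hTμ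
  have hp : Tendsto (fun k : ℕ => (1 - δ) ^ k) atTop (𝓝 0) :=
    tendsto_pow_atTop_nhds_zero_of_lt_one (by linarith) (by linarith)
  refine tendsto_of_le_of_le hFt (.of_forall fun k => ?_) (S := fun k => (1 - (1 - δ) ^ k) • F)
    (U := fun k => (1 + (1 - δ) ^ k * (μ - 1)) • F) ?_ ?_
    (.of_forall fun k => (hb k).1) (.of_forall fun k => (hb k).2)
  · refine transpose_eq_of_posSemidef ?_
    induction k with
    | zero => exact hT
    | succ k ih => rw [Function.iterate_succ_apply']; exact hΦ.1 _ ih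
  · simpa using (hp.const_sub 1).smul_const F
  · simpa using ((hp.mul_const (μ - 1)).const_add 1).smul_const F

end Loewner


/-! ### Matrix exponentials and Gramians -/

section Gramian

open Matrix NormedSpace
open scoped MatrixOrder

variable {ι : Type*} [Fintype ι] [DecidableEq ι]

set_option linter.unusedSectionVars false

attribute [local instance] Matrix.linftyOpNormedRing Matrix.linftyOpNormedAlgebra

theorem hasDerivAt_matrix_exp (B : Matrix ι ι ℝ) (t : ℝ) :
    HasDerivAt (fun s : ℝ => exp (s • B)) (B * exp (t • B)) t :=
  hasDerivAt_exp_smul_const' B t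

theorem hasDerivAt_matrix_exp' (B : Matrix ι ι ℝ) (t : ℝ) :
    HasDerivAt (fun s : ℝ => exp (s • B)) (exp (t • B) * B) t :=
  hasDerivAt_exp_smul_const B t

theorem continuous_matrix_exp_smul (B : Matrix ι ι ℝ) :
    Continuous fun s : ℝ => exp (s • B) :=
  continuous_iff_continuousAt.2 fun t => (hasDerivAt_matrix_exp B t).continuousAt

theorem matrix_exp_neg_mul (B : Matrix ι ι ℝ) (t : ℝ) : exp (t • (-B)) * exp (t • B) = 1 := by
  rw [smul_neg, ← Matrix.exp_add_of_commute _ _ ((Commute.refl (t • B)).neg_left)]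
  simp

theorem matrix_exp_mul_neg (B : Matrix ι ι ℝ) (t : ℝ) : exp (t • B) * exp (t • (-B)) = 1 := by
  simpa using matrix_exp_neg_mul (-B) t

theorem _root_.HasDerivAt.matrix_transpose {f : ℝ → Matrix ι ι ℝ} {f' : Matrix ι ι ℝ} {t : ℝ}
    (h : HasDerivAt f f' t) : HasDerivAt (fun s => (f s)ᵀ) f'ᵀ t :=
  hasDerivAt_pi.2 fun i => hasDerivAt_pi.2 fun j => hasDerivAt_pi.1 (hasDerivAt_pi.1 h j) i

theorem _root_.HasDerivAt.matrix_mulVec {f : ℝ → Matrix ι ι ℝ} {f' : Matrix ι ι ℝ} {t : ℝ}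
    (h : HasDerivAt f f' t) (v : ι → ℝ) : HasDerivAt (fun s => f s *ᵥ v) (f' *ᵥ v) t :=
  hasDerivAt_pi.2 fun i => HasDerivAt.fun_sum fun j _ =>
    (hasDerivAt_pi.1 (hasDerivAt_pi.1 h i) j).mul_const (v j)

theorem _root_.HasDerivAt.matrix_quadForm {f : ℝ → Matrix ι ι ℝ} {f' : Matrix ι ι ℝ} {t : ℝ}
    (h : HasDerivAt f f' t) (v : ι → ℝ) :
    HasDerivAt (fun s => v ⬝ᵥ f s *ᵥ v) (v ⬝ᵥ f' *ᵥ v) t :=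
  HasDerivAt.fun_sum fun i _ => (hasDerivAt_pi.1 (h.matrix_mulVec v) i).const_mul (v i)

/-- `M Bᵏ v = 0` for all `k` only for `v = 0`. -/
def ObservablePair (M B : Matrix ι ι ℝ) : Prop :=
  ∀ v : ι → ℝ, (∀ k : ℕ, (M * B ^ k) *ᵥ v = 0) → v = 0

theorem ObservablePair.neg {M B : Matrix ι ι ℝ} (h : ObservablePair M B) :
    ObservablePair M (-B) := by
  intro v hv
  refine h v fun k => ?_
  have := hv k
  rw [neg_pow, ← Matrix.mul_assoc] at this
  rcases neg_one_pow_eq_or (Matrix ι ι ℝ) k with h1 | h1 <;> simpa [h1, Matrix.neg_mulVec] using this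

/-- Repeated differentiation on the open interval gives M Bᵏ exp(sB) v = 0 for all k. Evaluating at
the midpoint, observability kills exp(tB/2) v, and the exponential is invertible. -/
theorem ObservablePair.eq_zero_of_exp {M B : Matrix ι ι ℝ} (h : ObservablePair M B) {t : ℝ}
    (ht : 0 < t) {v : ι → ℝ} (hv : ∀ s ∈ Set.Ioo 0 t, (M * exp (s • B)) *ᵥ v = 0) : v = 0 := by
  have key : ∀ k : ℕ, ∀ s ∈ Set.Ioo 0 t, (M * B ^ k * exp (s • B)) *ᵥ v = 0 := by
    intro k
    induction k with
    | zero => simpa using hv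
    | succ k ih =>
      intro s hs
      have h1 : HasDerivAt (fun s : ℝ => (M * B ^ k * exp (s • B)) *ᵥ v)
          ((M * B ^ k * (B * exp (s • B))) *ᵥ v) s :=
        ((hasDerivAt_matrix_exp B s).const_mul (M * B ^ k)).matrix_mulVec v
      have h2 : HasDerivAt (fun s : ℝ => (M * B ^ k * exp (s • B)) *ᵥ v) 0 s := by
        refine (hasDerivAt_const s (0 : ι → ℝ)).congr_of_eventuallyEq ?_
        filter_upwards [Ioo_mem_nhds hs.1 hs.2] with u hu using ih u hu
      have h3 := h1.unique h2
      rwa [← Matrix.mul_assoc, Matrix.mul_assoc M, ← pow_succ] at h3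
  have h1 : exp ((t / 2) • B) *ᵥ v = 0 := by
    refine h _ fun k => ?_
    rw [Matrix.mulVec_mulVec]
    exact key k _ ⟨by linarith, by linarith⟩
  have h2 : exp ((t / 2) • (-B)) *ᵥ (exp ((t / 2) • B) *ᵥ v) = v := by
    rw [Matrix.mulVec_mulVec, matrix_exp_neg_mul, Matrix.one_mulVec]
  rw [← h2, h1, Matrix.mulVec_zero]

theorem quadForm_intervalIntegral {f : ℝ → Matrix ι ι ℝ} (hf : Continuous f) (a b : ℝ)
    (v : ι → ℝ) : v ⬝ᵥ (∫ s in a..b, f s) *ᵥ v = ∫ s in a..b, v ⬝ᵥ f s *ᵥ v := by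
  obtain ⟨q, hq⟩ : ∃ q : Matrix ι ι ℝ →L[ℝ] ℝ, ∀ M, q M = v ⬝ᵥ M *ᵥ v :=
    ⟨LinearMap.toContinuousLinearMap
      { toFun := fun M => v ⬝ᵥ M *ᵥ v
        map_add' := fun M N => by rw [Matrix.add_mulVec, dotProduct_add]
        map_smul' := fun c M => by simp [Matrix.smul_mulVec] }, fun M => rfl⟩
  simp only [← hq]
  exact (q.intervalIntegral_comp_comm (hf.intervalIntegrable a b)).symm

theorem transpose_intervalIntegral {f : ℝ → Matrix ι ι ℝ} (hf : Continuous f) (a b : ℝ) :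
    (∫ s in a..b, f s)ᵀ = ∫ s in a..b, (f s)ᵀ := by
  obtain ⟨q, hq⟩ : ∃ q : Matrix ι ι ℝ →L[ℝ] Matrix ι ι ℝ, ∀ M, q M = Mᵀ :=
    ⟨LinearMap.toContinuousLinearMap (Matrix.transposeLinearEquiv ι ι ℝ ℝ).toLinearMap,
      fun M => rfl⟩
  simp only [← hq]
  exact (q.intervalIntegral_comp_comm (hf.intervalIntegrable a b)).symm

theorem entry_intervalIntegral {f : ℝ → Matrix ι ι ℝ} (hf : Continuous f) (a b : ℝ) (i j : ι) :
    (∫ s in a..b, f s) i j = ∫ s in a..b, f s i j := by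
  obtain ⟨q, hq⟩ : ∃ q : Matrix ι ι ℝ →L[ℝ] ℝ, ∀ M, q M = M i j :=
    ⟨LinearMap.toContinuousLinearMap (Matrix.entryLinearMap ℝ ℝ i j), fun M => rfl⟩
  simp only [← hq]
  exact (q.intervalIntegral_comp_comm (hf.intervalIntegrable a b)).symm

theorem continuous_gramian_integrand (D B : Matrix ι ι ℝ) :
    Continuous fun s : ℝ => (exp (s • B))ᵀ * D * exp (s • B) := by
  have h := continuous_matrix_exp_smul B
  exact (h.matrix_transpose.mul continuous_const).mul h

/-- Weighted observability Gramians are positive definite. -/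
theorem posDef_gramian {D B : Matrix ι ι ℝ} (hD : D.PosSemidef) (h : ObservablePair D B) {t : ℝ}
    (ht : 0 < t) {ρ : ℝ → ℝ} (hρ : Continuous ρ) (hρ0 : ∀ s ∈ Set.Ioo 0 t, 0 < ρ s) :
    (∫ s in (0 : ℝ)..t, ρ s • ((exp (s • B))ᵀ * D * exp (s • B))).PosDef := by
  have hc : Continuous fun s : ℝ => ρ s • ((exp (s • B))ᵀ * D * exp (s • B)) :=
    hρ.smul (continuous_gramian_integrand D B)
  have hp : ∀ s : ℝ, ((exp (s • B))ᵀ * D * exp (s • B)).PosSemidef := fun s =>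
    posSemidef_conj' hD _
  have hρ1 : ∀ s ∈ Set.Icc 0 t, 0 ≤ ρ s := by
    intro s hs
    have h1 : s ∈ closure (Set.Ioo 0 t) := by rwa [closure_Ioo ht.ne]
    have h2 : IsClosed {s | 0 ≤ ρ s} := isClosed_le continuous_const hρ
    exact closure_minimal (fun u hu => (hρ0 u hu).le) h2 h1
  refine posDef_iff_quadForm.2 ⟨?_, fun v hv => ?_⟩
  · rw [transpose_intervalIntegral hc]
    simp_rw [Matrix.transpose_smul, transpose_eq_of_posSemidef (hp _)]
  · rw [quadForm_intervalIntegral hc]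
    have hcv : Continuous fun s : ℝ => v ⬝ᵥ (ρ s • ((exp (s • B))ᵀ * D * exp (s • B))) *ᵥ v :=
      (continuous_quadForm v).comp hc
    have hval : ∀ s : ℝ, v ⬝ᵥ (ρ s • ((exp (s • B))ᵀ * D * exp (s • B))) *ᵥ v
        = ρ s * (v ⬝ᵥ ((exp (s • B))ᵀ * D * exp (s • B)) *ᵥ v) := fun s => by
      rw [Matrix.smul_mulVec, dotProduct_smul, smul_eq_mul]
    refine intervalIntegral.integral_pos ht hcv.continuousOn (fun s hs => ?_) ?_
    · rw [hval]
      exact mul_nonneg (hρ1 s ⟨hs.1.le, hs.2⟩) (quadForm_nonneg (hp s) v)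
    -- The integrand is nonnegative. If it is nowhere positive, then D exp(sB) v = 0 on the whole
    -- interval because D is positive semidefinite, and observability forces v = 0.
    · by_contra! hcon
      refine hv (h.eq_zero_of_exp ht fun s hs => ?_)
      have h1 := hcon s ⟨hs.1.le, hs.2.le⟩
      rw [hval] at h1
      have h2 := quadForm_nonneg (hp s) v
      have h3 : v ⬝ᵥ ((exp (s • B))ᵀ * D * exp (s • B)) *ᵥ v = 0 := by
        by_contra h4
        exact absurd (mul_pos (hρ0 s hs) (lt_of_le_of_ne h2 (Ne.symm h4))) (not_lt.2 h1)
      have h4 : (exp (s • B) *ᵥ v) ⬝ᵥ D *ᵥ (exp (s • B) *ᵥ v) = 0 := by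
        rw [← h3, Matrix.mul_assoc, ← Matrix.mulVec_mulVec, ← Matrix.mulVec_mulVec,
          Matrix.dotProduct_mulVec v, Matrix.vecMul_transpose]
      have h5 := (hD.dotProduct_mulVec_zero_iff (exp (s • B) *ᵥ v)).1 (by simpa using h4)
      rwa [Matrix.mulVec_mulVec] at h5

/-! ### Algebraic Riccati inequalities -/

/-- `A S + S Aᵀ - S D S + Q`. -/
def ric (A D Q S : Matrix ι ι ℝ) : Matrix ι ι ℝ := A * S + S * Aᵀ - S * D * S + Q

/-- With M(s) = exp(-sA)ᵀ D exp(-sA) one has M' = -(AᵀM + MA). Take V = ∫₀¹ (1-s)M(s) ds and K = ∫₀¹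
M(s) ds: integrating the derivative of (1-s)M(s) gives the identity, since the weight kills the
boundary term at 1 and leaves M(0) = D at 0. Both are weighted Gramians, hence positive definite. -/
theorem exists_lyapunov {A D : Matrix ι ι ℝ} (hD : D.PosSemidef) (h : ObservablePair D A) :
    ∃ V K : Matrix ι ι ℝ, V.PosDef ∧ K.PosDef ∧ V * A + Aᵀ * V = D - K := by
  set M : ℝ → Matrix ι ι ℝ := fun s => (exp (s • (-A)))ᵀ * D * exp (s • (-A)) with hM
  have hMc : Continuous M := continuous_gramian_integrand D (-A)
  have hM' : ∀ s, HasDerivAt M (-(Aᵀ * M s + M s * A)) s := by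
    intro s
    have h1 := hasDerivAt_matrix_exp' (-A) s
    have h2 := (h1.matrix_transpose.mul_const D).mul h1
    refine h2.congr_deriv ?_
    simp only [hM, Matrix.transpose_mul, Matrix.transpose_neg]
    noncomm_ring
  refine ⟨∫ s in (0 : ℝ)..1, (1 - s) • M s, ∫ s in (0 : ℝ)..1, M s,
    posDef_gramian hD h.neg one_pos (by fun_prop) (fun s hs => by linarith [hs.2]), ?_, ?_⟩
  · have := posDef_gramian hD h.neg one_pos (ρ := fun _ => 1) continuous_const
      (fun s hs => one_pos)
    simpa only [one_smul] using this
  · have hc : Continuous fun s : ℝ => (1 - s) • M s := by fun_prop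
    have h1 : ∀ s ∈ Set.uIcc (0 : ℝ) 1, HasDerivAt (fun s : ℝ => (1 - s) • M s)
        (-(M s) - ((1 - s) • M s * A + Aᵀ * ((1 - s) • M s))) s := by
      intro s _
      have h2 := ((hasDerivAt_id s).const_sub 1).smul (hM' s)
      refine h2.congr_deriv ?_
      simp only [smul_neg, smul_add, Matrix.smul_mul, Matrix.mul_smul, id]
      module
    have h2 := intervalIntegral.integral_eq_sub_of_hasDerivAt h1
      (Continuous.intervalIntegrable (by fun_prop) 0 1)
    have hc2 : Continuous fun s : ℝ => (1 - s) • M s * A := by fun_prop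
    have hc3 : Continuous fun s : ℝ => Aᵀ * ((1 - s) • M s) := by fun_prop
    have hc1 : Continuous fun s : ℝ => -M s := by fun_prop
    have i1 := hc1.intervalIntegrable (μ := volume) 0 1
    have i2 := hc2.intervalIntegrable (μ := volume) 0 1
    have i3 := hc3.intervalIntegrable (μ := volume) 0 1
    have e1 : ∫ s in (0 : ℝ)..1, (1 - s) • M s * A = (∫ s in (0 : ℝ)..1, (1 - s) • M s) * A :=
      ((ContinuousLinearMap.mul ℝ (Matrix ι ι ℝ)).flip A).intervalIntegral_comp_comm
        (hc.intervalIntegrable 0 1)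
    have e2 : ∫ s in (0 : ℝ)..1, Aᵀ * ((1 - s) • M s) = Aᵀ * (∫ s in (0 : ℝ)..1, (1 - s) • M s) :=
      ((ContinuousLinearMap.mul ℝ (Matrix ι ι ℝ)) Aᵀ).intervalIntegral_comp_comm
        (hc.intervalIntegrable 0 1)
    rw [intervalIntegral.integral_sub i1 (i2.add i3), intervalIntegral.integral_add i2 i3,
      intervalIntegral.integral_neg, e1, e2] at h2
    have hM0 : M 0 = D := by simp [hM]
    simp only [sub_self, zero_smul, sub_zero, one_smul, zero_sub, hM0] at h2
    rw [← sub_eq_zero] at h2 ⊢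
    rw [← neg_eq_zero, ← h2]
    abel

/-- Observability gives a strict supersolution of the algebraic Riccati equation. -/
theorem exists_strict_supersolution {A D Q : Matrix ι ι ℝ} (hD : D.PosSemidef)
    (hQ : Q.PosSemidef) (h : ObservablePair D A) :
    ∃ U : Matrix ι ι ℝ, U.PosDef ∧ (-(ric A D Q U)).PosDef := by
  obtain ⟨V, K, hV, hK, hVK⟩ := exists_lyapunov hD h
  have hVt := transpose_eq_of_posSemidef hV.posSemidef
  have hVQ : (V * Q * V).PosSemidef := by simpa [hVt] using posSemidef_conj hQ V
  -- The factor ε makes the quadratic term ε²VQV negligible against εK.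
  obtain ⟨ε, h0, h1, -, h2⟩ := exists_smul_le hK (transpose_eq_of_posSemidef hVQ)
  have hW : (ε • V).PosDef := hV.smul h0
  set W := ε • V with hWdef
  have hu : IsUnit W.det := (Matrix.isUnit_iff_isUnit_det W).1 hW.isUnit
  have hl : W⁻¹ * W = 1 := Matrix.nonsing_inv_mul W hu
  have hr : W * W⁻¹ = 1 := Matrix.mul_nonsing_inv W hu
  have hWt : W⁻¹ᵀ = W⁻¹ := transpose_eq_of_posSemidef hW.inv.posSemidef
  -- For U = W⁻¹ with W = εV, the congruence of -ric U by W is D - (WA + AᵀW) - WQW = (1-ε)D + ε(K -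
  -- εVQV), which is positive definite.
  refine ⟨W⁻¹, hW.inv, ?_⟩
  have e1 : W * A + Aᵀ * W = ε • (D - K) := by
    rw [hWdef, ← hVK]
    simp
  have e2 : -(ric A D Q W⁻¹) = W⁻¹ * (D - (W * A + Aᵀ * W) - W * Q * W) * W⁻¹ := by
    have : W⁻¹ * (D - (W * A + Aᵀ * W) - W * Q * W) * W⁻¹
      = W⁻¹ * D * W⁻¹ - (W⁻¹ * W * A * W⁻¹ + W⁻¹ * Aᵀ * (W * W⁻¹))
        - W⁻¹ * W * Q * (W * W⁻¹) := by noncomm_ring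
    rw [this, hl, hr, ric]
    noncomm_ring
  have e3 : D - (W * A + Aᵀ * W) - W * Q * W
      = (1 - ε) • D + ε • (K - ε • (V * Q * V)) := by
    rw [e1, hWdef]
    simp only [Matrix.smul_mul, Matrix.mul_smul, smul_sub, sub_smul, one_smul]
    abel
  have h3 : (D - (W * A + Aᵀ * W) - W * Q * W).PosDef := by
    rw [e3]
    exact (h2.smul h0).posSemidef_add (hD.smul (sub_nonneg.2 h1))
  rw [e2]
  have h4 := h3.mul_mul_conjTranspose_same (B := W⁻¹)
    (Matrix.vecMul_injective_of_isUnit hW.inv.isUnit)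
  rwa [conjTranspose_eq_transpose_of_trivial, hWt] at h4

end Gramian


/-! ### The Riccati flow -/

section Flow

open Matrix NormedSpace
open scoped MatrixOrder

variable {ι : Type*} [Fintype ι] [DecidableEq ι]

set_option linter.unusedSectionVars false

attribute [local instance] Matrix.linftyOpNormedRing Matrix.linftyOpNormedAlgebra

/-- The exponential of the Hamiltonian matrix of the Riccati equation. -/
noncomputable def hamExp (A D Q : Matrix ι ι ℝ) (t : ℝ) : Matrix (ι ⊕ ι) (ι ⊕ ι) ℝ :=
  exp (t • fromBlocks (-Aᵀ) D Q A)

/-- The denominator of the linear fractional form of the Riccati flow. -/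
noncomputable def flowX (A D Q S₀ : Matrix ι ι ℝ) (t : ℝ) : Matrix ι ι ℝ :=
  (hamExp A D Q t).toBlocks₁₁ + (hamExp A D Q t).toBlocks₁₂ * S₀

/-- The numerator of the linear fractional form of the Riccati flow. -/
noncomputable def flowY (A D Q S₀ : Matrix ι ι ℝ) (t : ℝ) : Matrix ι ι ℝ :=
  (hamExp A D Q t).toBlocks₂₁ + (hamExp A D Q t).toBlocks₂₂ * S₀

/-- The solution of the Riccati differential equation with initial value `S₀`. -/
noncomputable def flow (A D Q S₀ : Matrix ι ι ℝ) (t : ℝ) : Matrix ι ι ℝ :=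
  flowY A D Q S₀ t * (flowX A D Q S₀ t)⁻¹

variable {A D Q S₀ : Matrix ι ι ℝ}

/-! ### The Hamiltonian linear system and its energy XᵀY. -/

theorem hasDerivAt_hamExp_blocks (t : ℝ) :
    (HasDerivAt (fun s => (hamExp A D Q s).toBlocks₁₁)
      (-Aᵀ * (hamExp A D Q t).toBlocks₁₁ + D * (hamExp A D Q t).toBlocks₂₁) t ∧
    HasDerivAt (fun s => (hamExp A D Q s).toBlocks₁₂)
      (-Aᵀ * (hamExp A D Q t).toBlocks₁₂ + D * (hamExp A D Q t).toBlocks₂₂) t) ∧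
    HasDerivAt (fun s => (hamExp A D Q s).toBlocks₂₁)
      (Q * (hamExp A D Q t).toBlocks₁₁ + A * (hamExp A D Q t).toBlocks₂₁) t ∧
    HasDerivAt (fun s => (hamExp A D Q s).toBlocks₂₂)
      (Q * (hamExp A D Q t).toBlocks₁₂ + A * (hamExp A D Q t).toBlocks₂₂) t := by
  have h : HasDerivAt (hamExp A D Q) (fromBlocks (-Aᵀ) D Q A * hamExp A D Q t) t :=
    hasDerivAt_matrix_exp _ t
  have h' := h
  conv at h' => enter [2]; rw [← fromBlocks_toBlocks (hamExp A D Q t), fromBlocks_multiply]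
  have he := fun i j => hasDerivAt_pi.1 (hasDerivAt_pi.1 h' i) j
  exact ⟨⟨hasDerivAt_pi.2 fun i => hasDerivAt_pi.2 fun j => he (Sum.inl i) (Sum.inl j),
    hasDerivAt_pi.2 fun i => hasDerivAt_pi.2 fun j => he (Sum.inl i) (Sum.inr j)⟩,
    hasDerivAt_pi.2 fun i => hasDerivAt_pi.2 fun j => he (Sum.inr i) (Sum.inl j),
    hasDerivAt_pi.2 fun i => hasDerivAt_pi.2 fun j => he (Sum.inr i) (Sum.inr j)⟩

theorem hasDerivAt_flowX (A D Q S₀ : Matrix ι ι ℝ) (t : ℝ) :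
    HasDerivAt (flowX A D Q S₀) (-Aᵀ * flowX A D Q S₀ t + D * flowY A D Q S₀ t) t := by
  obtain ⟨⟨h1, h2⟩, -, -⟩ := hasDerivAt_hamExp_blocks (A := A) (D := D) (Q := Q) t
  refine (h1.add (h2.mul_const S₀)).congr_deriv ?_
  rw [flowX, flowY]
  noncomm_ring

theorem hasDerivAt_flowY (A D Q S₀ : Matrix ι ι ℝ) (t : ℝ) :
    HasDerivAt (flowY A D Q S₀) (Q * flowX A D Q S₀ t + A * flowY A D Q S₀ t) t := by
  obtain ⟨-, h1, h2⟩ := hasDerivAt_hamExp_blocks (A := A) (D := D) (Q := Q) t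
  refine (h1.add (h2.mul_const S₀)).congr_deriv ?_
  rw [flowX, flowY]
  noncomm_ring

theorem hamExp_zero : hamExp A D Q 0 = 1 := by simp [hamExp]

theorem flowX_zero : flowX A D Q S₀ 0 = 1 := by
  have : (fromBlocks 1 0 0 1 : Matrix (ι ⊕ ι) (ι ⊕ ι) ℝ) = 1 := fromBlocks_one
  rw [flowX, hamExp_zero, ← this, toBlocks_fromBlocks₁₁, toBlocks_fromBlocks₁₂, Matrix.zero_mul,
    add_zero]

theorem flowY_zero : flowY A D Q S₀ 0 = S₀ := by
  have : (fromBlocks 1 0 0 1 : Matrix (ι ⊕ ι) (ι ⊕ ι) ℝ) = 1 := fromBlocks_one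
  rw [flowY, hamExp_zero, ← this, toBlocks_fromBlocks₂₁, toBlocks_fromBlocks₂₂, Matrix.one_mul,
    zero_add]

theorem continuous_flowX : Continuous (flowX A D Q S₀) :=
  continuous_iff_continuousAt.2 fun t => (hasDerivAt_flowX A D Q S₀ t).continuousAt

theorem continuous_flowY : Continuous (flowY A D Q S₀) :=
  continuous_iff_continuousAt.2 fun t => (hasDerivAt_flowY A D Q S₀ t).continuousAt

theorem matrix_const_of_hasDerivAt_zero {f : ℝ → Matrix ι ι ℝ} (h : ∀ t, HasDerivAt f 0 t)
    (s t : ℝ) : f s = f t :=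
  is_const_of_deriv_eq_zero (fun t => (h t).differentiableAt) (fun t => (h t).deriv) s t

/-- The terms containing A cancel, which leaves a sum of two nonnegative squares. This monotone
energy is the source of all positivity of the flow. -/
theorem hasDerivAt_flowXY (hD : Dᵀ = D) (t : ℝ) :
    HasDerivAt (fun s => (flowX A D Q S₀ s)ᵀ * flowY A D Q S₀ s)
      ((flowY A D Q S₀ t)ᵀ * D * flowY A D Q S₀ t
        + (flowX A D Q S₀ t)ᵀ * Q * flowX A D Q S₀ t) t := by
  refine ((hasDerivAt_flowX A D Q S₀ t).matrix_transpose.mul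
    (hasDerivAt_flowY A D Q S₀ t)).congr_deriv ?_
  simp only [Matrix.transpose_add, Matrix.transpose_mul, Matrix.transpose_neg,
    Matrix.transpose_transpose, hD]
  noncomm_ring

/-- The antisymmetric part is conserved by the Hamiltonian system and vanishes at time 0. -/
theorem flowXY_symm (hD : Dᵀ = D) (hQ : Qᵀ = Q) (hS : S₀ᵀ = S₀) (t : ℝ) :
    ((flowX A D Q S₀ t)ᵀ * flowY A D Q S₀ t)ᵀ = (flowX A D Q S₀ t)ᵀ * flowY A D Q S₀ t := by
  have h : ∀ t, HasDerivAt (fun s => ((flowX A D Q S₀ s)ᵀ * flowY A D Q S₀ s)ᵀ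
      - (flowX A D Q S₀ s)ᵀ * flowY A D Q S₀ s) 0 t := by
    intro t
    have h1 := hasDerivAt_flowXY (A := A) (Q := Q) (S₀ := S₀) hD t
    refine (h1.matrix_transpose.sub h1).congr_deriv ?_
    simp only [Matrix.transpose_add, Matrix.transpose_mul, Matrix.transpose_transpose, hD, hQ,
      Matrix.mul_assoc, sub_self]
  have h1 := matrix_const_of_hasDerivAt_zero h t 0
  simp only [flowX_zero, flowY_zero, Matrix.transpose_one, Matrix.one_mul, hS, sub_self] at h1
  exact sub_eq_zero.1 h1

theorem quadForm_conj (M B : Matrix ι ι ℝ) (v : ι → ℝ) :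
    v ⬝ᵥ (Bᵀ * M * B) *ᵥ v = (B *ᵥ v) ⬝ᵥ M *ᵥ (B *ᵥ v) := by
  rw [Matrix.mul_assoc, ← Matrix.mulVec_mulVec, ← Matrix.mulVec_mulVec, Matrix.dotProduct_mulVec v,
    Matrix.vecMul_transpose]

theorem mulVec_eq_zero_of_quadForm {M : Matrix ι ι ℝ} (hM : M.PosSemidef) {v : ι → ℝ}
    (h : v ⬝ᵥ M *ᵥ v = 0) : M *ᵥ v = 0 :=
  (hM.dotProduct_mulVec_zero_iff v).1 (by simpa using h)

theorem monotone_flowXY (hD : D.PosSemidef) (hQ : Q.PosSemidef) (v : ι → ℝ) :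
    Monotone fun t => v ⬝ᵥ ((flowX A D Q S₀ t)ᵀ * flowY A D Q S₀ t) *ᵥ v :=
  monotone_of_hasDerivAt_nonneg
    (fun t => (hasDerivAt_flowXY (transpose_eq_of_posSemidef hD) t).matrix_quadForm v)
    fun _ => quadForm_nonneg ((posSemidef_conj' hD _).add (posSemidef_conj' hQ _)) v

/-- Where the energy `vᵀ Xᵀ Y v` vanishes, the trajectory is not observed and not excited. -/
theorem flow_degenerate (hD : D.PosSemidef) (hQ : Q.PosSemidef) (hS : S₀.PosSemidef) {t : ℝ}
    {v : ι → ℝ} (hv : v ⬝ᵥ ((flowX A D Q S₀ t)ᵀ * flowY A D Q S₀ t) *ᵥ v = 0) :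
    (∀ s ∈ Set.Ioo 0 t, Q *ᵥ (flowX A D Q S₀ s *ᵥ v) = 0) ∧
      ∀ s ∈ Set.Icc 0 t, flowX A D Q S₀ s *ᵥ v = exp (s • (-Aᵀ)) *ᵥ v := by
  have hm := monotone_flowXY (A := A) (S₀ := S₀) hD hQ v
  -- The energy is nondecreasing, starts at vᵀS₀v ≥ 0 and ends at 0, so it is zero throughout.
  have hz : ∀ s ∈ Set.Ioo 0 t, v ⬝ᵥ ((flowX A D Q S₀ s)ᵀ * flowY A D Q S₀ s) *ᵥ v = 0 := by
    intro s hs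
    have h1 := hm hs.1.le
    have h2 := hm hs.2.le
    simp only [flowX_zero, flowY_zero, Matrix.transpose_one, Matrix.one_mul] at h1
    linarith [quadForm_nonneg hS v]
  have hd : ∀ s ∈ Set.Ioo 0 t, D *ᵥ (flowY A D Q S₀ s *ᵥ v) = 0 ∧
      Q *ᵥ (flowX A D Q S₀ s *ᵥ v) = 0 := by
    intro s hs
    have h1 := (hasDerivAt_flowXY (A := A) (Q := Q) (S₀ := S₀)
      (transpose_eq_of_posSemidef hD) s).matrix_quadForm v
    have h2 := h1.unique ((hasDerivAt_const s (0 : ℝ)).congr_of_eventuallyEq (by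
      filter_upwards [Ioo_mem_nhds hs.1 hs.2] with u hu using hz u hu))
    rw [Matrix.add_mulVec, dotProduct_add, quadForm_conj, quadForm_conj] at h2
    have h3 := quadForm_nonneg hD (flowY A D Q S₀ s *ᵥ v)
    have h4 := quadForm_nonneg hQ (flowX A D Q S₀ s *ᵥ v)
    exact ⟨mulVec_eq_zero_of_quadForm hD (by linarith),
      mulVec_eq_zero_of_quadForm hQ (by linarith)⟩
  refine ⟨fun s hs => (hd s hs).2, fun s hs => ?_⟩
  have hc : Continuous fun s => exp (s • Aᵀ) *ᵥ (flowX A D Q S₀ s *ᵥ v) :=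
    (continuous_matrix_exp_smul Aᵀ).matrix_mulVec (continuous_flowX.matrix_mulVec continuous_const)
  -- Since DY(u)v = 0, the equation for X(u)v reduces to that of exp(-uAᵀ)v.
  have hdv : ∀ u ∈ Set.Ioo 0 t,
      HasDerivAt (fun s => exp (s • Aᵀ) *ᵥ (flowX A D Q S₀ s *ᵥ v)) 0 u := by
    intro u hu
    have h1 := ((hasDerivAt_matrix_exp' Aᵀ u).mul (hasDerivAt_flowX A D Q S₀ u)).matrix_mulVec v
    have h2 : HasDerivAt (fun s => exp (s • Aᵀ) *ᵥ (flowX A D Q S₀ s *ᵥ v)) _ u :=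
      h1.congr_of_eventuallyEq (.of_forall fun s => Matrix.mulVec_mulVec _ _ _)
    refine h2.congr_deriv ?_
    have : exp (u • Aᵀ) * Aᵀ * flowX A D Q S₀ u
        + exp (u • Aᵀ) * (-Aᵀ * flowX A D Q S₀ u + D * flowY A D Q S₀ u)
        = exp (u • Aᵀ) * (D * flowY A D Q S₀ u) := by noncomm_ring
    rw [this, ← Matrix.mulVec_mulVec, ← Matrix.mulVec_mulVec, (hd u hu).1, Matrix.mulVec_zero]
  have hconst : exp (s • Aᵀ) *ᵥ (flowX A D Q S₀ s *ᵥ v) = v := by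
    have h0 : exp ((0 : ℝ) • Aᵀ) *ᵥ (flowX A D Q S₀ 0 *ᵥ v) = v := by simp [flowX_zero]
    rcases hs.1.eq_or_lt with rfl | hs0
    · exact h0
    funext i
    by_contra hne
    have hci : Continuous fun s => (exp (s • Aᵀ) *ᵥ (flowX A D Q S₀ s *ᵥ v)) i :=
      (continuous_apply i).comp hc
    -- The zero derivative is known only on the open interval, so the mean value theorem is applied
    -- coordinatewise, with continuity at the ends.
    obtain ⟨u, hu, hu'⟩ := exists_hasDerivAt_eq_slope _ (fun _ => 0) hs0 hci.continuousOn
      (fun u hu => hasDerivAt_pi.1 (hdv u ⟨hu.1, hu.2.trans_le hs.2⟩) i)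
    rw [eq_comm, div_eq_zero_iff] at hu'
    rcases hu' with hu' | hu'
    · exact hne ((sub_eq_zero.1 hu').trans (congrFun h0 i))
    · linarith
  conv_rhs => rw [← hconst]
  rw [Matrix.mulVec_mulVec, matrix_exp_neg_mul, Matrix.one_mulVec]

/-- If X(t)v = 0, the energy of v vanishes at t; the degenerate case then gives X(t)v = exp(-tAᵀ)v,
so v = 0. Hence the Riccati solution has no finite escape time. -/
theorem isUnit_flowX (hD : D.PosSemidef) (hQ : Q.PosSemidef) (hS : S₀.PosSemidef) {t : ℝ}
    (ht : 0 ≤ t) : IsUnit (flowX A D Q S₀ t) := by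
  rcases ht.eq_or_lt with rfl | ht
  · rw [flowX_zero]; exact isUnit_one
  · rw [← Matrix.mulVec_injective_iff_isUnit]
    refine (injective_iff_map_eq_zero (flowX A D Q S₀ t).mulVecLin).2 fun v hv => ?_
    rw [Matrix.mulVecLin_apply] at hv
    have h1 : v ⬝ᵥ ((flowX A D Q S₀ t)ᵀ * flowY A D Q S₀ t) *ᵥ v = 0 := by
      rw [← Matrix.mulVec_mulVec, Matrix.dotProduct_mulVec, Matrix.vecMul_transpose, hv,
        zero_dotProduct]
    have h2 := (flow_degenerate hD hQ hS h1).2 t ⟨ht.le, le_rfl⟩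
    rw [hv] at h2
    have h3 := congrArg (fun x => exp (t • Aᵀ) *ᵥ x) h2
    simpa only [Matrix.mulVec_mulVec, matrix_exp_mul_neg, Matrix.one_mulVec,
      Matrix.mulVec_zero] using h3.symm

theorem flow_mul_flowX (hD : D.PosSemidef) (hQ : Q.PosSemidef) (hS : S₀.PosSemidef) {t : ℝ}
    (ht : 0 ≤ t) : flow A D Q S₀ t * flowX A D Q S₀ t = flowY A D Q S₀ t := by
  rw [flow, Matrix.mul_assoc, Matrix.nonsing_inv_mul _
    ((Matrix.isUnit_iff_isUnit_det _).1 (isUnit_flowX hD hQ hS ht)), Matrix.mul_one]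

theorem flow_zero : flow A D Q S₀ 0 = S₀ := by simp [flow, flowX_zero, flowY_zero]

theorem posSemidef_flowXY (hD : D.PosSemidef) (hQ : Q.PosSemidef) (hS : S₀.PosSemidef) {t : ℝ}
    (ht : 0 ≤ t) : ((flowX A D Q S₀ t)ᵀ * flowY A D Q S₀ t).PosSemidef := by
  refine posSemidef_iff_quadForm.2 ⟨flowXY_symm (transpose_eq_of_posSemidef hD)
    (transpose_eq_of_posSemidef hQ) (transpose_eq_of_posSemidef hS) t, fun v => ?_⟩
  have h1 := monotone_flowXY (A := A) (S₀ := S₀) hD hQ v ht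
  simp only [flowX_zero, flowY_zero, Matrix.transpose_one, Matrix.one_mul] at h1
  exact (quadForm_nonneg hS v).trans h1

/-- YX⁻¹ is congruent to the energy XᵀY, so it inherits symmetry and positivity. -/
theorem flow_eq_conj (hD : D.PosSemidef) (hQ : Q.PosSemidef) (hS : S₀.PosSemidef) {t : ℝ}
    (ht : 0 ≤ t) : flow A D Q S₀ t = (flowX A D Q S₀ t)⁻¹ᵀ
      * ((flowX A D Q S₀ t)ᵀ * flowY A D Q S₀ t) * (flowX A D Q S₀ t)⁻¹ := by
  have h := Matrix.mul_nonsing_inv _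
    ((Matrix.isUnit_iff_isUnit_det _).1 (isUnit_flowX (A := A) hD hQ hS ht))
  rw [← Matrix.mul_assoc (_)ᵀ, ← Matrix.transpose_mul, h, Matrix.transpose_one, Matrix.one_mul,
    flow]

theorem posSemidef_flow (hD : D.PosSemidef) (hQ : Q.PosSemidef) (hS : S₀.PosSemidef) {t : ℝ}
    (ht : 0 ≤ t) : (flow A D Q S₀ t).PosSemidef := by
  rw [flow_eq_conj hD hQ hS ht]
  exact posSemidef_conj' (posSemidef_flowXY hD hQ hS ht) _

/-- A vector of zero energy would satisfy Q exp(-sAᵀ)v = 0 on (0, t), which controllability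
excludes. -/
theorem posDef_flow (hD : D.PosSemidef) (hQ : Q.PosSemidef) (hS : S₀.PosSemidef)
    (hctr : ObservablePair Q Aᵀ) {t : ℝ} (ht : 0 < t) : (flow A D Q S₀ t).PosDef := by
  have h1 : ((flowX A D Q S₀ t)ᵀ * flowY A D Q S₀ t).PosDef := by
    have h2 := posSemidef_flowXY (A := A) hD hQ hS ht.le
    refine posDef_iff_quadForm.2 ⟨transpose_eq_of_posSemidef h2, fun v hv => ?_⟩
    refine lt_of_le_of_ne (quadForm_nonneg h2 v) fun h3 => hv ?_
    obtain ⟨h4, h5⟩ := flow_degenerate hD hQ hS h3.symm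
    refine hctr.neg.eq_zero_of_exp ht fun s hs => ?_
    rw [← Matrix.mulVec_mulVec, ← h5 s ⟨hs.1.le, hs.2.le⟩, h4 s hs]
  rw [flow_eq_conj hD hQ hS ht.le]
  have hu := isUnit_flowX (A := A) hD hQ hS ht.le
  have h3 := h1.conjTranspose_mul_mul_same (B := (flowX A D Q S₀ t)⁻¹)
    (Matrix.mulVec_injective_iff_isUnit.2 ((Matrix.isUnit_nonsing_inv_iff).2 hu))
  rwa [conjTranspose_eq_transpose_of_trivial] at h3

/-! ### The flow as the unique solution of the Riccati equation. -/

theorem hasDerivAt_flow (hD : D.PosSemidef) (hQ : Q.PosSemidef) (hS : S₀.PosSemidef) {t : ℝ}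
    (ht : 0 ≤ t) : HasDerivAt (flow A D Q S₀) (ric A D Q (flow A D Q S₀ t)) t := by
  have hu := isUnit_flowX (A := A) hD hQ hS ht
  obtain ⟨u, hu'⟩ := hu
  have hinv : ((u⁻¹ : (Matrix ι ι ℝ)ˣ) : Matrix ι ι ℝ) = (flowX A D Q S₀ t)⁻¹ := by
    rw [← hu', Matrix.coe_units_inv]
  have h1 : HasDerivAt (fun s => (flowX A D Q S₀ s)⁻¹)
      (-((flowX A D Q S₀ t)⁻¹ * (-Aᵀ * flowX A D Q S₀ t + D * flowY A D Q S₀ t)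
        * (flowX A D Q S₀ t)⁻¹)) t := by
    have h2 := hasFDerivAt_ringInverse (𝕜 := ℝ) u
    rw [hu'] at h2
    have h3 := h2.comp_hasDerivAt t (hasDerivAt_flowX A D Q S₀ t)
    refine (h3.congr_deriv ?_).congr_of_eventuallyEq
      (.of_forall fun s => Matrix.nonsing_inv_eq_ringInverse _)
    simp [hinv, ContinuousLinearMap.mulLeftRight_apply]
  refine ((hasDerivAt_flowY A D Q S₀ t).mul h1).congr_deriv ?_
  have h4 : flowX A D Q S₀ t * (flowX A D Q S₀ t)⁻¹ = 1 := Matrix.mul_nonsing_inv _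
    ((Matrix.isUnit_iff_isUnit_det _).1 (isUnit_flowX (A := A) hD hQ hS ht))
  calc _ = Q * (flowX A D Q S₀ t * (flowX A D Q S₀ t)⁻¹) + A * flow A D Q S₀ t
        + flow A D Q S₀ t * Aᵀ * (flowX A D Q S₀ t * (flowX A D Q S₀ t)⁻¹)
        - flow A D Q S₀ t * D * flow A D Q S₀ t := by rw [flow]; noncomm_ring
    _ = _ := by rw [h4, ric]; noncomm_ring

/-- For any solution S, the matrix Z = Y - SX satisfies the linear equation Z' = (A - SD)Z with Z(0)
= 0, so Grönwall gives Z = 0. Neither symmetry nor positivity of S is assumed at later times. -/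
theorem eq_flow_of_hasDerivWithinAt (hD : D.PosSemidef) (hQ : Q.PosSemidef)
    (hS : S₀.PosSemidef) {S : ℝ → Matrix ι ι ℝ} (h0 : S 0 = S₀)
    (h : ∀ t, 0 ≤ t → HasDerivWithinAt S (ric A D Q (S t)) (Set.Ici 0) t) {t : ℝ} (ht : 0 ≤ t) :
    S t = flow A D Q S₀ t := by
  have hSc : ContinuousOn S (Set.Icc 0 t) := fun s hs =>
    (h s hs.1).continuousWithinAt.mono Set.Icc_subset_Ici_self
  have hZ : ∀ s, 0 ≤ s → HasDerivWithinAt (fun s => flowY A D Q S₀ s - S s * flowX A D Q S₀ s)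
      ((A - S s * D) * (flowY A D Q S₀ s - S s * flowX A D Q S₀ s)) (Set.Ici 0) s := by
    intro s hs
    refine ((hasDerivAt_flowY A D Q S₀ s).hasDerivWithinAt.sub
      ((h s hs).mul (hasDerivAt_flowX A D Q S₀ s).hasDerivWithinAt)).congr_deriv ?_
    rw [ric]
    noncomm_ring
  obtain ⟨C, hC⟩ : ∃ C, ∀ s ∈ Set.Icc 0 t, ‖A - S s * D‖ ≤ C :=
    isCompact_Icc.exists_bound_of_continuousOn
      (continuousOn_const.sub (hSc.mul continuousOn_const))
  have hz : flowY A D Q S₀ t - S t * flowX A D Q S₀ t = 0 := by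
    have hcont : ContinuousOn (fun s => flowY A D Q S₀ s - S s * flowX A D Q S₀ s)
        (Set.Icc 0 t) := fun s hs =>
      (hZ s hs.1).continuousWithinAt.mono Set.Icc_subset_Ici_self
    have hg := norm_le_gronwallBound_of_norm_deriv_right_le (δ := 0) (K := C) (ε := 0)
      hcont
      (fun s hs => (hZ s hs.1).mono (Set.Ici_subset_Ici.2 hs.1))
      (by simp [flowX_zero, flowY_zero, h0])
      (fun s hs => by
        rw [add_zero]
        exact (norm_mul_le _ _).trans
          (mul_le_mul_of_nonneg_right (hC s ⟨hs.1, hs.2.le⟩) (norm_nonneg _)))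
      t ⟨ht, le_rfl⟩
    rw [gronwallBound_ε0_δ0] at hg
    exact norm_le_zero_iff.1 hg
  have h4 : flowX A D Q S₀ t * (flowX A D Q S₀ t)⁻¹ = 1 := Matrix.mul_nonsing_inv _
    ((Matrix.isUnit_iff_isUnit_det _).1 (isUnit_flowX (A := A) hD hQ hS ht))
  rw [flow, sub_eq_zero.1 hz, Matrix.mul_assoc, h4, Matrix.mul_one]

theorem flow_add (hD : D.PosSemidef) (hQ : Q.PosSemidef) (hS : S₀.PosSemidef) {s t : ℝ}
    (hs : 0 ≤ s) (ht : 0 ≤ t) : flow A D Q S₀ (s + t) = flow A D Q (flow A D Q S₀ s) t := by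
  refine eq_flow_of_hasDerivWithinAt hD hQ (posSemidef_flow hD hQ hS hs)
    (S := fun t => flow A D Q S₀ (s + t)) (by simp) (fun u hu => ?_) ht
  exact ((hasDerivAt_flow hD hQ hS (add_nonneg hs hu)).comp_const_add s u).hasDerivWithinAt

theorem flow_nat (hD : D.PosSemidef) (hQ : Q.PosSemidef) (hS : S₀.PosSemidef) (k : ℕ) :
    flow A D Q S₀ k = (fun S => flow A D Q S 1)^[k] S₀ := by
  induction k with
  | zero => simp [flow_zero]
  | succ k ih =>
    rw [Function.iterate_succ_apply', ← ih, Nat.cast_succ,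
      flow_add hD hQ hS (Nat.cast_nonneg k) zero_le_one]

/-- Let X, Y be the Hamiltonian data started at S and U the orbit of T. Then XᵀUX - XᵀY has
derivative -(UX - Y)ᵀD(UX - Y) ≤ 0 and starts at T - S. Undoing the congruence by X(t) gives the
majorant, with B = X(t)⁻ᵀ. -/
theorem isSupported_flow (hD : D.PosSemidef) (hQ : Q.PosSemidef) {t : ℝ} (ht : 0 ≤ t) :
    IsSupported fun S => flow A D Q S t := by
  refine ⟨fun S hS => posSemidef_flow hD hQ hS ht, fun S hS =>
    ⟨(flowX A D Q S t)⁻¹ᵀ, fun T hT => ?_⟩⟩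
  have hDt := transpose_eq_of_posSemidef hD
  have hQt := transpose_eq_of_posSemidef hQ
  set X := flowX A D Q S with hX
  set Y := flowY A D Q S with hY
  set U := flow A D Q T with hU
  have hder : ∀ s, 0 ≤ s → HasDerivAt (fun s => (X s)ᵀ * U s * X s - (X s)ᵀ * Y s)
      (-((U s * X s - Y s)ᵀ * D * (U s * X s - Y s))) s := by
    intro s hs
    have hUt : (U s)ᵀ = U s := transpose_eq_of_posSemidef (posSemidef_flow hD hQ hT hs)
    have h1 := hasDerivAt_flowX A D Q S s
    refine (((h1.matrix_transpose.mul (hasDerivAt_flow hD hQ hT hs)).mul h1).sub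
      (hasDerivAt_flowXY hDt s)).congr_deriv ?_
    simp only [ric, Matrix.transpose_add, Matrix.transpose_sub, Matrix.transpose_mul,
      Matrix.transpose_neg, Matrix.transpose_transpose, hDt, ← hX, ← hY, ← hU, hUt, Pi.mul_apply]
    noncomm_ring
  have hPt : ∀ s, 0 ≤ s → ((X s)ᵀ * U s * X s - (X s)ᵀ * Y s)ᵀ
      = (X s)ᵀ * U s * X s - (X s)ᵀ * Y s := by
    intro s hs
    rw [Matrix.transpose_sub, flowXY_symm hDt hQt (transpose_eq_of_posSemidef hS),
      transpose_eq_of_posSemidef (posSemidef_conj' (posSemidef_flow hD hQ hT hs) _)]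
  have hle : (X t)ᵀ * U t * X t - (X t)ᵀ * Y t ≤ T - S := by
    rw [le_iff_quadForm (hPt t ht) (by
      rw [Matrix.transpose_sub, transpose_eq_of_posSemidef hS, transpose_eq_of_posSemidef hT])]
    intro v
    have hanti := antitoneOn_of_hasDerivWithinAt_nonpos (convex_Icc 0 t)
      (f := fun s => v ⬝ᵥ ((X s)ᵀ * U s * X s - (X s)ᵀ * Y s) *ᵥ v)
      (f' := fun s => v ⬝ᵥ (-((U s * X s - Y s)ᵀ * D * (U s * X s - Y s))) *ᵥ v)
      (fun s hs => ((hder s hs.1).matrix_quadForm v).continuousAt.continuousWithinAt)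
      (fun s hs => ((hder s (interior_subset hs).1).matrix_quadForm v).hasDerivWithinAt)
      (fun s _ => by
        rw [Matrix.neg_mulVec, dotProduct_neg, neg_nonpos]
        exact quadForm_nonneg (posSemidef_conj' hD _) v)
    have := hanti (Set.left_mem_Icc.2 ht) (Set.right_mem_Icc.2 ht) ht
    simpa [hX, hY, hU, flowX_zero, flowY_zero, flow_zero] using this
  have h4 : X t * (X t)⁻¹ = 1 := Matrix.mul_nonsing_inv _
    ((Matrix.isUnit_iff_isUnit_det _).1 (isUnit_flowX (A := A) hD hQ hS ht))
  have h5 : (X t)⁻¹ᵀ * (X t)ᵀ = 1 := by rw [← Matrix.transpose_mul, h4, Matrix.transpose_one]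
  have h6 := conj_le_conj hle (X t)⁻¹ᵀ
  have h7 : (X t)⁻¹ᵀ * ((X t)ᵀ * U t * X t - (X t)ᵀ * Y t) * (X t)⁻¹ᵀᵀ = U t - flow A D Q S t := by
    rw [Matrix.transpose_transpose, flow, ← hX, ← hY]
    calc _ = ((X t)⁻¹ᵀ * (X t)ᵀ) * (U t * (X t * (X t)⁻¹) - Y t * (X t)⁻¹) := by noncomm_ring
      _ = _ := by rw [h4, h5, Matrix.one_mul, Matrix.mul_one]
  rw [h7] at h6
  exact sub_le_iff_le_add'.1 h6

/-- The Riccati operator is transported by the flow. -/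
theorem ric_flow_conj (hD : D.PosSemidef) (hQ : Q.PosSemidef) (hS : S₀.PosSemidef) {t : ℝ}
    (ht : 0 ≤ t) : (flowX A D Q S₀ t)ᵀ * ric A D Q (flow A D Q S₀ t) * flowX A D Q S₀ t
      = ric A D Q S₀ := by
  have hDt := transpose_eq_of_posSemidef hD
  have hQt := transpose_eq_of_posSemidef hQ
  set X := flowX A D Q S₀ with hX
  set Y := flowY A D Q S₀ with hY
  -- This expression is the Hamiltonian, a conserved quantity; after substituting Y = SX it becomes
  -- Xᵀ (ric S) X.
  have hder : ∀ s, HasDerivAt (fun s => (X s)ᵀ * A * Y s + (Y s)ᵀ * Aᵀ * X s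
      - (Y s)ᵀ * D * Y s + (X s)ᵀ * Q * X s) 0 s := by
    intro s
    have h1 := hasDerivAt_flowX A D Q S₀ s
    have h2 := hasDerivAt_flowY A D Q S₀ s
    have h3 := h1.matrix_transpose
    have h4 := h2.matrix_transpose
    refine (((((h3.mul_const A).mul h2).add ((h4.mul_const Aᵀ).mul h1)).sub
      ((h4.mul_const D).mul h2)).add ((h3.mul_const Q).mul h1)).congr_deriv ?_
    simp only [Matrix.transpose_add, Matrix.transpose_mul,
      Matrix.transpose_neg, Matrix.transpose_transpose, hDt, hQt]
    noncomm_ring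
  have h1 := matrix_const_of_hasDerivAt_zero hder t 0
  have hXY : flow A D Q S₀ t * X t = Y t := flow_mul_flowX hD hQ hS ht
  have hYt : (Y t)ᵀ = (X t)ᵀ * flow A D Q S₀ t := by
    rw [← hXY, Matrix.transpose_mul, transpose_eq_of_posSemidef (posSemidef_flow hD hQ hS ht)]
  calc _ = (X t)ᵀ * A * (flow A D Q S₀ t * X t) + (X t)ᵀ * flow A D Q S₀ t * Aᵀ * X t
        - (X t)ᵀ * flow A D Q S₀ t * D * (flow A D Q S₀ t * X t) + (X t)ᵀ * Q * X t := by
        rw [ric]; noncomm_ring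
    _ = _ := by
        rw [hXY, ← hYt, h1]
        simp [hX, hY, flowX_zero, flowY_zero, ric, transpose_eq_of_posSemidef hS]

/-- The velocity at time u is congruent to the initial velocity by `ric_flow_conj`, so it keeps its
sign. -/
theorem flow_monotone_of_nonneg (hD : D.PosSemidef) (hQ : Q.PosSemidef) (hS : S₀.PosSemidef)
    (h : (ric A D Q S₀).PosSemidef) {s t : ℝ} (hs : 0 ≤ s) (hst : s ≤ t) :
    flow A D Q S₀ s ≤ flow A D Q S₀ t := by
  have hp := fun u (hu : 0 ≤ u) => transpose_eq_of_posSemidef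
    (posSemidef_flow (A := A) hD hQ hS hu)
  rw [le_iff_quadForm (hp s hs) (hp t (hs.trans hst))]
  intro v
  refine monotoneOn_of_hasDerivWithinAt_nonneg (convex_Ici 0)
    (f := fun s => v ⬝ᵥ flow A D Q S₀ s *ᵥ v)
    (f' := fun s => v ⬝ᵥ ric A D Q (flow A D Q S₀ s) *ᵥ v)
    (fun u hu => ((hasDerivAt_flow hD hQ hS hu).matrix_quadForm v).continuousAt.continuousWithinAt)
    (fun u hu => ((hasDerivAt_flow hD hQ hS
      (interior_subset hu)).matrix_quadForm v).hasDerivWithinAt)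
    (fun u hu => ?_) hs (hs.trans hst) hst
  have h1 : 0 ≤ ric A D Q (flow A D Q S₀ u) := by
    refine le_of_conj_le (isUnit_flowX (A := A) hD hQ hS (interior_subset hu)) ?_
    rw [ric_flow_conj hD hQ hS (interior_subset hu), Matrix.mul_zero, Matrix.zero_mul]
    simpa [Matrix.le_iff] using h
  simpa using quadForm_le_of_le h1 v

theorem flow_le_of_nonpos (hD : D.PosSemidef) (hQ : Q.PosSemidef) (hS : S₀.PosSemidef)
    (h : (-(ric A D Q S₀)).PosSemidef) {t : ℝ} (ht : 0 ≤ t) : flow A D Q S₀ t ≤ S₀ := by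
  rw [le_iff_quadForm (transpose_eq_of_posSemidef (posSemidef_flow hD hQ hS ht))
    (transpose_eq_of_posSemidef hS)]
  intro v
  have key := antitoneOn_of_hasDerivWithinAt_nonpos (convex_Ici 0)
    (f := fun s => v ⬝ᵥ flow A D Q S₀ s *ᵥ v)
    (f' := fun s => v ⬝ᵥ ric A D Q (flow A D Q S₀ s) *ᵥ v)
    (fun u hu => ((hasDerivAt_flow hD hQ hS hu).matrix_quadForm v).continuousAt.continuousWithinAt)
    (fun u hu => ((hasDerivAt_flow hD hQ hS
      (interior_subset hu)).matrix_quadForm v).hasDerivWithinAt)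
    (fun u hu => by
      have h1 : ric A D Q (flow A D Q S₀ u) ≤ 0 := by
        refine le_of_conj_le (isUnit_flowX (A := A) hD hQ hS (interior_subset hu)) ?_
        rw [ric_flow_conj hD hQ hS (interior_subset hu), Matrix.mul_zero, Matrix.zero_mul]
        simpa [Matrix.le_iff] using h
      simpa using quadForm_le_of_le h1 v) (Set.self_mem_Ici) ht ht
  simpa [flow_zero] using key

theorem flow_of_ric_eq_zero (hD : D.PosSemidef) (hQ : Q.PosSemidef) (hS : S₀.PosSemidef)
    (h : ric A D Q S₀ = 0) {t : ℝ} (ht : 0 ≤ t) : flow A D Q S₀ t = S₀ := by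
  refine (eq_flow_of_hasDerivWithinAt hD hQ hS (S := fun _ => S₀) rfl (fun u _ => ?_) ht).symm
  rw [h]
  exact hasDerivWithinAt_const _ _ _

theorem continuous_ric : Continuous (ric A D Q) := by
  unfold ric
  fun_prop

/-- Under observability and controllability the Riccati flow converges from every initial value
to the same solution of the algebraic Riccati equation. -/
theorem exists_tendsto_flow (hD : D.PosSemidef) (hQ : Q.PosSemidef)
    (hobs : ObservablePair D A) (hctr : ObservablePair Q Aᵀ) :
    ∃ F : Matrix ι ι ℝ, F.PosSemidef ∧ ric A D Q F = 0 ∧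
      ∀ S : Matrix ι ι ℝ, S.PosSemidef → Tendsto (flow A D Q S) atTop (𝓝 F) := by
  obtain ⟨U, hU, hUr⟩ := exists_strict_supersolution (A := A) hD hQ hobs
  have h0 : (ric A D Q 0).PosSemidef := by simpa [ric] using hQ
  -- Monotonicity in the initial value puts the orbit of 0 below the orbit of U, which decreases
  -- from U.
  have hle : ∀ t, 0 ≤ t → flow A D Q 0 t ≤ U := fun t ht =>
    ((isSupported_flow hD hQ ht).mono .zero (by simpa [Matrix.le_iff] using hU.posSemidef)).trans
      (flow_le_of_nonpos hD hQ hU.posSemidef hUr.posSemidef ht)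
  obtain ⟨F, -, hF, -, -⟩ := exists_tendsto_of_monotone (a₀ := (0 : ℝ))
    (fun s t hs hst => flow_monotone_of_nonneg hD hQ .zero h0 hs hst) hle
    (fun t ht => transpose_eq_of_posSemidef (posSemidef_flow (A := A) hD hQ .zero ht))
  have hFp : F.PosSemidef := by
    refine isClosed_posSemidef.mem_of_tendsto hF ?_
    filter_upwards [eventually_ge_atTop 0] with t ht using posSemidef_flow hD hQ .zero ht
  have hFr : ric A D Q F = 0 := by
    have h1 : Tendsto (fun t => ric A D Q (flow A D Q 0 t)) atTop (𝓝 (ric A D Q F)) :=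
      (continuous_ric.tendsto F).comp hF
    have h2 : Tendsto (fun t => flow A D Q 0 (t + 1) - flow A D Q 0 t) atTop (𝓝 0) := by
      simpa using (hF.comp (tendsto_atTop_add_const_right _ 1 tendsto_id)).sub hF
    funext i j
    have h1' : Tendsto (fun t => ric A D Q (flow A D Q 0 t) i j) atTop (𝓝 (ric A D Q F i j)) :=
      tendsto_pi_nhds.1 (tendsto_pi_nhds.1 h1 i) j
    have h2' : Tendsto (fun t => flow A D Q 0 (t + 1) i j - flow A D Q 0 t i j) atTop (𝓝 0) :=
      tendsto_pi_nhds.1 (tendsto_pi_nhds.1 h2 i) j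
    -- Each entry of the velocity equals, at some time in (t, t+1), the increment over that
    -- interval. Increments of a convergent orbit tend to 0, while the velocity tends to ric F.
    have h3 : ∀ t : ℝ, 0 ≤ t → ∃ c ∈ Set.Ioo t (t + 1), ric A D Q (flow A D Q 0 c) i j
        = flow A D Q 0 (t + 1) i j - flow A D Q 0 t i j := by
      intro t ht
      have hd : ∀ c, 0 ≤ c → HasDerivAt (fun s => flow A D Q 0 s i j)
          (ric A D Q (flow A D Q 0 c) i j) c := fun c hc =>
        hasDerivAt_pi.1 (hasDerivAt_pi.1 (hasDerivAt_flow hD hQ .zero hc) i) j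
      obtain ⟨c, hc, hc'⟩ := exists_hasDerivAt_eq_slope (fun s => flow A D Q 0 s i j)
        (fun c => ric A D Q (flow A D Q 0 c) i j) (lt_add_one t)
        (fun c hc => (hd c (ht.trans hc.1)).continuousAt.continuousWithinAt)
        (fun c hc => hd c (ht.trans hc.1.le))
      exact ⟨c, hc, by rw [hc']; simp⟩
    choose! c hc hc' using h3
    have h4 : Tendsto c atTop atTop := by
      refine tendsto_atTop_mono' _ ?_ tendsto_id
      filter_upwards [eventually_ge_atTop 0] with t ht using (hc t ht).1.le
    refine tendsto_nhds_unique ((h1'.comp h4).congr' ?_) h2'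
    filter_upwards [eventually_ge_atTop 0] with t ht using hc' t ht
  refine ⟨F, hFp, hFr, fun S hS => ?_⟩
  have hfix : ∀ t, 0 ≤ t → flow A D Q F t = F := fun t ht =>
    flow_of_ric_eq_zero hD hQ hFp hFr ht
  have hsup := isSupported_flow (A := A) hD hQ zero_le_one
  have hpos := posDef_flow (A := A) hD hQ .zero hctr one_pos
  have hFt := transpose_eq_of_posSemidef hFp
  have hFd : F.PosDef := by
    rw [← hfix 1 zero_le_one]
    exact posDef_flow hD hQ hFp hctr one_pos
  obtain ⟨δ, hδ0, hδ1, hδ, -⟩ := exists_smul_le hpos hFt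
  -- A common bound of the orbit on [0, 1] is needed to start the iteration at fractional times; a
  -- large multiple of U supplies it.
  obtain ⟨M, hM⟩ : ∃ M : Matrix ι ι ℝ, Mᵀ = M ∧ S ≤ M ∧
      ∀ t ∈ Set.Icc (0 : ℝ) 1, flow A D Q S t ≤ M := by
    obtain ⟨μ, hμ, hSμ⟩ := exists_le_smul hU (transpose_eq_of_posSemidef hS)
    have hμU := hU.smul (zero_lt_one.trans_le hμ)
    refine ⟨μ • U, transpose_eq_of_posSemidef hμU.posSemidef, hSμ, fun t ht => ?_⟩
    refine ((isSupported_flow hD hQ ht.1).mono hS hSμ).trans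
      (flow_le_of_nonpos hD hQ hμU.posSemidef ?_ ht.1)
    -- For μ ≥ 1 all three terms are nonnegative, so μU is again a supersolution.
    have e : -(ric A D Q (μ • U)) = μ • (-(ric A D Q U)) + (μ * (μ - 1)) • (U * D * U)
        + (μ - 1) • Q := by
      simp only [ric, Matrix.smul_mul, Matrix.mul_smul, smul_add, smul_neg, smul_sub, smul_smul]
      module
    rw [e]
    have hUD : (U * D * U).PosSemidef := by
      simpa [transpose_eq_of_posSemidef hU.posSemidef] using posSemidef_conj hD U
    exact ((hUr.posSemidef.smul (by linarith)).add (hUD.smul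
      (mul_nonneg (by linarith) (by linarith)))).add (hQ.smul (by linarith))
  obtain ⟨μ, hμ, hMμ⟩ := exists_le_smul hFd hM.1
  have hb : ∀ t : ℝ, 0 ≤ t → (1 - (1 - δ) ^ ⌊t⌋₊) • F ≤ flow A D Q S t ∧
      flow A D Q S t ≤ (1 + (1 - δ) ^ ⌊t⌋₊ * (μ - 1)) • F := by
    intro t ht
    have h1 : 0 ≤ t - ⌊t⌋₊ := sub_nonneg.2 (Nat.floor_le ht)
    have h2 : t - ⌊t⌋₊ ≤ 1 := by linarith [Nat.lt_floor_add_one t]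
    -- The fractional part of t is run first; the integer part is then an iterate of the time-one
    -- map from a point of the bounded piece of the orbit.
    have h3 : flow A D Q S t
        = (fun S => flow A D Q S 1)^[⌊t⌋₊] (flow A D Q S (t - ⌊t⌋₊)) := by
      rw [← flow_nat hD hQ (posSemidef_flow hD hQ hS h1), ← flow_add hD hQ hS h1
        (Nat.cast_nonneg _), sub_add_cancel]
    rw [h3]
    exact hsup.iterate_bounds hFp (hfix 1 zero_le_one) hδ0 hδ1 hδ hμ (posSemidef_flow hD hQ hS h1)
      ((hM.2.2 _ ⟨h1, h2⟩).trans hMμ) _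
  have hp : Tendsto (fun t : ℝ => (1 - δ) ^ ⌊t⌋₊) atTop (𝓝 0) :=
    (tendsto_pow_atTop_nhds_zero_of_lt_one (by linarith) (by linarith)).comp
      tendsto_nat_floor_atTop
  refine tendsto_of_le_of_le hFt (S := fun t => (1 - (1 - δ) ^ ⌊t⌋₊) • F)
    (U := fun t => (1 + (1 - δ) ^ ⌊t⌋₊ * (μ - 1)) • F) ?_ ?_ ?_ ?_ ?_
  · filter_upwards [eventually_ge_atTop 0] with t ht
    exact transpose_eq_of_posSemidef (posSemidef_flow hD hQ hS ht)
  · simpa using (hp.const_sub 1).smul_const F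
  · simpa using ((hp.mul_const (μ - 1)).const_add 1).smul_const F
  · filter_upwards [eventually_ge_atTop 0] with t ht using (hb t ht).1
  · filter_upwards [eventually_ge_atTop 0] with t ht using (hb t ht).2

end Flow


/-! ### The covariance recursion of the sampled system -/

section Sampled

open Matrix NormedSpace
open scoped MatrixOrder

set_option linter.unusedSectionVars false

attribute [local instance] Matrix.linftyOpNormedRing Matrix.linftyOpNormedAlgebra

variable {n m p N : ℕ} {A : Matrix (Fin n) (Fin n) ℝ} {G : Matrix (Fin n) (Fin m) ℝ}

theorem matrix_exp_smul_transpose {ι : Type*} [Fintype ι] [DecidableEq ι] (B : Matrix ι ι ℝ)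
    (t : ℝ) : exp (t • Bᵀ) = (exp (t • B))ᵀ := by
  rw [← Matrix.transpose_smul, Matrix.exp_transpose]

theorem noiseGramian_eq (A : Matrix (Fin n) (Fin n) ℝ) (G : Matrix (Fin n) (Fin m) ℝ) (h : ℝ) :
    noiseGramian A G h
      = ∫ s in (0 : ℝ)..h, (exp (s • Aᵀ))ᵀ * (G * Gᵀ) * exp (s • Aᵀ) := by
  ext a b
  rw [entry_intervalIntegral (continuous_gramian_integrand _ _)]
  simp only [noiseGramian, Matrix.of_apply, matrix_exp_smul_transpose, Matrix.transpose_transpose]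

theorem posDef_noiseGramian (hctr : ObservablePair (G * Gᵀ) Aᵀ) {h : ℝ} (hh : 0 < h) :
    (noiseGramian A G h).PosDef := by
  rw [noiseGramian_eq]
  have := posDef_gramian (posSemidef_mul_transpose G) hctr hh (ρ := fun _ => 1) continuous_const
    (fun s hs => one_pos)
  simpa only [one_smul] using this

theorem predictCov_eq (A : Matrix (Fin n) (Fin n) ℝ) (G : Matrix (Fin n) (Fin m) ℝ) (h : ℝ)
    (S : Matrix (Fin n) (Fin n) ℝ) :
    predictCov A G h S = exp (h • A) * S * (exp (h • A))ᵀ + noiseGramian A G h := by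
  rw [predictCov, matrix_exp_smul_transpose]

theorem posDef_predictCov (hctr : ObservablePair (G * Gᵀ) Aᵀ) {h : ℝ} (hh : 0 < h)
    {S : Matrix (Fin n) (Fin n) ℝ} (hS : S.PosSemidef) : (predictCov A G h S).PosDef := by
  rw [predictCov_eq]
  exact (posDef_noiseGramian hctr hh).posSemidef_add (posSemidef_conj hS _)

/-! ### Algebra of the information-form update. -/

theorem isUnit_det_of_posDef {P : Matrix (Fin n) (Fin n) ℝ} (hP : P.PosDef) : IsUnit P.det :=
  (Matrix.isUnit_iff_isUnit_det P).1 hP.isUnit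

theorem posDef_infoUpdate {P O : Matrix (Fin n) (Fin n) ℝ} (hP : P.PosDef) (hO : O.PosSemidef) :
    (P⁻¹ + O)⁻¹.PosDef :=
  (hP.inv.add_posSemidef hO).inv

theorem infoUpdate_add_left {P O : Matrix (Fin n) (Fin n) ℝ} (hP : P.PosDef)
    (hO : O.PosSemidef) : (P⁻¹ + O)⁻¹ + P * O * (P⁻¹ + O)⁻¹ = P := by
  have h1 : (P⁻¹ + O) * (P⁻¹ + O)⁻¹ = 1 :=
    Matrix.mul_nonsing_inv _ (isUnit_det_of_posDef (hP.inv.add_posSemidef hO))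
  have h2 : P * P⁻¹ = 1 := Matrix.mul_nonsing_inv _ (isUnit_det_of_posDef hP)
  calc _ = (P * P⁻¹) * (P⁻¹ + O)⁻¹ + P * O * (P⁻¹ + O)⁻¹ := by rw [h2, Matrix.one_mul]
    _ = P * ((P⁻¹ + O) * (P⁻¹ + O)⁻¹) := by noncomm_ring
    _ = P := by rw [h1, Matrix.mul_one]

theorem infoUpdate_add_right {P O : Matrix (Fin n) (Fin n) ℝ} (hP : P.PosDef)
    (hO : O.PosSemidef) : (P⁻¹ + O)⁻¹ + (P⁻¹ + O)⁻¹ * O * P = P := by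
  have h := congrArg Matrix.transpose (infoUpdate_add_left hP hO)
  simpa only [Matrix.transpose_add, Matrix.transpose_mul,
    transpose_eq_of_posSemidef hP.posSemidef, transpose_eq_of_posSemidef hO,
    transpose_eq_of_posSemidef (posDef_infoUpdate hP hO).posSemidef, ← Matrix.mul_assoc] using h

/-- The update in Joseph form. -/
theorem joseph_sub_infoUpdate {P O : Matrix (Fin n) (Fin n) ℝ} (hP : P.PosDef)
    (hO : O.PosSemidef) (K : Matrix (Fin n) (Fin n) ℝ) :
    (1 - K * O) * P * (1 - K * O)ᵀ + K * O * Kᵀ - (P⁻¹ + O)⁻¹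
      = (K - (P⁻¹ + O)⁻¹) * (O * P * O + O) * (K - (P⁻¹ + O)⁻¹)ᵀ := by
  set g := (P⁻¹ + O)⁻¹ with hg
  have hgt : gᵀ = g := transpose_eq_of_posSemidef (posDef_infoUpdate hP hO).posSemidef
  have hOt := transpose_eq_of_posSemidef hO
  have h1 : g + P * O * g = P := infoUpdate_add_left hP hO
  have h2 : g + g * O * P = P := infoUpdate_add_right hP hO
  have e1 : (O * P * O + O) * g = O * P := by
    calc _ = O * (g + P * O * g) := by noncomm_ring
      _ = _ := by rw [h1]
  have e2 : g * (O * P * O + O) = P * O := by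
    calc _ = (g + g * O * P) * O := by noncomm_ring
      _ = _ := by rw [h2]
  have e3 : P - g = g * O * P := by rw [sub_eq_iff_eq_add']; exact h2.symm
  rw [Matrix.transpose_sub, Matrix.transpose_sub, Matrix.transpose_mul, hOt, hgt,
    Matrix.transpose_one]
  -- Completing the square in K. With W = OPO + O one has Wg = OP and gW = PO, so the quadratic
  -- polynomial in K has its minimum at K = g, with remainder (K - g)W(K - g)ᵀ.
  calc _ = (P - g) - K * O * P - P * O * Kᵀ + K * (O * P * O + O) * Kᵀ := by noncomm_ring
    _ = g * (O * P) - K * (O * P) - P * O * Kᵀ + K * (O * P * O + O) * Kᵀ := by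
        rw [e3]; noncomm_ring
    _ = g * ((O * P * O + O) * g) - K * ((O * P * O + O) * g) - g * (O * P * O + O) * Kᵀ
        + K * (O * P * O + O) * Kᵀ := by rw [e1, e2]
    _ = _ := by noncomm_ring

/-- In Joseph form the gain that is optimal for P is merely admissible for T. With the gain frozen,
the updated covariance is affine in T and bounds the optimal update from above. -/
theorem infoUpdate_le {P T O : Matrix (Fin n) (Fin n) ℝ} (hP : P.PosDef) (hT : T.PosDef)
    (hO : O.PosSemidef) :
    (T⁻¹ + O)⁻¹ ≤ (P⁻¹ + O)⁻¹
      + (1 - (P⁻¹ + O)⁻¹ * O) * (T - P) * (1 - (P⁻¹ + O)⁻¹ * O)ᵀ := by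
  set g := (P⁻¹ + O)⁻¹
  have hOt := transpose_eq_of_posSemidef hO
  have h1 : (1 - g * O) * P * (1 - g * O)ᵀ + g * O * gᵀ = g := by
    have := joseph_sub_infoUpdate hP hO g
    rwa [sub_self, Matrix.zero_mul, Matrix.zero_mul, sub_eq_zero] at this
  have h2 := joseph_sub_infoUpdate hT hO g
  have h3 : (O * T * O + O).PosSemidef := by
    refine Matrix.PosSemidef.add ?_ hO
    simpa [hOt] using posSemidef_conj hT.posSemidef O
  rw [Matrix.le_iff]
  have h4 : g + (1 - g * O) * (T - P) * (1 - g * O)ᵀ - (T⁻¹ + O)⁻¹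
      = (1 - g * O) * T * (1 - g * O)ᵀ + g * O * gᵀ - (T⁻¹ + O)⁻¹ := by
    calc _ = ((1 - g * O) * P * (1 - g * O)ᵀ + g * O * gᵀ)
          + (1 - g * O) * (T - P) * (1 - g * O)ᵀ - (T⁻¹ + O)⁻¹ := by rw [h1]
      _ = _ := by
          generalize (1 - g * O) = B
          rw [Matrix.mul_sub, Matrix.sub_mul]
          abel
  rw [h4, h2]
  exact posSemidef_conj h3 _

theorem posDef_slotUpdate (hctr : ObservablePair (G * Gᵀ) Aᵀ) {h : ℝ} (hh : 0 < h)
    (C : Matrix (Fin n) (Fin p) ℝ) {S : Matrix (Fin n) (Fin n) ℝ} (hS : S.PosSemidef) :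
    (slotUpdate A G h C S).PosDef :=
  posDef_infoUpdate (posDef_predictCov hctr hh hS) (posSemidef_mul_transpose C)

/-- Prediction is affine with congruence by exp(hA) as linear part, and `infoUpdate_le` supplies the
majorant of the correction. -/
theorem isSupported_slotUpdate (hctr : ObservablePair (G * Gᵀ) Aᵀ) {h : ℝ} (hh : 0 < h)
    (C : Matrix (Fin n) (Fin p) ℝ) : IsSupported (slotUpdate A G h C) := by
  refine ⟨fun S hS => (posDef_slotUpdate hctr hh C hS).posSemidef, fun S hS => ?_⟩
  refine ⟨(1 - slotUpdate A G h C S * (C * Cᵀ)) * exp (h • A), fun T hT => ?_⟩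
  refine (infoUpdate_le (posDef_predictCov hctr hh hS) (posDef_predictCov hctr hh hT)
    (posSemidef_mul_transpose C)).trans_eq ?_
  have : predictCov A G h T - predictCov A G h S = exp (h • A) * (T - S) * (exp (h • A))ᵀ := by
    rw [predictCov_eq, predictCov_eq]
    noncomm_ring
  rw [this, Matrix.transpose_mul, ← slotUpdate]
  simp only [Matrix.mul_assoc]

theorem continuousAt_matrix_inv {ι : Type*} [Fintype ι] [DecidableEq ι] {M : Matrix ι ι ℝ}
    (hM : IsUnit M) : ContinuousAt (fun M : Matrix ι ι ℝ => M⁻¹) M := by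
  obtain ⟨u, rfl⟩ := hM
  refine (NormedRing.inverse_continuousAt u).congr (.of_forall fun M => ?_)
  exact (Matrix.nonsing_inv_eq_ringInverse M).symm

theorem continuousAt_slotUpdate (hctr : ObservablePair (G * Gᵀ) Aᵀ) {h : ℝ} (hh : 0 < h)
    (C : Matrix (Fin n) (Fin p) ℝ) {S : Matrix (Fin n) (Fin n) ℝ} (hS : S.PosSemidef) :
    ContinuousAt (slotUpdate A G h C) S := by
  have hp : Continuous (predictCov A G h) := by
    unfold predictCov
    fun_prop
  have hP := posDef_predictCov hctr hh hS
  have h1 : ContinuousAt (fun S => (predictCov A G h S)⁻¹) S :=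
    ContinuousAt.comp (f := predictCov A G h) (continuousAt_matrix_inv hP.isUnit) hp.continuousAt
  have h2 : ContinuousAt (fun S => (predictCov A G h S)⁻¹ + C * Cᵀ) S :=
    h1.add continuousAt_const
  exact ContinuousAt.comp (f := fun S => (predictCov A G h S)⁻¹ + C * Cᵀ)
    (continuousAt_matrix_inv (hP.inv.add_posSemidef (posSemidef_mul_transpose C)).isUnit) h2

theorem foldl_slotUpdate (hctr : ObservablePair (G * Gᵀ) Aᵀ) {h : ℝ} (hh : 0 < h)
    (C : Fin N → Matrix (Fin n) (Fin p) ℝ) (L : List (Fin N)) :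
    IsSupported (fun S => L.foldl (fun T i => slotUpdate A G h (C i) T) S) ∧
      (∀ S : Matrix (Fin n) (Fin n) ℝ, S.PosSemidef → L ≠ [] →
        (L.foldl (fun T i => slotUpdate A G h (C i) T) S).PosDef) ∧
      ∀ S : Matrix (Fin n) (Fin n) ℝ, S.PosSemidef →
        ContinuousAt (fun S => L.foldl (fun T i => slotUpdate A G h (C i) T) S) S := by
  induction L with
  | nil => exact ⟨isSupported_id, by simp, fun S _ => continuousAt_id⟩
  | cons i L ih =>
    obtain ⟨h1, h2, h3⟩ := ih
    refine ⟨h1.comp (isSupported_slotUpdate hctr hh (C i)), fun S hS _ => ?_, fun S hS => ?_⟩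
    · have hd := posDef_slotUpdate hctr hh (C i) hS
      rcases eq_or_ne L [] with rfl | hL
      · exact hd
      · exact h2 _ hd.posSemidef hL
    · exact ContinuousAt.comp (f := slotUpdate A G h (C i))
        (h3 _ (posDef_slotUpdate hctr hh (C i) hS).posSemidef)
        (continuousAt_slotUpdate hctr hh (C i) hS)

/-- The iterates of 0 increase by monotonicity and remain below U because ΦU ≤ U; continuity makes
their limit a fixed point. -/
theorem IsSupported.exists_fixedPoint {ι : Type*} [Fintype ι] {Φ : Matrix ι ι ℝ → Matrix ι ι ℝ}
    (hΦ : IsSupported Φ) (hc : ∀ S, S.PosSemidef → ContinuousAt Φ S) {U : Matrix ι ι ℝ}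
    (hU : U.PosSemidef) (hle : Φ U ≤ U) : ∃ F, F.PosSemidef ∧ F ≤ U ∧ Φ F = F := by
  have hp : ∀ k : ℕ, (Φ^[k] 0).PosSemidef := fun k => by
    induction k with
    | zero => exact .zero
    | succ k ih => rw [Function.iterate_succ_apply']; exact hΦ.1 _ ih
  have hs : ∀ k : ℕ, Φ^[k] 0 ≤ Φ^[k + 1] 0 := fun k => by
    induction k with
    | zero => simpa [Matrix.le_iff] using hp 1
    | succ k ih =>
      rw [Function.iterate_succ_apply', Function.iterate_succ_apply' Φ (k + 1)]
      exact hΦ.mono (hp k) ih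
  have hb : ∀ k : ℕ, Φ^[k] 0 ≤ U := fun k => by
    induction k with
    | zero => simpa [Matrix.le_iff] using hU
    | succ k ih => rw [Function.iterate_succ_apply']; exact (hΦ.mono (hp k) ih).trans hle
  obtain ⟨F, -, hF, -, hFU⟩ := exists_tendsto_of_monotone (a₀ := 0)
    (fun a b _ hab => monotone_nat_of_le_succ hs hab) (fun k _ => hb k)
    (fun k _ => transpose_eq_of_posSemidef (hp k))
  have hFp := isClosed_posSemidef.mem_of_tendsto hF (.of_forall hp)
  refine ⟨F, hFp, hFU, ?_⟩
  have h1 : Tendsto (fun k => Φ^[k + 1] 0) atTop (𝓝 (Φ F)) := by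
    simp_rw [Function.iterate_succ_apply']
    exact (hc F hFp).tendsto.comp hF
  exact tendsto_nhds_unique h1 (hF.comp (tendsto_add_atTop_nat 1))

/-! ### First order expansion for short periods -/

/-- With E = exp(hA), (ESEᵀ - S)/h = ((E-1)/h)SEᵀ + S((E-1)/h)ᵀ. The matrix S may vary with the
parameter, since later it is an intermediate value inside a period or a steady state depending on τ.
-/
theorem tendsto_predictCov_slope {α : Type*} {l : Filter α} {h : α → ℝ}
    (hh : Tendsto h l (𝓝[>] 0)) {S : α → Matrix (Fin n) (Fin n) ℝ}
    {L : Matrix (Fin n) (Fin n) ℝ} (hS : Tendsto S l (𝓝 L)) :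
    Tendsto (fun a => (h a)⁻¹ • (predictCov A G (h a) (S a) - S a)) l
      (𝓝 (A * L + L * Aᵀ + G * Gᵀ)) := by
  have hh0 : Tendsto h l (𝓝[≠] 0) :=
    hh.mono_right (nhdsWithin_mono _ fun x hx => ne_of_gt hx)
  have e1 : Tendsto (fun a => (h a)⁻¹ • (exp (h a • A) - 1)) l (𝓝 A) := by
    have h1 := hasDerivAt_matrix_exp A 0
    rw [zero_smul, exp_zero, Matrix.mul_one] at h1
    have h2 := h1.tendsto_slope_zero.comp hh0
    simp only [Function.comp_def, zero_add, zero_smul, exp_zero] at h2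
    exact h2
  have e2 : Tendsto (fun a => (exp (h a • A))ᵀ) l (𝓝 1) := by
    have h1 : Tendsto h l (𝓝 0) := hh.mono_right nhdsWithin_le_nhds
    have h2 := ((continuous_matrix_exp_smul A).matrix_transpose.tendsto 0).comp h1
    simpa [Function.comp_def] using h2
  have e3 : Tendsto (fun a => ((h a)⁻¹ • (exp (h a • A) - 1))ᵀ) l (𝓝 Aᵀ) :=
    (continuous_id.matrix_transpose.tendsto A).comp e1
  have e4 : Tendsto (fun a => (h a)⁻¹ • noiseGramian A G (h a)) l (𝓝 (G * Gᵀ)) := by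
    have hc := continuous_gramian_integrand (G * Gᵀ) Aᵀ
    have h1 := (hc.integral_hasStrictDerivAt 0 0).hasDerivAt
    have h2 := h1.tendsto_slope_zero.comp hh0
    simp only [Function.comp_def, zero_add, zero_smul, exp_zero, Matrix.transpose_one,
      Matrix.one_mul, Matrix.mul_one, intervalIntegral.integral_same, sub_zero] at h2
    simp only [noiseGramian_eq]
    exact h2
  have e5 := ((((e1.mul hS).mul e2).add (hS.mul e3)).add e4)
  rw [Matrix.mul_one] at e5
  refine e5.congr fun a => ?_
  rw [predictCov_eq, Matrix.transpose_smul, Matrix.transpose_sub, Matrix.transpose_one,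
    Matrix.smul_mul, Matrix.smul_mul, Matrix.mul_smul, ← smul_add, ← smul_add]
  congr 1
  noncomm_ring

/-- The update g of the prediction P satisfies g = P - τ g O P with O = cᵢcᵢᵀ, so the correction
contributes -LOL. Only the prediction carries the factor 1/r: the slot has length τ/r, but the
information of its sample is τ O. -/
theorem tendsto_slotUpdate_slope (hctr : ObservablePair (G * Gᵀ) Aᵀ) {r : ℕ} (hr : 0 < r)
    (c : Fin N → Matrix (Fin n) (Fin p) ℝ) (i : Fin N) {α : Type*} {l : Filter α} {τ : α → ℝ}
    (hτ : Tendsto τ l (𝓝[>] 0)) {S : α → Matrix (Fin n) (Fin n) ℝ}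
    {L : Matrix (Fin n) (Fin n) ℝ} (hS : Tendsto S l (𝓝 L))
    (hSp : ∀ᶠ a in l, (S a).PosSemidef) :
    Tendsto (fun a => (τ a)⁻¹ • (slotUpdate A G (τ a / r) (scaledGain c (τ a) i) (S a) - S a)) l
      (𝓝 ((r : ℝ)⁻¹ • (A * L + L * Aᵀ + G * Gᵀ) - L * (c i * (c i)ᵀ) * L)) := by
  have hr' : (0 : ℝ) < r := Nat.cast_pos.2 hr
  have hτ0 : Tendsto τ l (𝓝 0) := hτ.mono_right nhdsWithin_le_nhds
  have hτp : ∀ᶠ a in l, 0 < τ a := hτ.eventually self_mem_nhdsWithin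
  have hh : Tendsto (fun a => τ a / r) l (𝓝[>] 0) := by
    refine tendsto_nhdsWithin_iff.2 ⟨by simpa using hτ0.div_const (r : ℝ), ?_⟩
    filter_upwards [hτp] with a ha using div_pos ha hr'
  have e1 := tendsto_predictCov_slope (A := A) (G := G) hh hS
  have e1' : Tendsto (fun a => (τ a)⁻¹ • (predictCov A G (τ a / r) (S a) - S a)) l
      (𝓝 ((r : ℝ)⁻¹ • (A * L + L * Aᵀ + G * Gᵀ))) := by
    refine (e1.const_smul (r : ℝ)⁻¹).congr fun a => ?_
    rw [smul_smul]
    congr 1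
    rw [inv_div, ← mul_div_assoc, inv_mul_cancel₀ hr'.ne', one_div]
  have eP : Tendsto (fun a => predictCov A G (τ a / r) (S a)) l (𝓝 L) := by
    have h1 := hS.add (hτ0.smul e1')
    rw [zero_smul, add_zero] at h1
    refine h1.congr' ?_
    filter_upwards [hτp] with a ha
    rw [smul_smul, mul_inv_cancel₀ ha.ne', one_smul, add_sub_cancel]
  set P := fun a => predictCov A G (τ a / r) (S a) with hP
  set O := c i * (c i)ᵀ with hO
  -- The limit L may be singular, so P⁻¹ need not stay bounded. The form g = P(1 + τOP)⁻¹ avoids it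
  -- and shows g → L.
  have eI : Tendsto (fun a => (1 + τ a • (O * P a))⁻¹) l (𝓝 1) := by
    have h1 : Tendsto (fun a => 1 + τ a • (O * P a)) l (𝓝 1) := by
      simpa using (hτ0.smul (tendsto_const_nhds.mul eP)).const_add (1 : Matrix (Fin n) (Fin n) ℝ)
    have h2 := (continuousAt_matrix_inv
      (isUnit_one : IsUnit (1 : Matrix (Fin n) (Fin n) ℝ))).tendsto.comp h1
    simpa [Function.comp_def] using h2
  have hev : ∀ᶠ a in l, slotUpdate A G (τ a / r) (scaledGain c (τ a) i) (S a)
        = P a * (1 + τ a • (O * P a))⁻¹ ∧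
      slotUpdate A G (τ a / r) (scaledGain c (τ a) i) (S a)
        = P a - τ a • (slotUpdate A G (τ a / r) (scaledGain c (τ a) i) (S a) * O * P a) := by
    filter_upwards [hτp, hSp] with a ha hSa
    have hPd : (P a).PosDef := posDef_predictCov hctr (div_pos ha hr') hSa
    have hC : scaledGain c (τ a) i * (scaledGain c (τ a) i)ᵀ = τ a • O := by
      simp only [scaledGain, Matrix.transpose_smul, Matrix.smul_mul, Matrix.mul_smul, smul_smul,
        Real.mul_self_sqrt ha.le, hO]
    have hOp : (τ a • O).PosSemidef := (posSemidef_mul_transpose (c i)).smul ha.le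
    have hg : slotUpdate A G (τ a / r) (scaledGain c (τ a) i) (S a)
        = ((P a)⁻¹ + τ a • O)⁻¹ := by rw [slotUpdate, hC]
    have h1 := infoUpdate_add_right hPd hOp
    rw [← hg] at h1
    set g := slotUpdate A G (τ a / r) (scaledGain c (τ a) i) (S a)
    have h2 : g * (1 + τ a • (O * P a)) = P a := by
      rw [Matrix.mul_add, Matrix.mul_one, Matrix.mul_smul, ← Matrix.mul_assoc]
      simpa only [Matrix.mul_smul, Matrix.smul_mul] using h1
    constructor
    · have h3 : IsUnit (1 + τ a • (O * P a)).det := by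
        have h4 := congrArg Matrix.det h2
        rw [Matrix.det_mul] at h4
        exact isUnit_of_mul_isUnit_right (h4 ▸ isUnit_det_of_posDef hPd)
      exact (Matrix.mul_nonsing_inv_cancel_right _ g h3).symm.trans (by rw [h2])
    · rw [eq_sub_iff_add_eq]
      simpa only [Matrix.mul_smul, Matrix.smul_mul] using h1
  have eg : Tendsto (fun a => slotUpdate A G (τ a / r) (scaledGain c (τ a) i) (S a)) l (𝓝 L) := by
    have h1 := eP.mul eI
    rw [Matrix.mul_one] at h1
    refine h1.congr' ?_
    filter_upwards [hev] with a ha using ha.1.symm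
  refine (e1'.sub ((eg.mul_const O).mul eP)).congr' ?_
  filter_upwards [hτp, hev] with a ha hea
  have h3 : slotUpdate A G (τ a / r) (scaledGain c (τ a) i) (S a) - S a
      = (P a - S a) - τ a • (slotUpdate A G (τ a / r) (scaledGain c (τ a) i) (S a) * O * P a) := by
    conv_lhs => rw [hea.2]
    abel
  rw [h3, smul_sub _ (P a - S a), smul_smul, inv_mul_cancel₀ ha.ne', one_smul]

/-- A slot moves the covariance by O(τ), so all slots of the period see the same limit L and their
slopes simply add. Here the dependence on the order of the slots disappears. -/
theorem tendsto_foldl_slope (hctr : ObservablePair (G * Gᵀ) Aᵀ) {r : ℕ} (hr : 0 < r)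
    (c : Fin N → Matrix (Fin n) (Fin p) ℝ) (Ls : List (Fin N)) {α : Type*} {l : Filter α}
    {τ : α → ℝ} (hτ : Tendsto τ l (𝓝[>] 0)) {S : α → Matrix (Fin n) (Fin n) ℝ}
    {L : Matrix (Fin n) (Fin n) ℝ} (hS : Tendsto S l (𝓝 L))
    (hSp : ∀ᶠ a in l, (S a).PosSemidef) :
    Tendsto (fun a => (τ a)⁻¹ • (Ls.foldl
        (fun T i => slotUpdate A G (τ a / r) (scaledGain c (τ a) i) T) (S a) - S a)) l
      (𝓝 ((Ls.map fun i => (r : ℝ)⁻¹ • (A * L + L * Aᵀ + G * Gᵀ)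
        - L * (c i * (c i)ᵀ) * L).sum)) := by
  have hr' : (0 : ℝ) < r := Nat.cast_pos.2 hr
  have hτp : ∀ᶠ a in l, 0 < τ a := hτ.eventually self_mem_nhdsWithin
  have hτ0 : Tendsto τ l (𝓝 0) := hτ.mono_right nhdsWithin_le_nhds
  induction Ls generalizing S with
  | nil =>
    simp only [List.foldl_nil, sub_self, smul_zero, List.map_nil, List.sum_nil]
    exact tendsto_const_nhds
  | cons i Ls ih =>
    have e1 := tendsto_slotUpdate_slope hctr hr c i hτ hS hSp
    have hS' : Tendsto (fun a => slotUpdate A G (τ a / r) (scaledGain c (τ a) i) (S a)) l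
        (𝓝 L) := by
      have h1 := hS.add (hτ0.smul e1)
      rw [zero_smul, add_zero] at h1
      refine h1.congr' ?_
      filter_upwards [hτp] with a ha
      rw [smul_smul, mul_inv_cancel₀ ha.ne', one_smul, add_sub_cancel]
    have e2 := ih hS' (by
      filter_upwards [hτp, hSp] with a ha hSa
      exact (posDef_slotUpdate hctr (div_pos ha hr') _ hSa).posSemidef)
    rw [List.map_cons, List.sum_cons]
    refine (e1.add e2).congr fun a => ?_
    rw [List.foldl_cons, ← smul_add]
    congr 1
    abel

/-- The `rtot` prediction slopes, each with factor 1/`rtot`, sum to the full drift; grouping the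
corrections by sensor produces the weights rᵢ. -/
theorem sum_map_slots {r : Fin N → ℕ} {rtot : ℕ} [NeZero rtot] {R : Fin rtot → Fin N}
    (hR : ∀ i, slotCount R i = r i) (c : Fin N → Matrix (Fin n) (Fin p) ℝ)
    (L : Matrix (Fin n) (Fin n) ℝ) :
    ((List.ofFn R).map fun i => (rtot : ℝ)⁻¹ • (A * L + L * Aᵀ + G * Gᵀ)
        - L * (c i * (c i)ᵀ) * L).sum
      = ric A (∑ i, (r i : ℝ) • (c i * (c i)ᵀ)) (G * Gᵀ) L := by
  have hrt : (rtot : ℝ) ≠ 0 := Nat.cast_ne_zero.2 (NeZero.ne rtot)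
  rw [List.map_ofFn, List.sum_ofFn]
  simp only [Function.comp_apply, Finset.sum_sub_distrib, Finset.sum_const, Finset.card_univ,
    Fintype.card_fin]
  rw [← Nat.cast_smul_eq_nsmul ℝ, smul_smul, mul_inv_cancel₀ hrt, one_smul]
  have h1 : ∑ l, L * (c (R l) * (c (R l))ᵀ) * L
      = ∑ i, (r i : ℝ) • (L * (c i * (c i)ᵀ) * L) := by
    rw [← Finset.sum_fiberwise Finset.univ R]
    refine Finset.sum_congr rfl fun i _ => ?_
    rw [Finset.sum_congr rfl (g := fun _ => L * (c i * (c i)ᵀ) * L)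
      (fun l hl => by rw [(Finset.mem_filter.1 hl).2]), Finset.sum_const, ← hR i, slotCount,
      Nat.cast_smul_eq_nsmul]
  rw [h1, ric, Finset.mul_sum, Finset.sum_mul]
  simp only [Matrix.mul_smul, Matrix.smul_mul]
  abel

theorem riccati_eq_ric (r : Fin N → ℕ) (c : Fin N → Matrix (Fin n) (Fin p) ℝ)
    (S : Matrix (Fin n) (Fin n) ℝ) :
    riccati A G (fun i => Real.sqrt (r i) • c i) S
      = ric A (∑ i, (r i : ℝ) • (c i * (c i)ᵀ)) (G * Gᵀ) S := by
  rw [riccati, ric, Finset.mul_sum, Finset.sum_mul]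
  congr 2
  refine Finset.sum_congr rfl fun i _ => ?_
  simp only [Matrix.transpose_smul, Matrix.smul_mul, Matrix.mul_smul, smul_smul,
    Real.mul_self_sqrt (Nat.cast_nonneg (r i))]

/-- For short periods the sampled recursion has a globally attracting steady state, and the steady
states converge to the solution of the algebraic Riccati equation. -/
theorem tendsto_steadyCov {r : Fin N → ℕ} (c : Fin N → Matrix (Fin n) (Fin p) ℝ)
    (hobs : ObservablePair (∑ i, (r i : ℝ) • (c i * (c i)ᵀ)) A)
    (hctr : ObservablePair (G * Gᵀ) Aᵀ) {F : Matrix (Fin n) (Fin n) ℝ}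
    (hF : ∀ S : Matrix (Fin n) (Fin n) ℝ, S.PosSemidef →
      ric A (∑ i, (r i : ℝ) • (c i * (c i)ᵀ)) (G * Gᵀ) S = 0 → S = F)
    {rtot : ℕ} [NeZero rtot] {R : Fin rtot → Fin N} (hR : ∀ i, slotCount R i = r i) :
    (∀ᶠ τ in 𝓝[>] (0 : ℝ), ∀ S₀ : Matrix (Fin n) (Fin n) ℝ, S₀.PosSemidef →
      Tendsto (fun k : ℕ => (periodUpdate A G (scaledGain c τ) τ R)^[k] S₀) atTop
        (𝓝 (steadyCov A G (scaledGain c τ) τ R))) ∧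
    Tendsto (fun τ => steadyCov A G (scaledGain c τ) τ R) (𝓝[>] (0 : ℝ)) (𝓝 F) := by
  have hr : 0 < rtot := NeZero.pos rtot
  have hr' : (0 : ℝ) < rtot := Nat.cast_pos.2 hr
  have hD : (∑ i, (r i : ℝ) • (c i * (c i)ᵀ)).PosSemidef :=
    posSemidef_sum _ fun i _ => (posSemidef_mul_transpose (c i)).smul (Nat.cast_nonneg _)
  set D := ∑ i, (r i : ℝ) • (c i * (c i)ᵀ) with hDdef
  have hQ := posSemidef_mul_transpose G
  obtain ⟨U, hU, hUr⟩ := exists_strict_supersolution (A := A) hD hQ hobs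
  have hne : List.ofFn R ≠ [] := by
    intro h
    have := congrArg List.length h
    simp only [List.length_ofFn, List.length_nil] at this
    omega
  have hfold := fun (τ : ℝ) (hτ : 0 < τ) =>
    foldl_slotUpdate (A := A) hctr (div_pos hτ hr') (scaledGain c τ) (List.ofFn R)
  have hpos : ∀ᶠ τ in 𝓝[>] (0 : ℝ), 0 < τ := self_mem_nhdsWithin
  -- The slope of the period map at U tends to ric U, which is negative definite. As this is an open
  -- condition, the period map lowers U for all small τ.
  have hle : ∀ᶠ τ in 𝓝[>] (0 : ℝ), periodUpdate A G (scaledGain c τ) τ R U ≤ U := by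
    have h1 := tendsto_foldl_slope hctr hr c (List.ofFn R) tendsto_id
      (tendsto_const_nhds (x := U)) (.of_forall fun _ => hU.posSemidef)
    rw [sum_map_slots hR] at h1
    have h2 := eventually_posDef_of_tendsto hUr ?_ h1.neg
    · filter_upwards [hpos, h2] with τ hτ h3
      have h4 := h3.posSemidef.smul hτ.le
      rw [id, smul_neg, smul_smul, mul_inv_cancel₀ hτ.ne', one_smul, neg_sub] at h4
      exact Matrix.le_iff.2 h4
    · filter_upwards [hpos] with τ hτ
      rw [Matrix.transpose_neg, Matrix.transpose_smul, Matrix.transpose_sub,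
        transpose_eq_of_posSemidef hU.posSemidef]
      exact congrArg (fun M => -(τ⁻¹ • (M - U)))
        (transpose_eq_of_posSemidef ((hfold τ hτ).1.1 U hU.posSemidef))
  have hfix : ∀ᶠ τ in 𝓝[>] (0 : ℝ), 0 < τ ∧ ∃ E : Matrix (Fin n) (Fin n) ℝ, E.PosSemidef ∧ E ≤ U ∧
      periodUpdate A G (scaledGain c τ) τ R E = E := by
    filter_upwards [hpos, hle] with τ hτ h1
    exact ⟨hτ, (hfold τ hτ).1.exists_fixedPoint (hfold τ hτ).2.2 hU.posSemidef h1⟩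
  have hconv : ∀ᶠ τ in 𝓝[>] (0 : ℝ), ((steadyCov A G (scaledGain c τ) τ R).PosSemidef ∧
      steadyCov A G (scaledGain c τ) τ R ≤ U ∧
      periodUpdate A G (scaledGain c τ) τ R (steadyCov A G (scaledGain c τ) τ R)
        = steadyCov A G (scaledGain c τ) τ R) ∧
      ∀ S₀ : Matrix (Fin n) (Fin n) ℝ, S₀.PosSemidef →
      Tendsto (fun k : ℕ => (periodUpdate A G (scaledGain c τ) τ R)^[k] S₀) atTop
        (𝓝 (steadyCov A G (scaledGain c τ) τ R)) := by
    filter_upwards [hfix] with τ hE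
    obtain ⟨hτ, E, hE1, hE2, hE3⟩ := hE
    have h1 : ∀ S₀ : Matrix (Fin n) (Fin n) ℝ, S₀.PosSemidef →
      Tendsto (fun k : ℕ => (periodUpdate A G (scaledGain c τ) τ R)^[k] S₀) atTop (𝓝 E) :=
      fun S₀ hS₀ => (hfold τ hτ).1.tendsto_iterate ((hfold τ hτ).2.1 0 .zero hne) hE1 hE3 hS₀
    have h2 : steadyCov A G (scaledGain c τ) τ R = E := (h1 0 .zero).limUnder_eq
    rw [h2]
    exact ⟨⟨hE1, hE2, hE3⟩, h1⟩
  -- Along every ultrafilter finer than 𝓝[>] 0 the steady states converge, since they lie in a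
  -- compact order interval. It remains to identify the limit L with F.
  refine ⟨hconv.mono fun τ h => h.2, tendsto_iff_ultrafilter _ _ _ |>.2 fun g hg => ?_⟩
  have hg1 := hg hconv
  obtain ⟨L, -, hL⟩ := (isCompact_Icc_matrix U).ultrafilter_le_nhds'
    (g.map fun τ => steadyCov A G (scaledGain c τ) τ R)
    (by
      rw [Ultrafilter.mem_map]
      filter_upwards [hg1] with τ h using ⟨h.1.1, h.1.2.1⟩)
  have hL' : Tendsto (fun τ => steadyCov A G (scaledGain c τ) τ R) g (𝓝 L) := hL
  have hpsd : ∀ᶠ τ in (g : Filter ℝ), (steadyCov A G (scaledGain c τ) τ R).PosSemidef := by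
    filter_upwards [hg1] with τ h using h.1.1
  have h1 := tendsto_foldl_slope hctr hr c (List.ofFn R) (show Tendsto id (g : Filter ℝ) _ from hg)
    hL' hpsd
  rw [sum_map_slots hR] at h1
  -- At a fixed point the difference quotient is identically 0, while by the expansion it tends to
  -- ric L.
  have h2 : ric A D (G * Gᵀ) L = 0 := by
    refine tendsto_nhds_unique h1 (tendsto_const_nhds.congr' ?_)
    filter_upwards [hg1] with τ h
    have h3 : List.foldl (fun T i => slotUpdate A G (id τ / rtot) (scaledGain c (id τ) i) T)
      (steadyCov A G (scaledGain c τ) τ R) (List.ofFn R) = steadyCov A G (scaledGain c τ) τ R :=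
      h.1.2.2
    rw [h3, sub_self, smul_zero]
  rw [← hF L (isClosed_posSemidef.mem_of_tendsto hL' hpsd) h2]
  exact hL'

/-- If D annihilates u = Aᵏv, then ∑ rᵢ|cᵢᵀu|² = 0, and rᵢ > 0 makes every cᵢᵀu vanish. Vanishing is
given for all powers and needed only below n, so Cayley-Hamilton is not used. -/
theorem observablePair_of_isObservable {r : Fin N → ℕ} (hr : ∀ i, 0 < r i)
    {c : Fin N → Matrix (Fin n) (Fin p) ℝ} (h : IsObservable A c) :
    ObservablePair (∑ i, (r i : ℝ) • (c i * (c i)ᵀ)) A := by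
  intro v hv
  have h1 : v ∈ (⨅ k : Fin n, ⨅ i : Fin N, LinearMap.ker ((c i)ᵀ * A ^ (k : ℕ)).mulVecLin) := by
    simp only [Submodule.mem_iInf, LinearMap.mem_ker, Matrix.mulVecLin_apply]
    intro k i
    have h2 := hv k
    rw [← Matrix.mulVec_mulVec] at h2
    set u := A ^ (k : ℕ) *ᵥ v with hu
    have h3 : ∑ i, (r i : ℝ) * (((c i)ᵀ *ᵥ u) ⬝ᵥ ((c i)ᵀ *ᵥ u)) = 0 := by
      have h4 := congrArg (fun x => u ⬝ᵥ x) h2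
      simp only [Matrix.sum_mulVec, dotProduct_sum, dotProduct_zero, Matrix.smul_mulVec,
        dotProduct_smul, smul_eq_mul] at h4
      rw [← h4]
      refine Finset.sum_congr rfl fun i _ => ?_
      rw [← Matrix.mulVec_mulVec, Matrix.dotProduct_mulVec u, ← Matrix.mulVec_transpose]
    have hn : ∀ i ∈ Finset.univ, 0 ≤ (r i : ℝ) * (((c i)ᵀ *ᵥ u) ⬝ᵥ ((c i)ᵀ *ᵥ u)) := fun i _ =>
      mul_nonneg (Nat.cast_nonneg _) (Finset.sum_nonneg fun j _ => mul_self_nonneg _)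
    have h5 := (Finset.sum_eq_zero_iff_of_nonneg hn).1 h3 i (Finset.mem_univ i)
    have h6 : ((c i)ᵀ *ᵥ u) ⬝ᵥ ((c i)ᵀ *ᵥ u) = 0 :=
      (mul_eq_zero.1 h5).resolve_left (Nat.cast_ne_zero.2 (hr i).ne')
    rw [← Matrix.mulVec_mulVec]
    exact dotProduct_self_eq_zero.1 h6
  rw [h] at h1
  exact (Submodule.mem_bot ℝ).1 h1

/-- A vector v with GGᵀ(Aᵀ)ᵏv = 0 is orthogonal to the columns of all AᵏG. These span the space, so
v is orthogonal to itself. -/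
theorem observablePair_of_isControllable (h : IsControllable A G) :
    ObservablePair (G * Gᵀ) Aᵀ := by
  intro v hv
  have h1 : (⨆ k : Fin n, LinearMap.range (A ^ (k : ℕ) * G).mulVecLin)
      ≤ LinearMap.ker (Matrix.replicateRow Unit v).mulVecLin := by
    refine iSup_le fun k => ?_
    rintro _ ⟨u, rfl⟩
    have h2 := hv k
    rw [← Matrix.mulVec_mulVec, ← Matrix.mulVec_mulVec] at h2
    set w := (Aᵀ ^ (k : ℕ)) *ᵥ v with hw
    have h3 : Gᵀ *ᵥ w = 0 := by
      have h4 := congrArg (fun x => w ⬝ᵥ x) h2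
      simp only [dotProduct_zero] at h4
      rw [Matrix.dotProduct_mulVec w, ← Matrix.mulVec_transpose] at h4
      exact dotProduct_self_eq_zero.1 h4
    have h5 : v ⬝ᵥ ((A ^ (k : ℕ) * G) *ᵥ u) = 0 := by
      rw [Matrix.dotProduct_mulVec, ← Matrix.mulVec_transpose, Matrix.transpose_mul,
        Matrix.transpose_pow, ← Matrix.mulVec_mulVec, ← hw, h3, zero_dotProduct]
    rw [LinearMap.mem_ker]
    funext x
    simpa [Matrix.mulVec] using h5
  rw [h] at h1
  have h2 : v ∈ LinearMap.ker (Matrix.replicateRow Unit v).mulVecLin := h1 trivial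
  rw [LinearMap.mem_ker] at h2
  have h3 := congrFun h2 ()
  exact dotProduct_self_eq_zero.1 (by simpa [Matrix.mulVec] using h3)

end Sampled


/-! ### Linear filtering in a Hilbert space -/

section Hilbert

open Matrix
open scoped RealInnerProductSpace

set_option linter.unusedSectionVars false

variable {H : Type*} [NormedAddCommGroup H] [InnerProductSpace ℝ H] [CompleteSpace H]
variable {ι κ μ : Type*} [Fintype ι] [Fintype κ] [Fintype μ]

/-- The linear combination `∑ₐ rₐ Xₐ`. -/
def pairing (r : ι → ℝ) (X : ι → H) : H := ∑ a, r a • X a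

/-- The action of a matrix on a tuple of vectors. -/
def matAct (M : Matrix κ ι ℝ) (X : ι → H) (k : κ) : H := ∑ a, M k a • X a

theorem pairing_matAct (r : κ → ℝ) (M : Matrix κ ι ℝ) (X : ι → H) :
    pairing r (matAct M X) = pairing (Mᵀ *ᵥ r) X := by
  simp only [pairing, matAct, Finset.smul_sum, smul_smul, Matrix.mulVec, dotProduct,
    Matrix.transpose_apply, Finset.sum_smul]
  rw [Finset.sum_comm]
  simp only [mul_comm]

theorem pairing_sub_left (r r' : ι → ℝ) (X : ι → H) :
    pairing (r - r') X = pairing r X - pairing r' X := by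
  simp [pairing, sub_smul, Finset.sum_sub_distrib]

theorem pairing_add_right (r : ι → ℝ) (X X' : ι → H) :
    pairing r (X + X') = pairing r X + pairing r X' := by
  simp [pairing, Finset.sum_add_distrib]

theorem pairing_sub_right (r : ι → ℝ) (X X' : ι → H) :
    pairing r (X - X') = pairing r X - pairing r X' := by
  simp [pairing, smul_sub, Finset.sum_sub_distrib]

theorem pairing_single [DecidableEq ι] (a : ι) (X : ι → H) :
    pairing (Pi.single a 1) X = X a := by
  simp [pairing, Pi.single_apply, ite_smul]

theorem inner_pairing_left (r : ι → ℝ) (X : ι → H) (h : H) :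
    ⟪pairing r X, h⟫ = ∑ a, r a * ⟪X a, h⟫ := by
  simp [pairing, sum_inner, inner_smul_left]

theorem inner_pairing_right (r : ι → ℝ) (X : ι → H) (h : H) :
    ⟪h, pairing r X⟫ = ∑ a, r a * ⟪h, X a⟫ := by
  simp [pairing, inner_sum, inner_smul_right]

theorem pairing_mem {K : Submodule ℝ H} {X : ι → H} (h : ∀ a, X a ∈ K) (r : ι → ℝ) :
    pairing r X ∈ K :=
  K.sum_mem fun a _ => K.smul_mem _ (h a)

theorem hasDerivAt_pairing {r : ℝ → ι → ℝ} {r' : ι → ℝ} {X : ℝ → ι → H} {X' : ι → H} {t : ℝ}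
    (hr : HasDerivAt r r' t) (hX : ∀ a, HasDerivAt (fun s => X s a) (X' a) t) :
    HasDerivAt (fun s => pairing (r s) (X s)) (pairing r' (X t) + pairing (r t) X') t := by
  have h := HasDerivAt.fun_sum (u := Finset.univ) fun a _ => (hasDerivAt_pi.1 hr a).smul (hX a)
  refine h.congr_deriv ?_
  simp only [pairing, Finset.sum_add_distrib]
  rw [add_comm]

theorem continuous_pairing {r : ℝ → ι → ℝ} {X : ℝ → ι → H} (hr : Continuous r)
    (hX : ∀ a, Continuous fun s => X s a) : Continuous fun s => pairing (r s) (X s) := by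
  unfold pairing
  exact continuous_finsetSum _ fun a _ => ((continuous_apply a).comp hr).smul (hX a)

theorem continuous_matAct {X : ℝ → ι → H} (M : Matrix κ ι ℝ)
    (hX : ∀ a, Continuous fun s => X s a) (k : κ) : Continuous fun s => matAct M (X s) k := by
  unfold matAct
  exact continuous_finsetSum _ fun a _ => (hX a).const_smul _

theorem inner_intervalIntegral_right {Z : ℝ → H} (hZ : Continuous Z) (a b : ℝ) (h : H) :
    ⟪h, ∫ s in a..b, Z s⟫ = ∫ s in a..b, ⟪h, Z s⟫ :=
  ((innerSL ℝ h).intervalIntegral_comp_comm (hZ.intervalIntegrable a b)).symm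

/-- A closed subspace is its double orthogonal complement, so membership can be tested by inner
products, which commute with the integral. -/
theorem intervalIntegral_mem_of_isClosed {K : Submodule ℝ H} (hK : IsClosed (K : Set H))
    {Z : ℝ → H} (hZ : Continuous Z) {t : ℝ} (ht : 0 ≤ t) (h : ∀ s ∈ Set.Icc 0 t, Z s ∈ K) :
    ∫ s in (0 : ℝ)..t, Z s ∈ K := by
  have hKK : Kᗮᗮ = K := by
    rw [Submodule.orthogonal_orthogonal_eq_closure, hK.submodule_topologicalClosure_eq]
  rw [← hKK, Submodule.mem_orthogonal]
  intro u hu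
  rw [inner_intervalIntegral_right hZ]
  have h1 : ∀ s ∈ Set.uIcc 0 t, ⟪u, Z s⟫ = 0 := by
    intro s hs
    rw [Set.uIcc_of_le ht] at hs
    exact (Submodule.mem_orthogonal' K u).1 hu _ (h s hs)
  rw [intervalIntegral.integral_congr (g := fun _ => 0) h1]
  simp

/-- The integral `∑ₖ ∫₀ᵗ rₖ dWₖ` of a differentiable integrand, defined by integration by parts. -/
noncomputable def wienerInt (r r' : ℝ → κ → ℝ) (W : ℝ → κ → H) (t : ℝ) : H :=
  pairing (r t) (W t) - ∫ s in (0 : ℝ)..t, pairing (r' s) (W s)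

theorem wienerInt_mem {K : Submodule ℝ H} (hK : IsClosed (K : Set H)) {r r' : ℝ → κ → ℝ}
    (hr' : Continuous r') {W : ℝ → κ → H} (hW : ∀ k, Continuous fun s => W s k) {t : ℝ}
    (ht : 0 ≤ t) (h : ∀ s ∈ Set.Icc 0 t, ∀ k, W s k ∈ K) : wienerInt r r' W t ∈ K :=
  K.sub_mem (pairing_mem (h t ⟨ht, le_rfl⟩) _)
    (intervalIntegral_mem_of_isClosed hK (continuous_pairing hr' hW) ht
      fun s hs => pairing_mem (h s hs) _)

theorem inner_wienerInt_eq_zero {r r' : ℝ → κ → ℝ} (hr' : Continuous r') {W : ℝ → κ → H}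
    (hW : ∀ k, Continuous fun s => W s k) {t : ℝ} (ht : 0 ≤ t) {h : H}
    (hh : ∀ s ∈ Set.Icc 0 t, ∀ k, ⟪h, W s k⟫ = 0) : ⟪h, wienerInt r r' W t⟫ = 0 := by
  have h1 : wienerInt r r' W t ∈ (ℝ ∙ h)ᗮ :=
    wienerInt_mem (Submodule.isClosed_orthogonal _) hr' hW ht fun s hs k => by
      rw [Submodule.mem_orthogonal_singleton_iff_inner_right]
      exact hh s hs k
  rwa [Submodule.mem_orthogonal_singleton_iff_inner_right] at h1

/-- Integration by parts against the Brownian covariance min(s, u), split at u. It is the scalar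
core of the Wiener isometry against W(u). -/
theorem integral_deriv_mul_min {f f' : ℝ → ℝ} (hf : ∀ t, HasDerivAt f (f' t) t)
    (hf' : Continuous f') {t u : ℝ} (hu : u ∈ Set.Icc 0 t) :
    f t * u - ∫ s in (0 : ℝ)..t, f' s * min s u = ∫ s in (0 : ℝ)..u, f s := by
  have hc : Continuous fun s => f' s * min s u := by fun_prop
  have hfc : Continuous f := continuous_iff_continuousAt.2 fun t => (hf t).continuousAt
  rw [← intervalIntegral.integral_add_adjacent_intervals
    (hc.intervalIntegrable 0 u) (hc.intervalIntegrable u t)]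
  have h1 : ∫ s in (0 : ℝ)..u, f' s * min s u = ∫ s in (0 : ℝ)..u, f' s * s :=
    intervalIntegral.integral_congr fun s hs => by
      rw [Set.uIcc_of_le hu.1] at hs
      simp only [min_eq_left hs.2]
  have h2 : ∫ s in u..t, f' s * min s u = ∫ s in u..t, f' s * u :=
    intervalIntegral.integral_congr fun s hs => by
      rw [Set.uIcc_of_le hu.2] at hs
      simp only [min_eq_right hs.1]
  have h3 : ∫ s in u..t, f' s * u = (f t - f u) * u := by
    rw [intervalIntegral.integral_mul_const, intervalIntegral.integral_eq_sub_of_hasDerivAt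
      (fun s _ => hf s) (hf'.intervalIntegrable u t)]
  have h4 : ∫ s in (0 : ℝ)..u, (f' s * s + f s) = f u * u := by
    rw [intervalIntegral.integral_eq_sub_of_hasDerivAt (f := fun s => f s * s)
      (fun s _ => ((hf s).fun_mul (hasDerivAt_id' s)).congr_deriv (by ring))
      (Continuous.intervalIntegrable (by fun_prop) 0 u)]
    simp
  rw [intervalIntegral.integral_add (Continuous.intervalIntegrable (by fun_prop) 0 u)
    (hfc.intervalIntegrable 0 u)] at h4
  rw [h1, h2, h3]
  linarith

theorem inner_wienerInt [DecidableEq κ] {r r' : ℝ → κ → ℝ} (hr : ∀ t, HasDerivAt r (r' t) t)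
    (hr' : Continuous r') {W : ℝ → κ → H} (hW : ∀ k, Continuous fun s => W s k) {t u : ℝ}
    (hu : u ∈ Set.Icc 0 t)
    {k : κ} (hh : ∀ s, 0 ≤ s → ∀ j, ⟪W u k, W s j⟫ = if j = k then min s u else 0) :
    ⟪wienerInt r r' W t, W u k⟫ = ∫ s in (0 : ℝ)..u, r s k := by
  have ht : 0 ≤ t := hu.1.trans hu.2
  rw [real_inner_comm, wienerInt, inner_sub_right, inner_pairing_right,
    inner_intervalIntegral_right (continuous_pairing hr' hW)]
  have h1 : ∀ s, 0 ≤ s → ∀ q : κ → ℝ, ∑ a, q a * ⟪W u k, W s a⟫ = q k * min s u := by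
    intro s hs q
    simp [hh s hs]
  have h2 : ∫ s in (0 : ℝ)..t, ⟪W u k, pairing (r' s) (W s)⟫
      = ∫ s in (0 : ℝ)..t, r' s k * min s u :=
    intervalIntegral.integral_congr fun s hs => by
      rw [Set.uIcc_of_le ht] at hs
      simp only [inner_pairing_right, h1 s hs.1]
  rw [h1 t ht, h2, min_eq_right hu.2]
  exact integral_deriv_mul_min (f := fun s => r s k) (fun s => hasDerivAt_pi.1 (hr s) k)
    ((continuous_apply k).comp hr') hu

/-- The primitive F of Mδ is differentiable everywhere and agrees with δ on [0, t], so Grönwall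
applies to F although δ is only continuous. -/
theorem eq_zero_of_eq_integral (M : Matrix ι ι ℝ) {δ : ℝ → ι → ℝ} (hδ : Continuous δ) {t : ℝ}
    (h : ∀ u ∈ Set.Icc 0 t, ∀ a, δ u a = ∫ s in (0 : ℝ)..u, (M *ᵥ δ s) a) :
    ∀ u ∈ Set.Icc 0 t, δ u = 0 := by
  have hc : Continuous fun s => M *ᵥ δ s := continuous_const.matrix_mulVec hδ
  obtain ⟨F, hF⟩ : ∃ F : ℝ → ι → ℝ, F = fun u a => ∫ s in (0 : ℝ)..u, (M *ᵥ δ s) a := ⟨_, rfl⟩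
  have hFd : ∀ u, HasDerivAt F (M *ᵥ δ u) u := fun u => by
    rw [hF]
    exact hasDerivAt_pi.2 fun a =>
      (((continuous_apply a).comp hc).integral_hasStrictDerivAt 0 u).hasDerivAt
  have hFe : ∀ u ∈ Set.Icc 0 t, δ u = F u := fun u hu => by
    rw [hF]; exact funext fun a => h u hu a
  obtain ⟨L, hL⟩ : ∃ L : (ι → ℝ) →L[ℝ] (ι → ℝ), ∀ v, L v = M *ᵥ v :=
    ⟨LinearMap.toContinuousLinearMap M.mulVecLin, fun v => rfl⟩
  intro u hu
  have hg := norm_le_gronwallBound_of_norm_deriv_right_le (f := F) (f' := fun u => M *ᵥ δ u)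
    (δ := 0) (K := ‖L‖) (ε := 0) (a := 0) (b := t)
    (fun s _ => (hFd s).continuousAt.continuousWithinAt)
    (fun s _ => (hFd s).hasDerivWithinAt)
    (by rw [← hFe 0 ⟨le_rfl, hu.1.trans hu.2⟩]
        have : δ 0 = 0 := funext fun a => by
          rw [h 0 ⟨le_rfl, hu.1.trans hu.2⟩]; simp
        simp [this])
    (fun s hs => by
      rw [add_zero, ← hFe s ⟨hs.1, hs.2.le⟩, ← hL]
      exact L.le_opNorm _)
    u hu
  rw [gronwallBound_ε0_δ0] at hg
  rw [hFe u hu]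
  exact norm_le_zero_iff.1 hg

/-- A linear system `dx = A x dt + G dw`, `dz = Cᵀ x dt + dν` of second order processes, regarded
as curves in a Hilbert space. The initial state splits into a known part `m₀` and an error `e₀` of
covariance `S₀`. -/
structure IsHilbertSystem (A S₀ : Matrix ι ι ℝ) (G : Matrix ι μ ℝ) (C : Matrix ι κ ℝ)
    [DecidableEq κ] [DecidableEq μ] (x : ℝ → ι → H) (w : ℝ → μ → H) (z ν : ℝ → κ → H)
    (m₀ e₀ : ι → H) : Prop where
  continuous_state : ∀ a, Continuous fun s => x s a
  continuous_input : ∀ j, Continuous fun s => w s j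
  continuous_output : ∀ k, Continuous fun s => z s k
  continuous_noise : ∀ k, Continuous fun s => ν s k
  state : ∀ t, 0 ≤ t → ∀ a, x t a = x 0 a + (∫ s in (0 : ℝ)..t, matAct A (x s) a)
    + matAct G (w t) a
  output : ∀ t, 0 ≤ t → ∀ k, z t k = (∫ s in (0 : ℝ)..t, matAct Cᵀ (x s) k) + ν t k
  inner_input : ∀ s t, 0 ≤ s → 0 ≤ t → ∀ i j, ⟪w s i, w t j⟫ = if j = i then min t s else 0
  inner_noise : ∀ s t, 0 ≤ s → 0 ≤ t → ∀ i j, ⟪ν s i, ν t j⟫ = if j = i then min t s else 0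
  inner_input_noise : ∀ s t, 0 ≤ s → 0 ≤ t → ∀ i j, ⟪w s i, ν t j⟫ = 0
  init : ∀ a, x 0 a = m₀ a + e₀ a
  inner_error : ∀ a b, ⟪e₀ a, e₀ b⟫ = S₀ a b
  inner_error_known : ∀ a b, ⟪e₀ a, m₀ b⟫ = 0
  inner_error_input : ∀ t, 0 ≤ t → ∀ a j, ⟪e₀ a, w t j⟫ = 0
  inner_error_noise : ∀ t, 0 ≤ t → ∀ a k, ⟪e₀ a, ν t k⟫ = 0
  inner_known_input : ∀ t, 0 ≤ t → ∀ a j, ⟪m₀ a, w t j⟫ = 0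
  inner_known_noise : ∀ t, 0 ≤ t → ∀ a k, ⟪m₀ a, ν t k⟫ = 0

variable [DecidableEq ι] [DecidableEq κ] [DecidableEq μ]

/-- The error of the Kalman-Bucy filter in the direction `X(t) v`. -/
noncomputable def filterError (A S₀ : Matrix ι ι ℝ) (G : Matrix ι μ ℝ) (C : Matrix ι κ ℝ)
    (w : ℝ → μ → H) (ν : ℝ → κ → H) (e₀ : ι → H) (t : ℝ) (v : ι → ℝ) : H :=
  pairing v e₀
    + wienerInt (fun s => Gᵀ *ᵥ (flowX A (C * Cᵀ) (G * Gᵀ) S₀ s *ᵥ v))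
      (fun s => Gᵀ *ᵥ ((-Aᵀ * flowX A (C * Cᵀ) (G * Gᵀ) S₀ s
        + C * Cᵀ * flowY A (C * Cᵀ) (G * Gᵀ) S₀ s) *ᵥ v)) w t
    - wienerInt (fun s => Cᵀ *ᵥ (flowY A (C * Cᵀ) (G * Gᵀ) S₀ s *ᵥ v))
      (fun s => Cᵀ *ᵥ ((G * Gᵀ * flowX A (C * Cᵀ) (G * Gᵀ) S₀ s
        + A * flowY A (C * Cᵀ) (G * Gᵀ) S₀ s) *ᵥ v)) ν t

variable {A S₀ : Matrix ι ι ℝ} {G : Matrix ι μ ℝ} {C : Matrix ι κ ℝ}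
  {x : ℝ → ι → H} {w : ℝ → μ → H} {z ν : ℝ → κ → H} {m₀ e₀ : ι → H}

theorem hasDerivAt_mulVec_flow {f f' : ℝ → Matrix ι ι ℝ} (M : Matrix κ ι ℝ) (v : ι → ℝ)
    (h : ∀ t, HasDerivAt f (f' t) t) (t : ℝ) :
    HasDerivAt (fun s => M *ᵥ (f s *ᵥ v)) (M *ᵥ (f' t *ᵥ v)) t := by
  have h1 := (h t).matrix_mulVec v
  refine hasDerivAt_pi.2 fun k => ?_
  exact HasDerivAt.fun_sum fun a _ => (hasDerivAt_pi.1 h1 a).const_mul (M k a)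

theorem continuous_input_weight (v : ι → ℝ) :
    Continuous fun s => Gᵀ *ᵥ ((-Aᵀ * flowX A (C * Cᵀ) (G * Gᵀ) S₀ s
        + C * Cᵀ * flowY A (C * Cᵀ) (G * Gᵀ) S₀ s) *ᵥ v) := by
  have h1 := continuous_flowX (A := A) (D := C * Cᵀ) (Q := G * Gᵀ) (S₀ := S₀)
  have h2 := continuous_flowY (A := A) (D := C * Cᵀ) (Q := G * Gᵀ) (S₀ := S₀)
  fun_prop

theorem continuous_noise_weight (v : ι → ℝ) :
    Continuous fun s => Cᵀ *ᵥ ((G * Gᵀ * flowX A (C * Cᵀ) (G * Gᵀ) S₀ s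
        + A * flowY A (C * Cᵀ) (G * Gᵀ) S₀ s) *ᵥ v) := by
  have h1 := continuous_flowX (A := A) (D := C * Cᵀ) (Q := G * Gᵀ) (S₀ := S₀)
  have h2 := continuous_flowY (A := A) (D := C * Cᵀ) (Q := G * Gᵀ) (S₀ := S₀)
  fun_prop

namespace IsHilbertSystem

/-- The filter error lies in the closed span of the initial error and of the noises up to t. Its
weights come from the adjoint error equation: with Y = SX one has X' = -(A - SCCᵀ)ᵀX, so pairing the
error with X(t)v cancels the drift and leaves only the two noise integrals. -/
theorem inner_filterError_eq_zero (hs : IsHilbertSystem A S₀ G C x w z ν m₀ e₀) {t : ℝ}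
    (ht : 0 ≤ t) (v : ι → ℝ) {h : H} (h0 : ∀ a, ⟪e₀ a, h⟫ = 0)
    (hw : ∀ s ∈ Set.Icc 0 t, ∀ j, ⟪w s j, h⟫ = 0)
    (hν : ∀ s ∈ Set.Icc 0 t, ∀ k, ⟪ν s k, h⟫ = 0) :
    ⟪filterError A S₀ G C w ν e₀ t v, h⟫ = 0 := by
  rw [filterError, inner_sub_left, inner_add_left, inner_pairing_left,
    real_inner_comm h (wienerInt _ _ w t), real_inner_comm h (wienerInt _ _ ν t),
    inner_wienerInt_eq_zero (continuous_input_weight v) hs.continuous_input ht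
      (fun s hs j => by rw [real_inner_comm]; exact hw s hs j),
    inner_wienerInt_eq_zero (continuous_noise_weight v) hs.continuous_noise ht
      (fun s hs j => by rw [real_inner_comm]; exact hν s hs j)]
  simp [h0]

theorem inner_filterError_input (hs : IsHilbertSystem A S₀ G C x w z ν m₀ e₀) {t u : ℝ}
    (hu : u ∈ Set.Icc 0 t) (v : ι → ℝ) (j : μ) :
    ⟪filterError A S₀ G C w ν e₀ t v, w u j⟫
      = ∫ s in (0 : ℝ)..u, (Gᵀ *ᵥ (flowX A (C * Cᵀ) (G * Gᵀ) S₀ s *ᵥ v)) j := by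
  rw [filterError, inner_sub_left, inner_add_left, inner_pairing_left,
    real_inner_comm (w u j) (wienerInt _ _ ν t),
    inner_wienerInt_eq_zero (continuous_noise_weight v) hs.continuous_noise (hu.1.trans hu.2)
      (fun s hs' k => hs.inner_input_noise _ _ hu.1 hs'.1 _ _),
    inner_wienerInt (hasDerivAt_mulVec_flow Gᵀ v (hasDerivAt_flowX A _ _ S₀))
      (continuous_input_weight v) hs.continuous_input hu
      (fun s hs' k => hs.inner_input _ _ hu.1 hs' _ _)]
  simp [hs.inner_error_input u hu.1]

theorem inner_filterError_noise (hs : IsHilbertSystem A S₀ G C x w z ν m₀ e₀) {t u : ℝ}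
    (hu : u ∈ Set.Icc 0 t) (v : ι → ℝ) (k : κ) :
    ⟪filterError A S₀ G C w ν e₀ t v, ν u k⟫
      = - ∫ s in (0 : ℝ)..u, (Cᵀ *ᵥ (flowY A (C * Cᵀ) (G * Gᵀ) S₀ s *ᵥ v)) k := by
  rw [filterError, inner_sub_left, inner_add_left, inner_pairing_left,
    real_inner_comm (ν u k) (wienerInt _ _ w t),
    inner_wienerInt_eq_zero (continuous_input_weight v) hs.continuous_input (hu.1.trans hu.2)
      (fun s hs' j => by
        rw [real_inner_comm]; exact hs.inner_input_noise _ _ hs'.1 hu.1 _ _),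
    inner_wienerInt (hasDerivAt_mulVec_flow Cᵀ v (hasDerivAt_flowY A _ _ S₀))
      (continuous_noise_weight v) hs.continuous_noise hu
      (fun s hs' k => hs.inner_noise _ _ hu.1 hs' _ _)]
  simp [hs.inner_error_noise u hu.1]

theorem inner_filterError_known (hs : IsHilbertSystem A S₀ G C x w z ν m₀ e₀) {t : ℝ}
    (ht : 0 ≤ t) (v : ι → ℝ) (a : ι) : ⟪filterError A S₀ G C w ν e₀ t v, m₀ a⟫ = 0 :=
  hs.inner_filterError_eq_zero ht v (fun b => hs.inner_error_known b a)
    (fun s hs' j => by rw [real_inner_comm]; exact hs.inner_known_input s hs'.1 a j)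
    (fun s hs' k => by rw [real_inner_comm]; exact hs.inner_known_noise s hs'.1 a k)

theorem transpose_init (hs : IsHilbertSystem A S₀ G C x w z ν m₀ e₀) : S₀ᵀ = S₀ := by
  ext a b
  rw [Matrix.transpose_apply, ← hs.inner_error, ← hs.inner_error, real_inner_comm]

theorem inner_filterError_init (hs : IsHilbertSystem A S₀ G C x w z ν m₀ e₀) {t : ℝ}
    (ht : 0 ≤ t) (v : ι → ℝ) (a : ι) :
    ⟪filterError A S₀ G C w ν e₀ t v, x 0 a⟫ = (S₀ *ᵥ v) a := by
  rw [hs.init, inner_add_right, hs.inner_filterError_known ht, zero_add, filterError,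
    inner_sub_left, inner_add_left, inner_pairing_left,
    real_inner_comm (e₀ a) (wienerInt _ _ w t), real_inner_comm (e₀ a) (wienerInt _ _ ν t),
    inner_wienerInt_eq_zero (continuous_input_weight v) hs.continuous_input ht
      (fun s hs' j => hs.inner_error_input s hs'.1 a j),
    inner_wienerInt_eq_zero (continuous_noise_weight v) hs.continuous_noise ht
      (fun s hs' j => hs.inner_error_noise s hs'.1 a j), add_zero, sub_zero]
  conv_rhs => rw [← hs.transpose_init]
  simp only [hs.inner_error, Matrix.mulVec, dotProduct, Matrix.transpose_apply, mul_comm]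

/-- The covariance of the filter error with the state. -/
theorem inner_filterError_state (hs : IsHilbertSystem A S₀ G C x w z ν m₀ e₀) {t : ℝ}
    (v : ι → ℝ) : ∀ u ∈ Set.Icc 0 t,
    (fun a => ⟪filterError A S₀ G C w ν e₀ t v, x u a⟫)
      = flowY A (C * Cᵀ) (G * Gᵀ) S₀ u *ᵥ v := by
  set ε := filterError A S₀ G C w ν e₀ t v with hε
  set X := flowX A (C * Cᵀ) (G * Gᵀ) S₀ with hX
  set Y := flowY A (C * Cᵀ) (G * Gᵀ) S₀ with hY
  have hq : Continuous fun u => (fun a => ⟪ε, x u a⟫ : ι → ℝ) :=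
    continuous_pi fun a => continuous_const.inner (hs.continuous_state a)
  have hXc : Continuous X := continuous_flowX
  have hYc : Continuous Y := continuous_flowY
  have hYv : Continuous fun u => Y u *ᵥ v := by fun_prop
  -- Pairing the state equation with the error shows that u ↦ ⟪ε, x(u)⟫ solves q' = Aq + GGᵀX(u)v
  -- with q(0) = S₀v, in integral form. This is also the equation of Y(u)v, so the difference
  -- satisfies a homogeneous one.
  have key := eq_zero_of_eq_integral A (δ := fun u => (fun a => ⟪ε, x u a⟫) - Y u *ᵥ v) (t := t)
    (hq.sub hYv) ?_
  · intro u hu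
    exact sub_eq_zero.1 (key u hu)
  · intro u hu a
    have ht : 0 ≤ t := hu.1.trans hu.2
    have e1 : ⟪ε, x u a⟫ = (S₀ *ᵥ v) a + (∫ s in (0 : ℝ)..u, (A *ᵥ fun b => ⟪ε, x s b⟫) a)
        + ∑ j, G a j * ∫ s in (0 : ℝ)..u, (Gᵀ *ᵥ (X s *ᵥ v)) j := by
      rw [hs.state u hu.1, inner_add_right, inner_add_right, hs.inner_filterError_init ht,
        inner_intervalIntegral_right (continuous_matAct A hs.continuous_state a)]
      congr 1
      · congr 1
        refine intervalIntegral.integral_congr fun s _ => ?_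
        simp [matAct, inner_sum, inner_smul_right, Matrix.mulVec, dotProduct]
      · simp only [matAct, inner_sum, inner_smul_right]
        exact Finset.sum_congr rfl fun j _ => by rw [hs.inner_filterError_input hu]
    have e2 : (Y u *ᵥ v) a = (S₀ *ᵥ v) a
        + ∫ s in (0 : ℝ)..u, ((G * Gᵀ * X s + A * Y s) *ᵥ v) a := by
      have h1 : ∀ s, HasDerivAt (fun s => (Y s *ᵥ v) a)
          (((G * Gᵀ * X s + A * Y s) *ᵥ v) a) s := fun s =>
        hasDerivAt_pi.1 ((hasDerivAt_flowY A (C * Cᵀ) (G * Gᵀ) S₀ s).matrix_mulVec v) a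
      have hc0 : Continuous fun s => (G * Gᵀ * X s + A * Y s) *ᵥ v := by fun_prop
      have hc : Continuous fun s => ((G * Gᵀ * X s + A * Y s) *ᵥ v) a :=
        (continuous_apply a).comp hc0
      rw [intervalIntegral.integral_eq_sub_of_hasDerivAt (fun s _ => h1 s)
        (hc.intervalIntegrable 0 u)]
      simp [hY, flowY_zero]
    have e3 : ∑ j, G a j * ∫ s in (0 : ℝ)..u, (Gᵀ *ᵥ (X s *ᵥ v)) j
        = ∫ s in (0 : ℝ)..u, ((G * Gᵀ * X s) *ᵥ v) a := by
      simp only [← intervalIntegral.integral_const_mul]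
      rw [← intervalIntegral.integral_finsetSum]
      · refine intervalIntegral.integral_congr fun s _ => ?_
        simp only [Matrix.mul_assoc, ← Matrix.mulVec_mulVec]
        rfl
      · intro j _
        have hc : Continuous fun s => Gᵀ *ᵥ (X s *ᵥ v) := by fun_prop
        exact (((continuous_apply j).comp hc).const_mul (G a j)).intervalIntegrable 0 u
    simp only [Pi.sub_apply]
    rw [e1, e2, e3]
    have hi1 : Continuous fun s => (A *ᵥ fun b => ⟪ε, x s b⟫) a :=
      (continuous_apply a).comp (continuous_const.matrix_mulVec hq)
    have hc2 : Continuous fun s => (G * Gᵀ * X s) *ᵥ v := by fun_prop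
    have hc3 : Continuous fun s => (G * Gᵀ * X s + A * Y s) *ᵥ v := by fun_prop
    have hi2 : Continuous fun s => ((G * Gᵀ * X s) *ᵥ v) a := (continuous_apply a).comp hc2
    have hi3 : Continuous fun s => ((G * Gᵀ * X s + A * Y s) *ᵥ v) a :=
      (continuous_apply a).comp hc3
    have e4 : ∫ s in (0 : ℝ)..u, (A *ᵥ ((fun b => ⟪ε, x s b⟫) - Y s *ᵥ v)) a
        = (∫ s in (0 : ℝ)..u, (A *ᵥ fun b => ⟪ε, x s b⟫) a)
          + ((∫ s in (0 : ℝ)..u, ((G * Gᵀ * X s) *ᵥ v) a)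
          - ∫ s in (0 : ℝ)..u, ((G * Gᵀ * X s + A * Y s) *ᵥ v) a) := by
      rw [← intervalIntegral.integral_sub (hi2.intervalIntegrable 0 u)
        (hi3.intervalIntegrable 0 u), ← intervalIntegral.integral_add
        (hi1.intervalIntegrable 0 u) ((hi2.fun_sub hi3).intervalIntegrable 0 u)]
      refine intervalIntegral.integral_congr fun s _ => ?_
      simp only [Matrix.mulVec_sub, Matrix.add_mulVec, Pi.sub_apply, Pi.add_apply,
        ← Matrix.mulVec_mulVec]
      ring
    rw [e4]
    ring

/-- The signal part of z(u) contributes ∫ CᵀYv and the noise part -∫ CᵀYv: the weight of ν is chosen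
for this cancellation. -/
theorem inner_filterError_output (hs : IsHilbertSystem A S₀ G C x w z ν m₀ e₀) {t : ℝ}
    (v : ι → ℝ) {u : ℝ} (hu : u ∈ Set.Icc 0 t) (k : κ) :
    ⟪filterError A S₀ G C w ν e₀ t v, z u k⟫ = 0 := by
  rw [hs.output u hu.1, inner_add_right, hs.inner_filterError_noise hu,
    inner_intervalIntegral_right (continuous_matAct Cᵀ hs.continuous_state k), add_neg_eq_zero]
  refine intervalIntegral.integral_congr fun s hs' => ?_
  rw [Set.uIcc_of_le hu.1] at hs'
  rw [← hs.inner_filterError_state v s ⟨hs'.1, hs'.2.trans hu.2⟩]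
  simp [matAct, inner_sum, inner_smul_right, Matrix.mulVec, dotProduct]

/-- The filter error is the state minus a linear functional of the observations. -/
theorem filterError_eq (hs : IsHilbertSystem A S₀ G C x w z ν m₀ e₀) {t : ℝ} (ht : 0 ≤ t)
    (v : ι → ℝ) :
    filterError A S₀ G C w ν e₀ t v
      = pairing (flowX A (C * Cᵀ) (G * Gᵀ) S₀ t *ᵥ v) (x t) - (pairing v m₀
        + wienerInt (fun s => Cᵀ *ᵥ (flowY A (C * Cᵀ) (G * Gᵀ) S₀ s *ᵥ v))
          (fun s => Cᵀ *ᵥ ((G * Gᵀ * flowX A (C * Cᵀ) (G * Gᵀ) S₀ s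
            + A * flowY A (C * Cᵀ) (G * Gᵀ) S₀ s) *ᵥ v)) z t) := by
  set X := flowX A (C * Cᵀ) (G * Gᵀ) S₀ with hX
  set Y := flowY A (C * Cᵀ) (G * Gᵀ) S₀ with hY
  set f' := fun s => Gᵀ *ᵥ ((-Aᵀ * X s + C * Cᵀ * Y s) *ᵥ v) with hf'
  set g := fun s => Cᵀ *ᵥ (Y s *ᵥ v) with hg
  set g' := fun s => Cᵀ *ᵥ ((G * Gᵀ * X s + A * Y s) *ᵥ v) with hg'
  have hf'c : Continuous f' := continuous_input_weight v
  have hg'c : Continuous g' := continuous_noise_weight v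
  obtain ⟨Jx, hJx⟩ : ∃ Jx : ℝ → ι → H, ∀ s a,
    Jx s a = x 0 a + ∫ r in (0 : ℝ)..s, matAct A (x r) a := ⟨_, fun _ _ => rfl⟩
  obtain ⟨J, hJ⟩ : ∃ J : ℝ → κ → H, ∀ s k,
    J s k = ∫ r in (0 : ℝ)..s, matAct Cᵀ (x r) k := ⟨_, fun _ _ => rfl⟩
  have hJxd : ∀ s a, HasDerivAt (fun s => Jx s a) (matAct A (x s) a) s := fun s a => by
    simp only [hJx]
    exact (((continuous_matAct A hs.continuous_state a).integral_hasStrictDerivAt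
      0 s).hasDerivAt).const_add _
  have hJd : ∀ s k, HasDerivAt (fun s => J s k) (matAct Cᵀ (x s) k) s := fun s k => by
    simp only [hJ]
    exact ((continuous_matAct Cᵀ hs.continuous_state k).integral_hasStrictDerivAt
      0 s).hasDerivAt
  have hJc : ∀ k, Continuous fun s => J s k := fun k =>
    continuous_iff_continuousAt.2 fun s => (hJd s k).continuousAt
  have hJx' : ∀ s, 0 ≤ s → x s = Jx s + matAct G (w s) := fun s hs' => funext fun a => by
    rw [hs.state s hs', Pi.add_apply, hJx]
  have hz : ∀ s, 0 ≤ s → z s = J s + ν s := fun s hs' => funext fun k => by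
    rw [hs.output s hs', Pi.add_apply, hJ]
  -- Ψ contains only differentiable curves: `Jx` is the state without its forcing and J the output
  -- without its noise. The ordinary product rule therefore suffices, and constancy of Ψ is the
  -- asserted identity.
  obtain ⟨Ψ, hΨ⟩ : ∃ Ψ : ℝ → H, ∀ s, Ψ s = pairing (X s *ᵥ v) (Jx s)
      + (∫ r in (0 : ℝ)..s, pairing (f' r) (w r))
      - (pairing (g s) (J s) - ∫ r in (0 : ℝ)..s, pairing (g' r) (J r)) := ⟨_, fun _ => rfl⟩
  have hΨd : ∀ s, HasDerivAt Ψ (pairing ((-Aᵀ * X s + C * Cᵀ * Y s) *ᵥ v) (Jx s)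
      + pairing (X s *ᵥ v) (matAct A (x s)) + pairing (f' s) (w s)
      - (pairing (g' s) (J s) + pairing (g s) (matAct Cᵀ (x s)) - pairing (g' s) (J s))) s := by
    intro s
    have h1 := hasDerivAt_pairing
      ((hasDerivAt_flowX A (C * Cᵀ) (G * Gᵀ) S₀ s).matrix_mulVec v) (hJxd s)
    have h2 := hasDerivAt_pairing
      (hasDerivAt_mulVec_flow Cᵀ v (hasDerivAt_flowY A (C * Cᵀ) (G * Gᵀ) S₀) s) (hJd s)
    have h3 := ((continuous_pairing hf'c hs.continuous_input).integral_hasStrictDerivAt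
      0 s).hasDerivAt
    have h4 := ((continuous_pairing hg'c hJc).integral_hasStrictDerivAt 0 s).hasDerivAt
    exact ((h1.add h3).sub (h2.sub h4)).congr_of_eventuallyEq (.of_forall hΨ)
  have hΨ0 : ∀ s ∈ Set.Icc 0 t, Ψ s = Ψ 0 := by
    refine constant_of_has_deriv_right_zero
      (fun s _ => (hΨd s).continuousAt.continuousWithinAt) fun s hs' => ?_
    refine ((hΨd s).congr_deriv ?_).hasDerivWithinAt
    have e1 : Jx s = x s - matAct G (w s) := by rw [hJx' s hs'.1, add_sub_cancel_right]
    have e2 : (-Aᵀ * X s + C * Cᵀ * Y s) *ᵥ v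
        = C *ᵥ (Cᵀ *ᵥ (Y s *ᵥ v)) - Aᵀ *ᵥ (X s *ᵥ v) := by
      rw [Matrix.add_mulVec, Matrix.neg_mul, Matrix.neg_mulVec]
      simp only [← Matrix.mulVec_mulVec]
      abel
    simp only [hf', hg]
    rw [e1, pairing_sub_right, pairing_matAct, pairing_matAct, pairing_matAct,
      Matrix.transpose_transpose, e2, pairing_sub_left]
    abel
  have hfin := hΨ0 t ⟨ht, le_rfl⟩
  rw [hΨ, hΨ] at hfin
  have hJx0 : Jx 0 = x 0 := funext fun a => by simp [hJx]
  have hJ0 : J 0 = 0 := funext fun k => by simp [hJ]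
  have hx0 : x 0 = m₀ + e₀ := funext fun a => hs.init a
  have hp0 : pairing (g 0) (0 : κ → H) = 0 := by simp [pairing]
  have hX0 : X 0 = 1 := flowX_zero
  simp only [hX0, Matrix.one_mulVec, hJx0, hJ0, hp0, intervalIntegral.integral_same,
    add_zero, sub_zero] at hfin
  rw [hx0, pairing_add_right] at hfin
  have hzi : wienerInt g g' z t = wienerInt g g' J t + wienerInt g g' ν t := by
    have h1 : ∫ s in (0 : ℝ)..t, pairing (g' s) (z s)
        = (∫ s in (0 : ℝ)..t, pairing (g' s) (J s)) + ∫ s in (0 : ℝ)..t, pairing (g' s) (ν s) := by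
      rw [← intervalIntegral.integral_add
        ((continuous_pairing hg'c hJc).intervalIntegrable 0 t)
        ((continuous_pairing hg'c hs.continuous_noise).intervalIntegrable 0 t)]
      refine intervalIntegral.integral_congr fun s hs' => ?_
      rw [Set.uIcc_of_le ht] at hs'
      rw [hz s hs'.1, pairing_add_right]
    rw [wienerInt, wienerInt, wienerInt, h1, hz t ht, pairing_add_right]
    abel
  have hJw : wienerInt g g' J t
      = pairing (g t) (J t) - ∫ r in (0 : ℝ)..t, pairing (g' r) (J r) := rfl
  rw [filterError, ← hX, ← hY, hzi, hJw, wienerInt, hJx' t ht, pairing_add_right, pairing_matAct]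
  have e3 : pairing (X t *ᵥ v) (Jx t) = pairing v m₀ + pairing v e₀
      - (∫ r in (0 : ℝ)..t, pairing (f' r) (w r))
      + (pairing (g t) (J t) - ∫ r in (0 : ℝ)..t, pairing (g' r) (J r)) := by
    rw [← hfin]
    abel
  rw [e3]
  abel

/-- The linear Kalman-Bucy filter: the error of the estimate is uncorrelated with the observations
and its covariance is given by the Riccati flow. -/
theorem exists_error (hs : IsHilbertSystem A S₀ G C x w z ν m₀ e₀) (hS : S₀.PosSemidef) {t : ℝ}
    (ht : 0 ≤ t) : ∃ e : ι → H,
    (∀ K : Submodule ℝ H, IsClosed (K : Set H) → (∀ b, m₀ b ∈ K) →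
      (∀ s ∈ Set.Icc 0 t, ∀ k, z s k ∈ K) → ∀ a, x t a - e a ∈ K) ∧
    (∀ a b, ⟪e a, m₀ b⟫ = 0) ∧
    (∀ a, ∀ s ∈ Set.Icc 0 t, ∀ k, ⟪e a, z s k⟫ = 0) ∧
    (∀ h : H, (∀ a, ⟪e₀ a, h⟫ = 0) → (∀ s ∈ Set.Icc 0 t, ∀ j, ⟪w s j, h⟫ = 0) →
      (∀ s ∈ Set.Icc 0 t, ∀ k, ⟪ν s k, h⟫ = 0) → ∀ a, ⟪e a, h⟫ = 0) ∧
    ∀ a b, ⟪e a, e b⟫ = flow A (C * Cᵀ) (G * Gᵀ) S₀ t a b := by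
  have hD := posSemidef_mul_transpose C
  have hQ := posSemidef_mul_transpose G
  set X := flowX A (C * Cᵀ) (G * Gᵀ) S₀ with hX
  have hXu : X t * (X t)⁻¹ = 1 := Matrix.mul_nonsing_inv _
    ((Matrix.isUnit_iff_isUnit_det _).1 (isUnit_flowX (A := A) hD hQ hS ht))
  have hXv : ∀ a, X t *ᵥ ((X t)⁻¹ *ᵥ Pi.single a 1) = Pi.single a 1 := fun a => by
    rw [Matrix.mulVec_mulVec, hXu, Matrix.one_mulVec]
  have heq := fun a => hs.filterError_eq ht ((X t)⁻¹ *ᵥ Pi.single a 1)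
  -- The direction v = X(t)⁻¹eₐ gives X(t)v = eₐ, so the filter error is the error of the coordinate
  -- a.
  have hee : ∀ a, ∃ xh : H, filterError A S₀ G C w ν e₀ t ((X t)⁻¹ *ᵥ Pi.single a 1)
      = x t a - xh ∧ ∀ K : Submodule ℝ H, IsClosed (K : Set H) → (∀ b, m₀ b ∈ K) →
      (∀ s ∈ Set.Icc 0 t, ∀ k, z s k ∈ K) → xh ∈ K := fun a => by
    have h1 := heq a
    rw [← hX, hXv, pairing_single] at h1
    exact ⟨_, h1, fun K hK h0 hz => K.add_mem (pairing_mem h0 _)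
      (wienerInt_mem hK (continuous_noise_weight _) hs.continuous_output ht hz)⟩
  choose xh hxh hxK using hee
  refine ⟨fun a => filterError A S₀ G C w ν e₀ t ((X t)⁻¹ *ᵥ Pi.single a 1), ?_, ?_, ?_, ?_, ?_⟩
  · intro K hK h0 hz a
    beta_reduce
    rw [hxh, sub_sub_cancel]
    exact hxK a K hK h0 hz
  · exact fun a b => hs.inner_filterError_known ht _ b
  · exact fun a s hs' k => hs.inner_filterError_output _ hs' k
  · exact fun h h0 hw hν a => hs.inner_filterError_eq_zero ht _ h0 hw hν
  · intro a b
    set εa := filterError A S₀ G C w ν e₀ t ((X t)⁻¹ *ᵥ Pi.single a 1) with hεa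
    -- The error is orthogonal to the known part and the observations, hence to the estimate; its
    -- covariance is therefore its covariance with the state, an entry of YX⁻¹.
    have h1 : ⟪εa, xh b⟫ = 0 := by
      have h2 := hxK b (ℝ ∙ εa)ᗮ (Submodule.isClosed_orthogonal _)
        (fun c => by
          rw [Submodule.mem_orthogonal_singleton_iff_inner_right]
          exact hs.inner_filterError_known ht _ c)
        (fun s hs' k => by
          rw [Submodule.mem_orthogonal_singleton_iff_inner_right]
          exact hs.inner_filterError_output _ hs' k)
      rwa [Submodule.mem_orthogonal_singleton_iff_inner_right] at h2
    have h3 := congrFun (hs.inner_filterError_state ((X t)⁻¹ *ᵥ Pi.single a 1) t ⟨ht, le_rfl⟩) b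
    have h5 : ⟪εa, x t b - xh b⟫ = ⟪εa, x t b⟫ := by rw [inner_sub_right, h1, sub_zero]
    have h4 := transpose_eq_of_posSemidef (posSemidef_flow (A := A) hD hQ hS ht)
    have h6 : (flowY A (C * Cᵀ) (G * Gᵀ) S₀ t *ᵥ ((X t)⁻¹ *ᵥ Pi.single a 1)) b
        = (flow A (C * Cᵀ) (G * Gᵀ) S₀ t) b a := by
      rw [Matrix.mulVec_mulVec, flow, ← hX, Matrix.mulVec_single_one, Matrix.col_apply]
    calc _ = ⟪εa, x t b - xh b⟫ := by rw [← hxh b]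
      _ = _ := h5.trans (h3.trans (h6.trans (congrFun (congrFun h4 a) b)))

end IsHilbertSystem

end Hilbert


/-! ### Gaussian subspaces of `L²` -/

section GaussianSpace

open scoped RealInnerProductSpace ENNReal

set_option linter.unusedSectionVars false

variable {Ω : Type*} {mΩ : MeasurableSpace Ω} {P : Measure Ω} [IsProbabilityMeasure P]

/-- The constant random variable `1`. -/
noncomputable def oneLp (P : Measure Ω) [IsProbabilityMeasure P] : Lp ℝ 2 P :=
  (memLp_const (1 : ℝ)).toLp fun _ => 1

theorem coeFn_oneLp : (oneLp P : Ω → ℝ) =ᵐ[P] fun _ => 1 := MemLp.coeFn_toLp _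

/-- The square integrable random variables that are measurable for the σ-algebra `m`. -/
noncomputable def measurableL2 (m : MeasurableSpace Ω) {mΩ : MeasurableSpace Ω} (P : Measure Ω) :
    Submodule ℝ (Lp ℝ 2 P) :=
  lpMeas ℝ ℝ m 2 P

theorem inner_Lp_eq (f g : Lp ℝ 2 P) : ⟪f, g⟫ = ∫ ω, f ω * g ω ∂P := by
  rw [L2.inner_def]
  exact integral_congr_ae (.of_forall fun ω => by simp [mul_comm])

theorem inner_oneLp (f : Lp ℝ 2 P) : ⟪f, oneLp P⟫ = ∫ ω, f ω ∂P := by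
  rw [inner_Lp_eq]
  refine integral_congr_ae ?_
  filter_upwards [coeFn_oneLp (P := P)] with ω h
  rw [h, mul_one]

theorem mem_measurableL2_of_ae_eq {m : MeasurableSpace Ω} {f : Lp ℝ 2 P} {g : Ω → ℝ}
    (hg : Measurable[m] g) (hfg : f =ᵐ[P] g) : f ∈ measurableL2 m P :=
  mem_lpMeas_iff_aestronglyMeasurable.2 ⟨g, hg.stronglyMeasurable, hfg⟩

theorem isClosed_measurableL2 {m : MeasurableSpace Ω} (hm : m ≤ mΩ) :
    IsClosed (measurableL2 m P : Set (Lp ℝ 2 P)) := by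
  have hfact : Fact (m ≤ mΩ) := ⟨hm⟩
  have h : CompleteSpace (measurableL2 m P) := by
    unfold measurableL2
    infer_instance
  exact (completeSpace_coe_iff_isComplete.1 h).isClosed

theorem oneLp_mem_measurableL2 (m : MeasurableSpace Ω) : oneLp P ∈ measurableL2 m P :=
  mem_measurableL2_of_ae_eq measurable_const coeFn_oneLp

theorem exists_measurable_of_mem_measurableL2 {m : MeasurableSpace Ω} {f : Lp ℝ 2 P}
    (hf : f ∈ measurableL2 m P) : ∃ g : Ω → ℝ, Measurable[m] g ∧ f =ᵐ[P] g := by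
  obtain ⟨g, hg, hfg⟩ := mem_lpMeas_iff_aestronglyMeasurable.1 hf
  exact ⟨g, hg.measurable, hfg⟩

theorem measurableL2_mono {m₁ m₂ : MeasurableSpace Ω} (h : m₁ ≤ m₂) :
    measurableL2 m₁ P ≤ measurableL2 m₂ P := fun f hf => by
  obtain ⟨g, hg, hfg⟩ := exists_measurable_of_mem_measurableL2 hf
  exact mem_measurableL2_of_ae_eq (hg.mono h le_rfl) hfg

theorem indepFun_of_indep_measurable {m₁ m₂ : MeasurableSpace Ω} (h : Indep m₁ m₂ P)
    {f g : Ω → ℝ} (hf : Measurable[m₁] f) (hg : Measurable[m₂] g) : IndepFun f g P :=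
  (IndepFun_iff_Indep f g P).2
    (indep_of_indep_of_le_right (indep_of_indep_of_le_left h hf.comap_le) hg.comap_le)

theorem indepFun_of_mem_measurableL2 {m₁ m₂ : MeasurableSpace Ω} (h : Indep m₁ m₂ P)
    {f g : Lp ℝ 2 P} (hf : f ∈ measurableL2 m₁ P) (hg : g ∈ measurableL2 m₂ P) :
    IndepFun f g P := by
  obtain ⟨f', hf', hff⟩ := exists_measurable_of_mem_measurableL2 hf
  obtain ⟨g', hg', hgg⟩ := exists_measurable_of_mem_measurableL2 hg
  exact (indepFun_of_indep_measurable h hf' hg').congr hff.symm hgg.symm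

theorem inner_of_indep {m₁ m₂ : MeasurableSpace Ω} (h : Indep m₁ m₂ P)
    {f g : Lp ℝ 2 P} (hf : f ∈ measurableL2 m₁ P) (hg : g ∈ measurableL2 m₂ P) :
    ⟪f, g⟫ = ⟪f, oneLp P⟫ * ⟪g, oneLp P⟫ := by
  rw [inner_Lp_eq, inner_oneLp, inner_oneLp]
  exact (indepFun_of_mem_measurableL2 h hf hg).integral_fun_mul_eq_mul_integral
    (Lp.aestronglyMeasurable f) (Lp.aestronglyMeasurable g)

theorem integral_abs_le_norm (f : Lp ℝ 2 P) : ∫ ω, |f ω| ∂P ≤ ‖f‖ := by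
  have h1 : MemLp (fun ω => |f ω|) 2 P := (Lp.memLp f).abs
  have h2 := variance_nonneg (fun ω => |f ω|) P
  rw [variance_eq_sub h1] at h2
  have h3 : ∫ ω, ((fun ω => |f ω|) ^ 2) ω ∂P = ‖f‖ ^ 2 := by
    rw [← real_inner_self_eq_norm_sq, inner_Lp_eq]
    exact integral_congr_ae (.of_forall fun ω => by simp [sq])
  rw [h3] at h2
  exact le_of_sq_le_sq (by linarith) (norm_nonneg f)

/-- A subspace of `L²` all of whose elements are Gaussian random variables. -/
def IsGaussianSpace (V : Submodule ℝ (Lp ℝ 2 P)) : Prop := ∀ f ∈ V, HasGaussianLaw f P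

/-- From |exp(ia) - exp(ib)| ≤ |a - b| and the bound of the L¹ norm by the L² norm, the map is
Lipschitz with constant |t|. -/
theorem continuous_charFun_Lp (t : ℝ) :
    Continuous fun f : Lp ℝ 2 P => ∫ ω, Complex.exp (t * f ω * Complex.I) ∂P := by
  have hi : ∀ f : Lp ℝ 2 P, Integrable (fun ω => Complex.exp (t * f ω * Complex.I)) P := by
    intro f
    refine Integrable.of_bound (C := 1) ?_ (.of_forall fun ω => ?_)
    · have := (Lp.stronglyMeasurable f).measurable
      exact Measurable.aestronglyMeasurable (by fun_prop)
    · rw [← Complex.ofReal_mul, Complex.norm_exp_ofReal_mul_I]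
  refine LipschitzWith.continuous (K := ‖t‖₊) (LipschitzWith.of_dist_le_mul fun f g => ?_)
  rw [dist_eq_norm, dist_eq_norm, ← integral_sub (hi f) (hi g), coe_nnnorm]
  have h1 : ∀ a b : ℝ, ‖Complex.exp (a * Complex.I) - Complex.exp (b * Complex.I)‖ ≤ |a - b| := by
    intro a b
    have : Complex.exp (a * Complex.I) - Complex.exp (b * Complex.I)
        = Complex.exp (b * Complex.I) * (Complex.exp (Complex.I * (a - b : ℝ)) - 1) := by
      rw [mul_sub, ← Complex.exp_add]
      push_cast
      ring_nf
    rw [this, norm_mul, Complex.norm_exp_ofReal_mul_I, one_mul]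
    exact Real.norm_exp_I_mul_ofReal_sub_one_le
  have h2 : Integrable (fun ω => |(f - g) ω|) P :=
    ((Lp.memLp (f - g)).integrable (by norm_num)).abs
  calc ‖∫ ω, (Complex.exp (t * f ω * Complex.I) - Complex.exp (t * g ω * Complex.I)) ∂P‖
      ≤ ∫ ω, |t| * |(f - g) ω| ∂P := by
        refine norm_integral_le_of_norm_le (h2.const_mul _) ?_
        filter_upwards [Lp.coeFn_sub f g] with ω hω
        rw [hω, Pi.sub_apply, ← abs_mul, mul_sub]
        have := h1 (t * f ω) (t * g ω)
        push_cast at this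
        exact this
    _ = |t| * ∫ ω, |(f - g) ω| ∂P := integral_const_mul _ _
    _ ≤ ‖t‖ * ‖f - g‖ := by
        rw [Real.norm_eq_abs]
        exact mul_le_mul_of_nonneg_left (integral_abs_le_norm _) (abs_nonneg _)

/-- Both sides of the characteristic function identity are continuous in f, so being Gaussian is a
closed condition in L². -/
theorem hasGaussianLaw_Lp_iff (f : Lp ℝ 2 P) : HasGaussianLaw f P ↔ ∀ t : ℝ,
    ∫ ω, Complex.exp (t * f ω * Complex.I) ∂P
      = Complex.exp ((t * ⟪f, oneLp P⟫ : ℝ) * Complex.I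
        - (t ^ 2 * (⟪f, f⟫ - ⟪f, oneLp P⟫ ^ 2) : ℝ) / 2) := by
  have hf := (Lp.aestronglyMeasurable f).aemeasurable
  rw [hasGaussianLaw_iff_charFun_map_eq hf]
  refine forall_congr' fun t => ?_
  rw [charFun_apply_real, integral_map hf (by fun_prop)]
  have h1 : P[fun ω => ⟪t, f ω⟫] = t * ⟪f, oneLp P⟫ := by
    rw [inner_oneLp, ← integral_const_mul]
    exact integral_congr_ae (.of_forall fun ω => by simp [mul_comm])
  have h2 : Var[fun ω => ⟪t, f ω⟫; P] = t ^ 2 * (⟪f, f⟫ - ⟪f, oneLp P⟫ ^ 2) := by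
    have : (fun ω => ⟪t, f ω⟫) = fun ω => t * f ω := funext fun ω => by simp [mul_comm]
    rw [this, variance_const_mul, variance_eq_sub (Lp.memLp f), inner_oneLp, inner_Lp_eq]
    simp [sq]
  rw [h1, h2]

theorem IsGaussianSpace.topologicalClosure {V : Submodule ℝ (Lp ℝ 2 P)}
    (hV : IsGaussianSpace V) : IsGaussianSpace V.topologicalClosure := by
  intro f hf
  rw [hasGaussianLaw_Lp_iff]
  intro t
  have hc : IsClosed {f : Lp ℝ 2 P | ∫ ω, Complex.exp (t * f ω * Complex.I) ∂P
      = Complex.exp ((t * ⟪f, oneLp P⟫ : ℝ) * Complex.I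
        - (t ^ 2 * (⟪f, f⟫ - ⟪f, oneLp P⟫ ^ 2) : ℝ) / 2)} :=
    isClosed_eq (continuous_charFun_Lp t) (by fun_prop)
  exact closure_minimal (fun g hg => (hasGaussianLaw_Lp_iff g).1 (hV g hg) t) hc hf

theorem coeFn_linearCombination {T : Type*} (s : Finset T) (c : T → ℝ) (f : T → Lp ℝ 2 P) :
    ((∑ t ∈ s, c t • f t : Lp ℝ 2 P) : Ω → ℝ) =ᵐ[P] fun ω => ∑ t ∈ s, c t * f t ω := by
  have h3 : ∀ᵐ ω ∂P, ∀ t ∈ s, (c t • f t : Lp ℝ 2 P) ω = c t * f t ω :=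
    (ae_ball_iff s.countable_toSet).2 fun t _ => Lp.coeFn_smul (c t) (f t)
  filter_upwards [Lp.coeFn_finsetSum s fun t => c t • f t, h3] with ω h2 h3
  rw [h2, Finset.sum_apply]
  exact Finset.sum_congr rfl h3

/-- A linear functional of a finite-dimensional marginal is a linear combination of the variables,
hence an element of V; Gaussian laws are characterised by such functionals. -/
theorem IsGaussianSpace.isGaussianProcess {V : Submodule ℝ (Lp ℝ 2 P)} (hV : IsGaussianSpace V)
    {T : Type*} {f : T → Lp ℝ 2 P} (hf : ∀ t, f t ∈ V) :
    IsGaussianProcess (fun t => (f t : Ω → ℝ)) P := by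
  classical
  refine ⟨fun I => ⟨?_⟩⟩
  have hm : AEMeasurable (fun ω => I.restrict fun t => f t ω) P :=
    aemeasurable_pi_lambda _ fun t => (Lp.aestronglyMeasurable (f t)).aemeasurable
  refine isGaussian_of_isGaussian_map fun L => ?_
  rw [AEMeasurable.map_map_of_aemeasurable (by fun_prop) hm]
  obtain ⟨c, hc⟩ : ∃ c : I → ℝ, ∀ x : I → ℝ, L x = ∑ t, x t * c t :=
    ⟨_, fun x => LinearMap.pi_apply_eq_sum_univ L.toLinearMap x⟩
  have h1 := coeFn_linearCombination Finset.univ c (fun t => f t)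
  have h2 : HasGaussianLaw (∑ t, c t • f t : Lp ℝ 2 P) P :=
    hV _ (V.sum_mem fun t _ => V.smul_mem _ (hf t))
  refine (h2.congr (h1.trans (.of_forall fun ω => ?_))).isGaussian_map
  rw [Function.comp, hc]
  exact Finset.sum_congr rfl fun t _ => mul_comm _ _

theorem IsGaussianSpace.span_range {T : Type*} {X : T → Ω → ℝ}
    (hX : IsGaussianProcess X P) {f : T → Lp ℝ 2 P} (hf : ∀ t, f t =ᵐ[P] X t) :
    IsGaussianSpace (Submodule.span ℝ (Set.range f)) := by
  intro g hg
  obtain ⟨c, rfl⟩ := (Finsupp.mem_span_range_iff_exists_finsupp).1 hg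
  have h1 := (hX.smul fun t => c t).hasGaussianLaw_fun_sum (I := c.support)
  refine h1.congr ?_
  have h3 : ∀ᵐ ω ∂P, ∀ t ∈ c.support, f t ω = X t ω :=
    (ae_ball_iff c.support.countable_toSet).2 fun t _ => hf t
  filter_upwards [coeFn_linearCombination c.support c f, h3] with ω h2 h3
  rw [Finsupp.sum, h2]
  exact Finset.sum_congr rfl fun t ht => by rw [h3 t ht, smul_eq_mul]

theorem IsGaussianSpace.sup {V W : Submodule ℝ (Lp ℝ 2 P)} (hV : IsGaussianSpace V)
    (hW : IsGaussianSpace W) {m₁ m₂ : MeasurableSpace Ω} (h : Indep m₁ m₂ P)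
    (hV' : V ≤ measurableL2 m₁ P) (hW' : W ≤ measurableL2 m₂ P) : IsGaussianSpace (V ⊔ W) := by
  intro f hf
  obtain ⟨v, hv, w, hw, rfl⟩ := Submodule.mem_sup.1 hf
  have := ((indepFun_of_mem_measurableL2 h (hV' hv) (hW' hw)).hasGaussianLaw (hV v hv) (hW w hw)).add
  exact this.congr (Lp.coeFn_add v w).symm

theorem IsGaussianSpace.iSup {α : Type*} {V : α → Submodule ℝ (Lp ℝ 2 P)}
    (hV : ∀ i, IsGaussianSpace (V i)) {m : α → MeasurableSpace Ω} (h : iIndep m P)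
    (hm : ∀ i, V i ≤ measurableL2 (m i) P) : IsGaussianSpace (⨆ i, V i) := by
  intro f hf
  obtain ⟨c, hc, rfl⟩ := (Submodule.mem_iSup_iff_exists_finsupp _ _).1 hf
  choose g hg hcg using fun i => exists_measurable_of_mem_measurableL2 (hm i (hc i))
  have h1 : iIndepFun g P := (iIndepFun_iff_iIndep _ g P).2
    (iIndep_of_iIndep_of_le h fun i => (hg i).comap_le)
  have h2 : iIndepFun (fun i : c.support => g i) P := h1.precomp Subtype.val_injective
  have h3 := iIndepFun.hasGaussianLaw_fun_sum (X := fun i : c.support => g i)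
    (fun i => (hV i _ (hc i)).congr (hcg i)) h2
  refine h3.congr ?_
  have h4 := Lp.coeFn_finsetSum c.support fun i => c i
  have h5 : ∀ᵐ ω ∂P, ∀ t ∈ c.support, c t ω = g t ω :=
    (ae_ball_iff c.support.countable_toSet).2 fun t _ => hcg t
  filter_upwards [h4, h5] with ω h4 h5
  rw [Finsupp.sum, h4, Finset.sum_apply, Finset.sum_congr rfl h5]
  exact Finset.sum_coe_sort c.support fun i => g i ω

theorem isGaussianSpace_span_oneLp : IsGaussianSpace (Submodule.span ℝ {oneLp P}) := by
  intro f hf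
  obtain ⟨c, rfl⟩ := Submodule.mem_span_singleton.1 hf
  rw [hasGaussianLaw_Lp_iff]
  intro t
  have h1 : ((c • oneLp P : Lp ℝ 2 P) : Ω → ℝ) =ᵐ[P] fun _ => c := by
    filter_upwards [Lp.coeFn_smul c (oneLp P), coeFn_oneLp (P := P)] with ω h1 h2
    rw [h1, Pi.smul_apply, h2, smul_eq_mul, mul_one]
  have h2 : ⟪oneLp P, oneLp P⟫ = (1 : ℝ) := by
    rw [inner_oneLp, integral_congr_ae coeFn_oneLp]
    simp
  rw [integral_congr_ae (g := fun _ => Complex.exp (t * c * Complex.I))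
    (by filter_upwards [h1] with ω h; rw [h])]
  simp only [integral_const, inner_smul_left, inner_smul_right, h2]
  simp [sq]

end GaussianSpace


/-! ### The mean squared error estimate in a Gaussian space -/

section ErrorCov

open scoped RealInnerProductSpace ENNReal

set_option linter.unusedSectionVars false

variable {Ω : Type*} {mΩ : MeasurableSpace Ω} {P : Measure Ω} [IsProbabilityMeasure P]

theorem measurable_coeFn_pi {T : Type*} (e : T → Lp ℝ 2 P) : Measurable fun ω a => e a ω :=
  measurable_pi_lambda _ fun a => (Lp.stronglyMeasurable (e a)).measurable

/-- In a Gaussian space, an error that is uncorrelated with the observations is the error of the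
mean squared error estimate. -/
theorem IsGaussianSpace.isErrorCov {κ : Type*} {n : ℕ} {V : Submodule ℝ (Lp ℝ 2 P)}
    (hV : IsGaussianSpace V) (hVc : IsClosed (V : Set (Lp ℝ 2 P))) (h1 : oneLp P ∈ V)
    {Y : κ → Ω → ℝ} (hYm : ∀ k, Measurable (Y k)) {Y' : κ → Lp ℝ 2 P}
    (hY : ∀ k, Y' k =ᵐ[P] Y k) (hYV : ∀ k, Y' k ∈ V) {X : Ω → Fin n → ℝ}
    {X' e : Fin n → Lp ℝ 2 P} (hX : ∀ a, X' a =ᵐ[P] fun ω => X ω a) (hXV : ∀ a, X' a ∈ V)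
    (hK : ∀ a, ∀ K : Submodule ℝ (Lp ℝ 2 P), IsClosed (K : Set (Lp ℝ 2 P)) → oneLp P ∈ K →
      (∀ k, Y' k ∈ K) → X' a - e a ∈ K)
    (he1 : ∀ a, ⟪e a, oneLp P⟫ = 0) (heY : ∀ a k, ⟪e a, Y' k⟫ = 0)
    {S : Matrix (Fin n) (Fin n) ℝ} (hS : ∀ a b, ⟪e a, e b⟫ = S a b)
    {F : MeasurableSpace Ω} (hF : F = ⨆ k, MeasurableSpace.comap (Y k) inferInstance) :
    IsErrorCov (mΩ := mΩ) F P X S := by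
  have hFm : F ≤ mΩ := by
    rw [hF]
    exact iSup_le fun k => (hYm k).comap_le
  have hFY : F = MeasurableSpace.comap (fun ω k => Y k ω) inferInstance := by
    rw [hF, MeasurableSpace.pi, MeasurableSpace.comap_iSup]
    simp only [MeasurableSpace.comap_comp]
    rfl
  -- The hypothesis on closed subspaces is used twice: with K = V here, and with K = L²(F) for
  -- measurability of the estimate.
  have heV : ∀ a, e a ∈ V := fun a => by
    have := V.sub_mem (hXV a) (hK a V hVc h1 hYV)
    rwa [sub_sub_cancel] at this
  have hKF : ∀ a, X' a - e a ∈ measurableL2 F P := fun a =>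
    hK a _ (isClosed_measurableL2 hFm) (oneLp_mem_measurableL2 F) fun k =>
      mem_measurableL2_of_ae_eq
        (((comap_measurable (Y k)).mono (le_iSup (fun k => MeasurableSpace.comap (Y k) _) k)
          le_rfl).mono hF.ge le_rfl) (hY k)
  have hgp : IsGaussianProcess (Sum.elim (fun a => (e a : Ω → ℝ)) Y) P := by
    refine (hV.isGaussianProcess (f := Sum.elim e Y') ?_).congr ?_
    · rintro (a | k)
      exacts [heV a, hYV k]
    · rintro (a | k)
      exacts [.rfl, hY k]
  -- Errors and observations are jointly Gaussian and uncorrelated, hence independent.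
  have hind : IndepFun (fun ω a => e a ω) (fun ω k => Y k ω) P := by
    refine hgp.indepFun_of_covariance_eq_zero
      (fun a => (Lp.aestronglyMeasurable (e a)).aemeasurable)
      (fun k => (hYm k).aemeasurable) fun a k => ?_
    have hL : MemLp (Y k) 2 P := (Lp.memLp (Y' k)).ae_eq (hY k)
    rw [covariance_eq_sub (Lp.memLp (e a)) hL, ← inner_oneLp, he1, zero_mul, sub_zero,
      ← heY a k, inner_Lp_eq]
    refine integral_congr_ae ?_
    filter_upwards [hY k] with ω h
    rw [Pi.mul_apply, h]
  have hm : MeasurableSpace.comap (fun ω a => e a ω) inferInstance ≤ mΩ :=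
    (measurable_coeFn_pi e).comap_le
  have hem : ∀ a, Measurable[MeasurableSpace.comap (fun ω (a : Fin n) => e a ω) inferInstance]
      (e a) := fun a => (measurable_pi_apply a).comp
      (comap_measurable fun ω (a : Fin n) => e a ω)
  have hindep : Indep (MeasurableSpace.comap (fun ω a => e a ω) inferInstance) F P := by
    rw [hFY]
    exact hind
  have hce : ∀ a, condExp F P (e a) =ᵐ[P] fun _ => 0 := fun a => by
    have := condExp_indep_eq hm hFm (hem a).stronglyMeasurable hindep
    rwa [← inner_oneLp, he1] at this
  have herr : ∀ a, (fun ω => estimationError (mΩ := mΩ) F P X ω a) =ᵐ[P] e a := fun a => by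
    have hd : X' a = (X' a - e a) + e a := by rw [sub_add_cancel]
    have h2 : (fun ω => X ω a) =ᵐ[P] ((X' a - e a : Lp ℝ 2 P) : Ω → ℝ) + e a := by
      refine (hX a).symm.trans ?_
      conv_lhs => rw [hd]
      exact Lp.coeFn_add _ _
    have hi : ∀ f : Lp ℝ 2 P, Integrable f P := fun f => (Lp.memLp f).integrable (by norm_num)
    have h3 := (condExp_congr_ae (m := F) h2).trans (condExp_add (hi _) (hi _) F)
    have h4 := condExp_of_aestronglyMeasurable' hFm
      (mem_lpMeas_iff_aestronglyMeasurable.1 (hKF a)) (hi _)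
    filter_upwards [h2, h3, h4, hce a] with ω h2 h3 h4 h5
    rw [estimationError, h3, h2, Pi.add_apply, Pi.add_apply, h4, h5]
    ring
  refine ⟨hFm, fun a b => ?_⟩
  have h5 : (fun ω => estimationError (mΩ := mΩ) F P X ω a * estimationError (mΩ := mΩ) F P X ω b)
      =ᵐ[P] (e a : Ω → ℝ) * e b := (herr a).mul (herr b)
  refine (condExp_congr_ae h5).trans ?_
  -- Products of errors are also independent of F, so their conditional expectation is the constant
  -- ⟪e a, e b⟫.
  have h6 := condExp_indep_eq hm hFm ((hem a).mul (hem b)).stronglyMeasurable hindep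
  refine h6.trans (.of_forall fun ω => ?_)
  rw [← hS, inner_Lp_eq]
  rfl

end ErrorCov

/-! ### Integrals of processes -/

section Riemann

/-- Riemann sums of a continuous function converge to the integral. -/
theorem tendsto_riemannSum {E : Type*} [NormedAddCommGroup E] [NormedSpace ℝ E] [CompleteSpace E]
    {f : ℝ → E} (hf : Continuous f) {t : ℝ} (ht : 0 ≤ t) :
    Tendsto (fun n : ℕ => ∑ i ∈ Finset.range (n + 1), (t / (n + 1)) • f (i * (t / (n + 1)))) atTop
      (𝓝 (∫ s in (0 : ℝ)..t, f s)) := by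
  rw [Metric.tendsto_atTop]
  intro ε hε
  have huc : UniformContinuousOn f (Set.Icc 0 t) :=
    isCompact_Icc.uniformContinuousOn_of_continuous hf.continuousOn
  -- The total error is at most εt/(t+1) < ε; the denominator t + 1 also covers t = 0.
  have hε' : 0 < ε / (t + 1) := by positivity
  obtain ⟨δ, hδ, hfδ⟩ := Metric.uniformContinuousOn_iff.1 huc _ hε'
  obtain ⟨n₀, hn₀⟩ := exists_nat_gt (t / δ)
  refine ⟨n₀, fun n hn => ?_⟩
  have hn1 : (0 : ℝ) < n + 1 := by positivity
  obtain ⟨h, hh⟩ : ∃ h, h = t / (n + 1) := ⟨_, rfl⟩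
  have hh0 : 0 ≤ h := by rw [hh]; positivity
  have hhδ : h < δ := by
    rw [hh, div_lt_iff₀ hn1]
    have h1 : t / δ < n + 1 := hn₀.trans_le (by exact_mod_cast hn.trans (Nat.le_succ n))
    rw [div_lt_iff₀ hδ] at h1
    linarith
  have hht : (n + 1) * h = t := by rw [hh]; field_simp
  have h1 : ∫ s in (0 : ℝ)..t, f s
      = ∑ i ∈ Finset.range (n + 1), ∫ s in (i * h)..((i + 1 : ℕ) * h), f s := by
    rw [intervalIntegral.sum_integral_adjacent_intervals (a := fun i : ℕ => (i : ℝ) * h)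
      fun i _ => hf.intervalIntegrable _ _]
    rw [Nat.cast_zero, zero_mul, Nat.cast_add, Nat.cast_one, hht]
  rw [← hh, dist_eq_norm, h1, ← Finset.sum_sub_distrib]
  have h2 : ∀ i ∈ Finset.range (n + 1),
      ‖h • f (i * h) - ∫ s in (i * h)..((i + 1 : ℕ) * h), f s‖ ≤ ε / (t + 1) * h := by
    intro i hi
    have hi' : (i : ℝ) + 1 ≤ n + 1 := by
      exact_mod_cast Nat.succ_le_of_lt (Finset.mem_range.1 hi)
    have e1 : h • f (i * h) = ∫ _ in (i * h)..((i + 1 : ℕ) * h), f (i * h) := by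
      rw [intervalIntegral.integral_const]
      push_cast
      ring_nf
    rw [e1, ← intervalIntegral.integral_sub (by simp) (hf.intervalIntegrable _ _)]
    have e2 : (i : ℝ) * h ≤ (i + 1 : ℕ) * h := by push_cast; nlinarith
    refine (intervalIntegral.norm_integral_le_of_norm_le_const (C := ε / (t + 1))
      fun s hs => ?_).trans (le_of_eq ?_)
    · rw [Set.uIoc_of_le e2] at hs
      have hs2 : s ≤ (i + 1) * h := by have := hs.2; push_cast at this; exact this
      have hi0 : 0 ≤ (i : ℝ) * h := by positivity
      have hst : s ≤ t := by
        rw [← hht]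
        exact hs2.trans (mul_le_mul_of_nonneg_right hi' hh0)
      rw [← dist_eq_norm]
      refine (hfδ _ ⟨hi0, hs.1.le.trans hst⟩ _ ⟨hi0.trans hs.1.le, hst⟩ ?_).le
      rw [Real.dist_eq, abs_sub_comm, abs_of_pos (sub_pos.2 hs.1)]
      linarith
    · rw [abs_of_nonneg (sub_nonneg.2 e2)]
      push_cast
      ring
  calc _ ≤ ∑ i ∈ Finset.range (n + 1), ε / (t + 1) * h := norm_sum_le_of_le _ h2
    _ = ε / (t + 1) * t := by
      rw [Finset.sum_const, Finset.card_range, nsmul_eq_mul]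
      push_cast
      rw [← hht]
      ring
    _ < ε := by
      rw [div_mul_eq_mul_div, div_lt_iff₀ (by positivity)]
      nlinarith

variable {Ω : Type*} {mΩ : MeasurableSpace Ω} {P : Measure Ω} [IsProbabilityMeasure P]

/-- The integral of an `L²`-continuous process with continuous paths can be computed in `L²` or
pathwise. -/
theorem coeFn_intervalIntegral {X : ℝ → Ω → ℝ} {X' : ℝ → Lp ℝ 2 P}
    (hX : ∀ s, X' s =ᵐ[P] X s) (hX' : Continuous X')
    (hXc : ∀ᵐ ω ∂P, Continuous fun s => X s ω) {t : ℝ} (ht : 0 ≤ t) :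
    ((∫ s in (0 : ℝ)..t, X' s : Lp ℝ 2 P) : Ω → ℝ)
      =ᵐ[P] fun ω => ∫ s in (0 : ℝ)..t, X s ω := by
  have h1 := tendstoInMeasure_of_tendsto_Lp (tendsto_riemannSum hX' ht)
  have h2 : ∀ n : ℕ, ((∑ i ∈ Finset.range (n + 1), (t / (n + 1)) • X' (i * (t / (n + 1)))
      : Lp ℝ 2 P) : Ω → ℝ) =ᵐ[P] fun ω => ∑ i ∈ Finset.range (n + 1),
        (t / (n + 1)) • X (i * (t / (n + 1))) ω := by
    intro n
    have h3 : ∀ᵐ ω ∂P, ∀ i : ℕ, X' (i * (t / (n + 1))) ω = X (i * (t / (n + 1))) ω :=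
      ae_all_iff.2 fun i => hX _
    filter_upwards [coeFn_linearCombination (Finset.range (n + 1)) (fun _ => t / (n + 1))
      (fun i : ℕ => X' (i * (t / (n + 1)))), h3] with ω h4 h3
    rw [h4]
    exact Finset.sum_congr rfl fun i _ => by rw [h3, smul_eq_mul]
  -- The same Riemann sums converge to the L² integral in measure and to the pathwise integral
  -- almost surely; limits in measure are unique.
  refine tendstoInMeasure_ae_unique h1 (tendstoInMeasure_of_tendsto_ae
    (fun n => Lp.aestronglyMeasurable _) ?_)
  filter_upwards [hXc, ae_all_iff.2 h2] with ω hc h2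
  simp only [h2]
  exact tendsto_riemannSum hc ht

end Riemann

/-! ### Linear equations with additive input -/

section Linear

open Matrix

set_option linter.unusedSectionVars false

variable {E : Type*} [NormedAddCommGroup E] [InnerProductSpace ℝ E] [CompleteSpace E]
variable {ι κ μ : Type*} [Fintype ι] [Fintype κ] [Fintype μ] [DecidableEq ι]

theorem matAct_real (M : Matrix κ ι ℝ) (v : ι → ℝ) : matAct M v = M *ᵥ v := rfl

theorem matAct_matAct (M : Matrix μ κ ℝ) (N : Matrix κ ι ℝ) (X : ι → E) :
    matAct M (matAct N X) = matAct (M * N) X := by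
  funext j
  simp only [matAct, Finset.smul_sum, smul_smul, Matrix.mul_apply, Finset.sum_smul]
  exact Finset.sum_comm

theorem matAct_add (M : Matrix κ ι ℝ) (X Y : ι → E) :
    matAct M (X + Y) = matAct M X + matAct M Y := by
  funext k
  simp [matAct, Finset.sum_add_distrib]

theorem matAct_sub (M : Matrix κ ι ℝ) (X Y : ι → E) :
    matAct M (X - Y) = matAct M X - matAct M Y := by
  funext k
  simp [matAct, smul_sub, Finset.sum_sub_distrib]

theorem matAct_one (X : ι → E) : matAct (1 : Matrix ι ι ℝ) X = X := by
  funext k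
  simp [matAct, Matrix.one_apply, ite_smul]

theorem hasDerivAt_matAct {M : ℝ → Matrix κ ι ℝ} {M' : Matrix κ ι ℝ} {X : ℝ → ι → E}
    {X' : ι → E} {t : ℝ} (hM : ∀ k a, HasDerivAt (fun s => M s k a) (M' k a) t)
    (hX : ∀ a, HasDerivAt (fun s => X s a) (X' a) t) (k : κ) :
    HasDerivAt (fun s => matAct (M s) (X s) k) (matAct M' (X t) k + matAct (M t) X' k) t :=
  hasDerivAt_pairing (r := fun s => M s k) (hasDerivAt_pi.2 (hM k)) hX

theorem continuous_matAct' {M : ℝ → Matrix κ ι ℝ} {X : ℝ → ι → E} (hM : Continuous M)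
    (hX : ∀ a, Continuous fun s => X s a) (k : κ) : Continuous fun s => matAct (M s) (X s) k :=
  continuous_pairing ((continuous_apply k).comp hM) hX

/-- The solution of `x(t) = x₀ + ∫₀ᵗ A x(s) ds + g(t)`. -/
noncomputable def linearResponse (A : Matrix ι ι ℝ) (x₀ : ι → E) (g : ℝ → ι → E) (t : ℝ)
    (a : ι) : E :=
  matAct (NormedSpace.exp (t • A))
    (fun b => x₀ b + ∫ s in (0 : ℝ)..t, matAct (NormedSpace.exp (-(s • A)) * A) (g s) b) a + g t a

theorem continuous_exp_neg_mul (A : Matrix ι ι ℝ) :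
    Continuous fun s : ℝ => NormedSpace.exp (-(s • A)) * A := by
  have h := (continuous_matrix_exp_smul A).comp continuous_neg
  simp only [Function.comp_def, neg_smul] at h
  exact h.matrix_mul continuous_const

/-- The formula is variation of constants after integration by parts, so it needs only continuity of
g: the part x - g is differentiable with derivative Ax. -/
theorem hasDerivAt_linearResponse_aux (A : Matrix ι ι ℝ) (x₀ : ι → E) {g : ℝ → ι → E}
    (hg : ∀ a, Continuous fun s => g s a) (t : ℝ) (a : ι) :
    HasDerivAt (fun t => linearResponse A x₀ g t a - g t a) (matAct A (linearResponse A x₀ g t) a)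
      t := by
  simp only [linearResponse, add_sub_cancel_right]
  have h1 : ∀ k c, HasDerivAt (fun s : ℝ => NormedSpace.exp (s • A) k c)
      ((A * NormedSpace.exp (t • A)) k c) t := fun k c =>
    hasDerivAt_pi.1 (hasDerivAt_pi.1 (hasDerivAt_matrix_exp A t) k) c
  have h2 : ∀ b, HasDerivAt (fun t : ℝ => x₀ b
      + ∫ s in (0 : ℝ)..t, matAct (NormedSpace.exp (-(s • A)) * A) (g s) b)
      (matAct (NormedSpace.exp (-(t • A)) * A) (g t) b) t := fun b =>
    ((continuous_matAct' (continuous_exp_neg_mul A) hg b).integral_hasStrictDerivAt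
      0 t).hasDerivAt.const_add _
  refine (hasDerivAt_matAct h1 h2 a).congr_deriv ?_
  have e1 : NormedSpace.exp (t • A) * (NormedSpace.exp (-(t • A)) * A) = A := by
    rw [← Matrix.mul_assoc, ← smul_neg, matrix_exp_mul_neg, Matrix.one_mul]
  have e2 : linearResponse A x₀ g t = matAct (NormedSpace.exp (t • A))
    (fun b => x₀ b + ∫ s in (0 : ℝ)..t, matAct (NormedSpace.exp (-(s • A)) * A) (g s) b) + g t :=
    rfl
  change _ + matAct _ (matAct _ (g t)) a = _
  rw [matAct_matAct, e1, ← matAct_matAct, e2, matAct_add]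
  rfl

theorem continuous_linearResponse (A : Matrix ι ι ℝ) (x₀ : ι → E) {g : ℝ → ι → E}
    (hg : ∀ a, Continuous fun s => g s a) (a : ι) :
    Continuous fun t => linearResponse A x₀ g t a := by
  have h1 : Continuous fun t => linearResponse A x₀ g t a - g t a :=
    continuous_iff_continuousAt.2 fun t => (hasDerivAt_linearResponse_aux A x₀ hg t a).continuousAt
  exact (h1.add (hg a)).congr fun t => sub_add_cancel _ _

theorem linearResponse_eq (A : Matrix ι ι ℝ) (x₀ : ι → E) {g : ℝ → ι → E}
    (hg : ∀ a, Continuous fun s => g s a) (t : ℝ) (a : ι) :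
    linearResponse A x₀ g t a
      = x₀ a + (∫ s in (0 : ℝ)..t, matAct A (linearResponse A x₀ g s) a) + g t a := by
  rw [intervalIntegral.integral_eq_sub_of_hasDerivAt
    (fun s _ => hasDerivAt_linearResponse_aux A x₀ hg s a)
    ((continuous_matAct A (continuous_linearResponse A x₀ hg) a).intervalIntegrable 0 t)]
  have h0 : linearResponse A x₀ g 0 a - g 0 a = x₀ a := by
    simp [linearResponse, matAct_one]
  rw [h0]
  abel

/-- Uniqueness identifies each path with the explicit formula; the same formula evaluated in L² then
represents the state process. -/
theorem eq_linearResponse (A : Matrix ι ι ℝ) {x₀ : ι → ℝ} {g x : ℝ → ι → ℝ}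
    (hg : Continuous g) (hx : Continuous x)
    (h : ∀ t, 0 ≤ t → ∀ a, x t a = x₀ a + (∫ s in (0 : ℝ)..t, (A *ᵥ x s) a) + g t a)
    {t : ℝ} (ht : 0 ≤ t) : x t = linearResponse A x₀ g t := by
  have hg' : ∀ a, Continuous fun s => g s a := fun a => (continuous_apply a).comp hg
  have hy : Continuous (linearResponse A x₀ g) :=
    continuous_pi (continuous_linearResponse A x₀ hg')
  refine sub_eq_zero.1 (eq_zero_of_eq_integral A (δ := fun t => x t - linearResponse A x₀ g t)
    (t := t) (hx.sub hy) (fun u hu a => ?_) t ⟨ht, le_rfl⟩)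
  have h1 : Continuous fun s => (A *ᵥ x s) a :=
    (continuous_apply a).comp (continuous_const.matrix_mulVec hx)
  have h2 : Continuous fun s => (A *ᵥ linearResponse A x₀ g s) a :=
    (continuous_apply a).comp (continuous_const.matrix_mulVec hy)
  simp only [Matrix.mulVec_sub, Pi.sub_apply]
  rw [intervalIntegral.integral_sub (h1.intervalIntegrable 0 u) (h2.intervalIntegrable 0 u),
    h u hu.1, linearResponse_eq A x₀ hg']
  simp only [matAct_real]
  ring

end Linear


/-! ### Gaussian inputs in `L²` -/

section Input

open scoped RealInnerProductSpace ENNReal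

set_option linter.unusedSectionVars false

variable {Ω : Type*} {mΩ : MeasurableSpace Ω} {P : Measure Ω} [IsProbabilityMeasure P]

open Classical in
/-- The class in `L²` of a square integrable random variable. -/
noncomputable def toL2 (P : Measure Ω) (f : Ω → ℝ) : Lp ℝ 2 P :=
  if h : MemLp f 2 P then h.toLp f else 0

theorem coeFn_toL2 {f : Ω → ℝ} (h : MemLp f 2 P) : toL2 P f =ᵐ[P] f := by
  rw [toL2, dif_pos h]
  exact h.coeFn_toLp

theorem inner_toL2 {f g : Ω → ℝ} (hf : MemLp f 2 P) (hg : MemLp g 2 P) :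
    ⟪toL2 P f, toL2 P g⟫ = cov[f, g; P] + (∫ ω, f ω ∂P) * ∫ ω, g ω ∂P := by
  rw [covariance_eq_sub hf hg, sub_add_cancel, inner_Lp_eq]
  refine integral_congr_ae ?_
  filter_upwards [coeFn_toL2 hf, coeFn_toL2 hg] with ω h1 h2
  rw [h1, h2, Pi.mul_apply]

theorem inner_toL2_oneLp {f : Ω → ℝ} (hf : MemLp f 2 P) :
    ⟪toL2 P f, oneLp P⟫ = ∫ ω, f ω ∂P := by
  rw [inner_oneLp]
  exact integral_congr_ae (coeFn_toL2 hf)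

theorem toL2_mem_measurableL2 {m : MeasurableSpace Ω} {f : Ω → ℝ}
    (hf : MemLp f 2 P) (hm : Measurable[m] f) : toL2 P f ∈ measurableL2 m P :=
  mem_measurableL2_of_ae_eq hm (coeFn_toL2 hf)

theorem inner_oneLp_oneLp : ⟪oneLp P, oneLp P⟫ = (1 : ℝ) := by
  rw [inner_oneLp, integral_congr_ae coeFn_oneLp]
  simp

theorem memLp_brownian {B : ℝ≥0 → Ω → ℝ} (hB : IsBrownianReal B P) (t : ℝ≥0) :
    MemLp (B t) 2 P :=
  (hB.toIsPreBrownianReal.isGaussianProcess.hasGaussianLaw_eval t).memLp_two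

theorem inner_toL2_brownian {B : ℝ≥0 → Ω → ℝ} (hB : IsBrownianReal B P) (s t : ℝ≥0) :
    ⟪toL2 P (B s), toL2 P (B t)⟫ = min (s : ℝ) t := by
  rw [inner_toL2 (memLp_brownian hB s) (memLp_brownian hB t),
    hB.toIsPreBrownianReal.covariance_eval, hB.toIsPreBrownianReal.integral_eval, zero_mul,
    add_zero, NNReal.coe_min]

theorem inner_toL2_brownian_oneLp {B : ℝ≥0 → Ω → ℝ} (hB : IsBrownianReal B P) (t : ℝ≥0) :
    ⟪toL2 P (B t), oneLp P⟫ = 0 := by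
  rw [inner_toL2_oneLp (memLp_brownian hB t), hB.toIsPreBrownianReal.integral_eval]

/-- The squared L² distance between two times is |s - t|. -/
theorem continuous_toL2_brownian {B : ℝ≥0 → Ω → ℝ} (hB : IsBrownianReal B P) :
    Continuous fun s : ℝ => toL2 P (B s.toNNReal) := by
  have h1 : ∀ s t : ℝ≥0, ‖toL2 P (B s) - toL2 P (B t)‖ = Real.sqrt |(s : ℝ) - t| := by
    intro s t
    rw [norm_eq_sqrt_real_inner, inner_sub_left, inner_sub_right, inner_sub_right]
    simp only [inner_toL2_brownian hB]
    congr 1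
    rcases le_total (s : ℝ) t with h | h
    · rw [min_self, min_self, min_eq_left h, min_eq_right h, abs_of_nonpos (by linarith)]
      ring
    · rw [min_self, min_self, min_eq_right h, min_eq_left h, abs_of_nonneg (by linarith)]
      ring
  refine continuous_iff_continuousAt.2 fun t => ?_
  rw [ContinuousAt, tendsto_iff_norm_sub_tendsto_zero]
  simp only [h1]
  have h2 : Continuous fun s : ℝ => Real.sqrt |(s.toNNReal : ℝ) - t.toNNReal| := by fun_prop
  have h3 := h2.tendsto t
  simpa using h3

/-- The values of a family of processes, indexed by real times, in `L²`. -/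
noncomputable def familyL2 {α : Type*} (P : Measure Ω) (U : α → ℝ≥0 → Ω → ℝ) (s : ℝ) (u : α) :
    Lp ℝ 2 P :=
  toL2 P (U u s.toNNReal)

/-- The σ-algebra of a process. -/
@[reducible] def processAlgebra {T : Type*} (X : T → Ω → ℝ) : MeasurableSpace Ω :=
  MeasurableSpace.comap (fun ω t => X t ω) inferInstance

theorem measurable_processAlgebra {T : Type*} (X : T → Ω → ℝ) (t : T) :
    Measurable[processAlgebra X] (X t) :=
  (measurable_pi_apply t).comp (comap_measurable fun ω t => X t ω)

section Brownian

variable {α : Type*} {U : α → ℝ≥0 → Ω → ℝ}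

theorem inner_familyL2 [DecidableEq α] (hU : ∀ u, IsBrownianReal (U u) P)
    (hi : iIndepFun (fun u ω t => U u t ω) P) {s t : ℝ} (hs : 0 ≤ s) (ht : 0 ≤ t) (i j : α) :
    ⟪familyL2 P U s i, familyL2 P U t j⟫ = if j = i then min t s else 0 := by
  split_ifs with h
  · rw [h, familyL2, familyL2, inner_toL2_brownian (hU i), Real.coe_toNNReal s hs,
      Real.coe_toNNReal t ht, min_comm]
  · have h1 : Indep (processAlgebra (U i)) (processAlgebra (U j)) P :=
      hi.indepFun (Ne.symm h)
    rw [familyL2, familyL2, inner_of_indep h1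
      (toL2_mem_measurableL2 (memLp_brownian (hU i) _) (measurable_processAlgebra (U i) _))
      (toL2_mem_measurableL2 (memLp_brownian (hU j) _) (measurable_processAlgebra (U j) _)),
      inner_toL2_brownian_oneLp (hU i), zero_mul]

theorem familyL2_zero (hU : ∀ u, IsBrownianReal (U u) P) (i : α) : familyL2 P U 0 i = 0 := by
  rw [← inner_self_eq_zero (𝕜 := ℝ), familyL2, inner_toL2_brownian (hU i)]
  simp

/-- The space spanned by a family of processes. -/
noncomputable def familySpan {T : Type*} (P : Measure Ω) (X : α → T → Ω → ℝ) :
    Submodule ℝ (Lp ℝ 2 P) :=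
  ⨆ u, Submodule.span ℝ (Set.range fun t => toL2 P (X u t))

theorem toL2_mem_familySpan {T : Type*} (X : α → T → Ω → ℝ) (u : α) (t : T) :
    toL2 P (X u t) ∈ familySpan P X :=
  (le_iSup (fun u => Submodule.span ℝ (Set.range fun t => toL2 P (X u t))) u)
    (Submodule.subset_span ⟨t, rfl⟩)

theorem familySpan_le {T : Type*} {X : α → T → Ω → ℝ} (hX : ∀ u t, MemLp (X u t) 2 P)
    {m : MeasurableSpace Ω} (hm : ∀ u t, Measurable[m] (X u t)) :
    familySpan P X ≤ measurableL2 m P :=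
  iSup_le fun u => Submodule.span_le.2 <| by
    rintro _ ⟨t, rfl⟩
    exact toL2_mem_measurableL2 (hX u t) (hm u t)

theorem isGaussianSpace_familySpan {T : Type*} {X : α → T → Ω → ℝ}
    (hX : ∀ u, IsGaussianProcess (X u) P) (hi : iIndepFun (fun u ω t => X u t ω) P) :
    IsGaussianSpace (familySpan P X) := by
  have hL : ∀ u t, MemLp (X u t) 2 P := fun u t => ((hX u).hasGaussianLaw_eval t).memLp_two
  refine IsGaussianSpace.iSup (m := fun u => processAlgebra (X u))
    (fun u => IsGaussianSpace.span_range (hX u) fun t => coeFn_toL2 (hL u t))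
    hi.iIndep fun u => Submodule.span_le.2 ?_
  rintro _ ⟨t, rfl⟩
  exact toL2_mem_measurableL2 (hL u t) (measurable_processAlgebra (X u) t)

end Brownian

theorem isGaussianProcess_of_hasGaussianLaw {n : ℕ} {X : Ω → Fin n → ℝ}
    (hX : HasGaussianLaw X P) : IsGaussianProcess (fun a ω => X ω a) P := by
  refine ⟨fun I => ?_⟩
  exact hX.map_fun (ContinuousLinearMap.pi fun a : I => ContinuousLinearMap.proj (a : Fin n))

/-- The closed space generated by constants and three independent Gaussian spaces. -/
noncomputable def systemSpace (V₀ V₁ V₂ : Submodule ℝ (Lp ℝ 2 P)) : Submodule ℝ (Lp ℝ 2 P) :=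
  (Submodule.span ℝ {oneLp P} ⊔ (V₀ ⊔ (V₁ ⊔ V₂))).topologicalClosure

theorem isGaussianSpace_systemSpace {V₀ V₁ V₂ : Submodule ℝ (Lp ℝ 2 P)}
    {m₀ m₁ m₂ : MeasurableSpace Ω} (h₀ : V₀ ≤ measurableL2 m₀ P) (h₁ : V₁ ≤ measurableL2 m₁ P)
    (h₂ : V₂ ≤ measurableL2 m₂ P) (hV₀ : IsGaussianSpace V₀) (hV₁ : IsGaussianSpace V₁)
    (hV₂ : IsGaussianSpace V₂) (h12 : Indep m₁ m₂ P) (h012 : Indep m₀ (m₁ ⊔ m₂) P) :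
    IsGaussianSpace (systemSpace V₀ V₁ V₂) := by
  refine IsGaussianSpace.topologicalClosure ?_
  have e1 := hV₁.sup hV₂ h12 h₁ h₂
  have e2 : V₁ ⊔ V₂ ≤ measurableL2 (m₁ ⊔ m₂) P :=
    sup_le (h₁.trans (measurableL2_mono le_sup_left)) (h₂.trans (measurableL2_mono le_sup_right))
  have e3 := hV₀.sup e1 h012 h₀ e2
  have e4 : V₀ ⊔ (V₁ ⊔ V₂) ≤ measurableL2 (m₀ ⊔ (m₁ ⊔ m₂)) P :=
    sup_le (h₀.trans (measurableL2_mono le_sup_left)) (e2.trans (measurableL2_mono le_sup_right))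
  -- Constants are measurable for the trivial σ-algebra, which is independent of every other.
  refine isGaussianSpace_span_oneLp.sup e3 (m₁ := ⊥) (indep_bot_left _) ?_ e4
  rw [Submodule.span_le, Set.singleton_subset_iff]
  exact oneLp_mem_measurableL2 ⊥

section systemSpace

variable {V₀ V₁ V₂ : Submodule ℝ (Lp ℝ 2 P)}

theorem isClosed_systemSpace : IsClosed (systemSpace V₀ V₁ V₂ : Set (Lp ℝ 2 P)) :=
  Submodule.isClosed_topologicalClosure _

theorem oneLp_mem_systemSpace : oneLp P ∈ systemSpace V₀ V₁ V₂ :=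
  Submodule.le_topologicalClosure _ (Submodule.mem_sup_left (Submodule.mem_span_singleton_self _))

theorem mem_systemSpace_zero {f : Lp ℝ 2 P} (hf : f ∈ V₀) : f ∈ systemSpace V₀ V₁ V₂ :=
  Submodule.le_topologicalClosure _ (Submodule.mem_sup_right (Submodule.mem_sup_left hf))

theorem mem_systemSpace_one {f : Lp ℝ 2 P} (hf : f ∈ V₁) : f ∈ systemSpace V₀ V₁ V₂ :=
  Submodule.le_topologicalClosure _ (Submodule.mem_sup_right (Submodule.mem_sup_right
    (Submodule.mem_sup_left hf)))

theorem mem_systemSpace_two {f : Lp ℝ 2 P} (hf : f ∈ V₂) : f ∈ systemSpace V₀ V₁ V₂ :=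
  Submodule.le_topologicalClosure _ (Submodule.mem_sup_right (Submodule.mem_sup_right
    (Submodule.mem_sup_right hf)))

end systemSpace

end Input

/-! ### The state process in `L²` -/

section StateProcess

open Matrix
open scoped RealInnerProductSpace ENNReal

set_option linter.unusedSectionVars false

variable {Ω : Type*} {mΩ : MeasurableSpace Ω} {P : Measure Ω} [IsProbabilityMeasure P]
variable {n m : ℕ} {A S₀ : Matrix (Fin n) (Fin n) ℝ} {G : Matrix (Fin n) (Fin m) ℝ}
  {w : Fin m → ℝ≥0 → Ω → ℝ} {x : ℝ≥0 → Ω → Fin n → ℝ}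

theorem coeFn_matAct {ι κ : Type*} [Fintype ι] (M : Matrix κ ι ℝ) {X' : ι → Lp ℝ 2 P}
    {X : Ω → ι → ℝ} (h : ∀ a, X' a =ᵐ[P] fun ω => X ω a) (k : κ) :
    (matAct M X' k : Lp ℝ 2 P) =ᵐ[P] fun ω => (M *ᵥ X ω) k := by
  have h1 := coeFn_linearCombination Finset.univ (fun a => M k a) X'
  have h2 : ∀ᵐ ω ∂P, ∀ a, X' a ω = X ω a := ae_all_iff.2 h
  filter_upwards [h1, h2] with ω h1 h2
  rw [matAct, h1]
  simp only [h2]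
  rfl

/-- The initial state in `L²`. -/
noncomputable def initL2 (P : Measure Ω) (x : ℝ≥0 → Ω → Fin n → ℝ) (a : Fin n) : Lp ℝ 2 P :=
  toL2 P fun ω => x 0 ω a

/-- The state process in `L²`. -/
noncomputable def stateL2 (P : Measure Ω) (A : Matrix (Fin n) (Fin n) ℝ)
    (G : Matrix (Fin n) (Fin m) ℝ) (w : Fin m → ℝ≥0 → Ω → ℝ) (x : ℝ≥0 → Ω → Fin n → ℝ) :
    ℝ → Fin n → Lp ℝ 2 P :=
  linearResponse A (initL2 P x) fun s => matAct G (familyL2 P w s)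

/-- The mean of the initial state. -/
noncomputable def meanL2 (P : Measure Ω) [IsProbabilityMeasure P] (x : ℝ≥0 → Ω → Fin n → ℝ)
    (a : Fin n) : Lp ℝ 2 P :=
  (∫ ω, x 0 ω a ∂P) • oneLp P

/-- The deviation of the initial state from its mean. -/
noncomputable def deviationL2 (P : Measure Ω) [IsProbabilityMeasure P]
    (x : ℝ≥0 → Ω → Fin n → ℝ) (a : Fin n) : Lp ℝ 2 P :=
  initL2 P x a - meanL2 P x a

theorem linearResponse_mem {E : Type*} [NormedAddCommGroup E] [InnerProductSpace ℝ E]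
    [CompleteSpace E] {x₀ : Fin n → E} {g : ℝ → Fin n → E} (hg : ∀ a, Continuous fun s => g s a)
    {K : Submodule ℝ E} (hK : IsClosed (K : Set E)) {t : ℝ} (ht : 0 ≤ t) (h0 : ∀ a, x₀ a ∈ K)
    (h : ∀ s ∈ Set.Icc 0 t, ∀ a, g s a ∈ K) (a : Fin n) : linearResponse A x₀ g t a ∈ K := by
  refine K.add_mem (pairing_mem (fun b => K.add_mem (h0 b) ?_) _) (h t ⟨ht, le_rfl⟩ a)
  exact intervalIntegral_mem_of_isClosed hK
    (continuous_matAct' (continuous_exp_neg_mul A) hg b) ht fun s hs => pairing_mem (h s hs) _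

theorem meanL2_mem {K : Submodule ℝ (Lp ℝ 2 P)} (h : oneLp P ∈ K) (a : Fin n) :
    meanL2 P x a ∈ K := K.smul_mem _ h

theorem initL2_eq (a : Fin n) : initL2 P x a = meanL2 P x a + deviationL2 P x a := by
  rw [deviationL2, add_sub_cancel]

namespace IsStateProcess

theorem memLp_init (hs : IsStateProcess P A G S₀ w x) (a : Fin n) :
    MemLp (fun ω => x 0 ω a) 2 P :=
  ((isGaussianProcess_of_hasGaussianLaw hs.gaussian_init).hasGaussianLaw_eval a).memLp_two

theorem continuous_input (hs : IsStateProcess P A G S₀ w x) (j : Fin m) :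
    Continuous fun s => familyL2 P w s j :=
  continuous_toL2_brownian (hs.brownian j)

theorem continuous_forcing (hs : IsStateProcess P A G S₀ w x) (a : Fin n) :
    Continuous fun s => matAct G (familyL2 P w s) a :=
  continuous_matAct G hs.continuous_input a

theorem continuous_stateL2 (hs : IsStateProcess P A G S₀ w x) (a : Fin n) :
    Continuous fun s => stateL2 P A G w x s a :=
  continuous_linearResponse A _ hs.continuous_forcing a

theorem stateL2_zero (hs : IsStateProcess P A G S₀ w x) (a : Fin n) :
    stateL2 P A G w x 0 a = initL2 P x a := by
  rw [stateL2, linearResponse_eq A _ hs.continuous_forcing, intervalIntegral.integral_same,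
    add_zero]
  simp [matAct, familyL2_zero hs.brownian]

theorem stateL2_eq (hs : IsStateProcess P A G S₀ w x) (t : ℝ) (a : Fin n) :
    stateL2 P A G w x t a = stateL2 P A G w x 0 a
      + (∫ s in (0 : ℝ)..t, matAct A (stateL2 P A G w x s) a) + matAct G (familyL2 P w t) a := by
  rw [hs.stateL2_zero]
  exact linearResponse_eq A _ hs.continuous_forcing t a

theorem stateL2_mem (hs : IsStateProcess P A G S₀ w x) {K : Submodule ℝ (Lp ℝ 2 P)}
    (hK : IsClosed (K : Set (Lp ℝ 2 P))) {t : ℝ} (ht : 0 ≤ t) (h0 : ∀ a, initL2 P x a ∈ K)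
    (h : ∀ s ∈ Set.Icc 0 t, ∀ j, familyL2 P w s j ∈ K) (a : Fin n) :
    stateL2 P A G w x t a ∈ K :=
  linearResponse_mem hs.continuous_forcing hK ht h0 (fun s hs' _ => pairing_mem (h s hs') _) a

theorem coeFn_familyL2 (hs : IsStateProcess P A G S₀ w x) (s : ℝ) (j : Fin m) :
    familyL2 P w s j =ᵐ[P] w j s.toNNReal :=
  coeFn_toL2 (memLp_brownian (hs.brownian j) _)

theorem continuous_paths (hs : IsStateProcess P A G S₀ w x) :
    ∀ᵐ ω ∂P, Continuous fun (s : ℝ) j => w j s.toNNReal ω := by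
  filter_upwards [ae_all_iff.2 fun j => (hs.brownian j).cont] with ω h
  exact continuous_pi fun j => (h j).comp continuous_real_toNNReal

/-- The response formula has finitely many terms and one integral, and each has the same value in L²
and pathwise; uniqueness for the path equation then recovers x. -/
theorem coeFn_stateL2 (hs : IsStateProcess P A G S₀ w x) {t : ℝ} (ht : 0 ≤ t) (a : Fin n) :
    stateL2 P A G w x t a =ᵐ[P] fun ω => x t.toNNReal ω a := by
  have hW : ∀ s b, (matAct G (familyL2 P w s) b : Lp ℝ 2 P)
      =ᵐ[P] fun ω => (G *ᵥ fun j => w j s.toNNReal ω) b := fun s b =>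
    coeFn_matAct G (hs.coeFn_familyL2 s) b
  have hI : ∀ b, ((∫ s in (0 : ℝ)..t, matAct (NormedSpace.exp (-(s • A)) * A)
        (matAct G (familyL2 P w s)) b : Lp ℝ 2 P) : Ω → ℝ)
      =ᵐ[P] fun ω => ∫ s in (0 : ℝ)..t, ((NormedSpace.exp (-(s • A)) * A)
        *ᵥ (G *ᵥ fun j => w j s.toNNReal ω)) b := fun b => by
    refine coeFn_intervalIntegral (fun s => coeFn_matAct _ (hW s) b)
      (continuous_matAct' (continuous_exp_neg_mul A) hs.continuous_forcing b) ?_ ht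
    filter_upwards [hs.continuous_paths] with ω hω
    exact (continuous_apply b).comp
      ((continuous_exp_neg_mul A).matrix_mulVec (continuous_const.matrix_mulVec hω))
  have hB : ∀ b, ((initL2 P x b + ∫ s in (0 : ℝ)..t, matAct (NormedSpace.exp (-(s • A)) * A)
        (matAct G (familyL2 P w s)) b : Lp ℝ 2 P) : Ω → ℝ)
      =ᵐ[P] fun ω => x 0 ω b + ∫ s in (0 : ℝ)..t, ((NormedSpace.exp (-(s • A)) * A)
        *ᵥ (G *ᵥ fun j => w j s.toNNReal ω)) b := fun b =>
    (Lp.coeFn_add _ _).trans ((coeFn_toL2 (hs.memLp_init b)).add (hI b))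
  have hF := (Lp.coeFn_add _ _).trans
    ((coeFn_matAct (NormedSpace.exp (t • A)) hB a).add (hW t a))
  refine EventuallyEq.trans hF ?_
  filter_upwards [hs.path, hs.continuous_paths] with ω hp hω
  have h1 := eq_linearResponse A (x₀ := x 0 ω) (g := fun s => G *ᵥ fun j => w j s.toNNReal ω)
    (x := fun s => x s.toNNReal ω) (continuous_const.matrix_mulVec hω)
    (hp.1.comp continuous_real_toNNReal)
    (fun s hs' b => by
      have := hp.2 s.toNNReal b
      rwa [Real.coe_toNNReal s hs'] at this) ht
  exact (congrFun h1 a).symm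

theorem inner_initL2_oneLp (hs : IsStateProcess P A G S₀ w x) (a : Fin n) :
    ⟪initL2 P x a, oneLp P⟫ = ∫ ω, x 0 ω a ∂P :=
  inner_toL2_oneLp (hs.memLp_init a)

theorem inner_deviationL2_oneLp (hs : IsStateProcess P A G S₀ w x) (a : Fin n) :
    ⟪deviationL2 P x a, oneLp P⟫ = 0 := by
  rw [deviationL2, inner_sub_left, hs.inner_initL2_oneLp, meanL2, inner_smul_left,
    inner_oneLp_oneLp]
  simp

theorem inner_deviationL2_meanL2 (hs : IsStateProcess P A G S₀ w x) (a b : Fin n) :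
    ⟪deviationL2 P x a, meanL2 P x b⟫ = 0 := by
  rw [meanL2, inner_smul_right, hs.inner_deviationL2_oneLp, mul_zero]

theorem inner_deviationL2 (hs : IsStateProcess P A G S₀ w x) (a b : Fin n) :
    ⟪deviationL2 P x a, deviationL2 P x b⟫ = S₀ a b := by
  have h1 : ⟪deviationL2 P x a, deviationL2 P x b⟫ = ⟪deviationL2 P x a, initL2 P x b⟫ := by
    rw [deviationL2.eq_1 P x b, inner_sub_right, hs.inner_deviationL2_meanL2, sub_zero]
  rw [h1, deviationL2, inner_sub_left, meanL2, inner_smul_left,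
    real_inner_comm (initL2 P x b) (oneLp P), hs.inner_initL2_oneLp b, initL2,
    initL2, inner_toL2 (hs.memLp_init a) (hs.memLp_init b), hs.cov_init]
  simp

theorem initL2_mem_measurableL2 (hs : IsStateProcess P A G S₀ w x) (a : Fin n) :
    initL2 P x a ∈ measurableL2 (MeasurableSpace.comap (x 0) inferInstance) P :=
  toL2_mem_measurableL2 (hs.memLp_init a) ((measurable_pi_apply a).comp (comap_measurable (x 0)))

theorem deviationL2_mem_measurableL2 (hs : IsStateProcess P A G S₀ w x) (a : Fin n) :
    deviationL2 P x a ∈ measurableL2 (MeasurableSpace.comap (x 0) inferInstance) P :=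
  Submodule.sub_mem _ (hs.initL2_mem_measurableL2 a) (meanL2_mem (oneLp_mem_measurableL2 _) a)

theorem measurable_input (w : Fin m → ℝ≥0 → Ω → ℝ) (j : Fin m) (t : ℝ≥0) :
    Measurable[MeasurableSpace.comap (fun ω j t => w j t ω) inferInstance] (w j t) :=
  have h1 : Measurable[MeasurableSpace.comap (fun ω j t => w j t ω) inferInstance]
      fun ω t => w j t ω :=
    (measurable_pi_apply j).comp (comap_measurable fun ω j t => w j t ω)
  (measurable_pi_apply t).comp h1

theorem familyL2_mem_measurableL2 (hs : IsStateProcess P A G S₀ w x) (s : ℝ) (j : Fin m) :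
    familyL2 P w s j ∈ measurableL2 (MeasurableSpace.comap (fun ω j t => w j t ω) inferInstance) P :=
  toL2_mem_measurableL2 (memLp_brownian (hs.brownian j) _) (measurable_input w j _)

theorem inner_familyL2_oneLp (hs : IsStateProcess P A G S₀ w x) (s : ℝ) (j : Fin m) :
    ⟪familyL2 P w s j, oneLp P⟫ = 0 :=
  inner_toL2_brownian_oneLp (hs.brownian j) _

theorem inner_meanL2_eq_zero {f : Lp ℝ 2 P} (hf : ⟪f, oneLp P⟫ = 0) (a : Fin n) :
    ⟪meanL2 P x a, f⟫ = 0 := by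
  rw [meanL2, inner_smul_left, real_inner_comm, hf, mul_zero]

theorem isGaussianSpace_init (hs : IsStateProcess P A G S₀ w x) :
    IsGaussianSpace (Submodule.span ℝ (Set.range (initL2 P x))) :=
  .span_range (isGaussianProcess_of_hasGaussianLaw hs.gaussian_init)
    fun a => coeFn_toL2 (hs.memLp_init a)

theorem span_init_le (hs : IsStateProcess P A G S₀ w x) :
    Submodule.span ℝ (Set.range (initL2 P x))
      ≤ measurableL2 (MeasurableSpace.comap (x 0) inferInstance) P := by
  rw [Submodule.span_le]
  rintro _ ⟨a, rfl⟩
  exact hs.initL2_mem_measurableL2 a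

theorem isBrownianReal (hs : IsStateProcess P A G S₀ w x) (j : Fin m) : IsBrownianReal (w j) P :=
  hs.brownian j

theorem isGaussianSpace_input (hs : IsStateProcess P A G S₀ w x) :
    IsGaussianSpace (familySpan P w) :=
  isGaussianSpace_familySpan
    (fun j => IsPreBrownianReal.isGaussianProcess (hs.brownian j).toIsPreBrownianReal)
    hs.indep

/-- The Gaussian space of a state process with additional observation noise. -/
theorem isGaussianSpace (hs : IsStateProcess P A G S₀ w x) {α T : Type*} {U : α → T → Ω → ℝ}
    (hU : ∀ u, IsGaussianProcess (U u) P) (hi : iIndepFun (fun u ω t => U u t ω) P)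
    {m₂ : MeasurableSpace Ω} (hm : ∀ u t, Measurable[m₂] (U u t))
    (h12 : Indep (MeasurableSpace.comap (fun ω j t => w j t ω) inferInstance) m₂ P)
    (h012 : Indep (MeasurableSpace.comap (x 0) inferInstance)
      (MeasurableSpace.comap (fun ω j t => w j t ω) inferInstance ⊔ m₂) P) :
    IsGaussianSpace (systemSpace (Submodule.span ℝ (Set.range (initL2 P x))) (familySpan P w)
      (familySpan P U)) :=
  isGaussianSpace_systemSpace hs.span_init_le
    (familySpan_le (fun j t => memLp_brownian (hs.isBrownianReal j) t) (measurable_input w))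
    (familySpan_le (fun u t => ((hU u).hasGaussianLaw_eval t).memLp_two) hm)
    hs.isGaussianSpace_init
    hs.isGaussianSpace_input
    (isGaussianSpace_familySpan hU hi) h12 h012

theorem stateL2_mem_systemSpace (hs : IsStateProcess P A G S₀ w x) {V : Submodule ℝ (Lp ℝ 2 P)}
    {t : ℝ} (ht : 0 ≤ t) (a : Fin n) :
    stateL2 P A G w x t a ∈ systemSpace (Submodule.span ℝ (Set.range (initL2 P x)))
      (familySpan P w) V :=
  hs.stateL2_mem isClosed_systemSpace ht
    (fun b => mem_systemSpace_zero (Submodule.subset_span (Set.mem_range_self b)))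
    (fun _ _ j => mem_systemSpace_one (toL2_mem_familySpan w j _)) a

end IsStateProcess

end StateProcess


/-! ### The continuous-time system -/

section ContinuousSystem

open Matrix
open scoped RealInnerProductSpace ENNReal

set_option linter.unusedSectionVars false

variable {Ω : Type*} {mΩ : MeasurableSpace Ω} {P : Measure Ω} [IsProbabilityMeasure P]
variable {n m p N : ℕ} {A S₀ : Matrix (Fin n) (Fin n) ℝ} {G : Matrix (Fin n) (Fin m) ℝ}
  {d : Fin N → Matrix (Fin n) (Fin p) ℝ} {w : Fin m → ℝ≥0 → Ω → ℝ}
  {ν : Fin N → Fin p → ℝ≥0 → Ω → ℝ} {x : ℝ≥0 → Ω → Fin n → ℝ}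
  {z : Fin N → ℝ≥0 → Ω → Fin p → ℝ}

/-- The joint observation matrix of all sensors. -/
def sensorMatrix (d : Fin N → Matrix (Fin n) (Fin p) ℝ) : Matrix (Fin n) (Fin N × Fin p) ℝ :=
  Matrix.of fun a u => d u.1 a u.2

/-- Stacking the sensors reduces the problem to a single observation matrix C with CCᵀ = ∑ dᵢdᵢᵀ. -/
theorem sensorMatrix_mul_transpose (d : Fin N → Matrix (Fin n) (Fin p) ℝ) :
    sensorMatrix d * (sensorMatrix d)ᵀ = ∑ i, d i * (d i)ᵀ := by
  ext a b
  rw [Matrix.mul_apply, Fintype.sum_prod_type, Matrix.sum_apply]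
  exact Finset.sum_congr rfl fun i _ => rfl

/-- The observations in `L²`. -/
noncomputable def outputL2 (P : Measure Ω) (A : Matrix (Fin n) (Fin n) ℝ)
    (G : Matrix (Fin n) (Fin m) ℝ) (d : Fin N → Matrix (Fin n) (Fin p) ℝ)
    (w : Fin m → ℝ≥0 → Ω → ℝ) (ν : Fin N → Fin p → ℝ≥0 → Ω → ℝ)
    (x : ℝ≥0 → Ω → Fin n → ℝ) (s : ℝ) (u : Fin N × Fin p) : Lp ℝ 2 P :=
  (∫ r in (0 : ℝ)..s, matAct (sensorMatrix d)ᵀ (stateL2 P A G w x r) u)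
    + familyL2 P (fun u : Fin N × Fin p => ν u.1 u.2) s u

theorem comap_eq_iSup_eval {T : Type*} (X : Ω → T → ℝ) :
    MeasurableSpace.comap X inferInstance
      = ⨆ a, MeasurableSpace.comap (fun ω => X ω a) inferInstance := by
  rw [MeasurableSpace.pi, MeasurableSpace.comap_iSup]
  simp only [MeasurableSpace.comap_comp]
  rfl

namespace IsContinuousSystem

theorem measurable_noise (ν : Fin N → Fin p → ℝ≥0 → Ω → ℝ) (u : Fin N × Fin p) (t : ℝ≥0) :
    Measurable[MeasurableSpace.comap (fun ω i a t => ν i a t ω) inferInstance] (ν u.1 u.2 t) :=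
  have h1 : Measurable[MeasurableSpace.comap (fun ω i a t => ν i a t ω) inferInstance]
      fun ω a t => ν u.1 a t ω :=
    (measurable_pi_apply u.1).comp (comap_measurable fun ω i a t => ν i a t ω)
  have h2 : Measurable[MeasurableSpace.comap (fun ω i a t => ν i a t ω) inferInstance]
      fun ω t => ν u.1 u.2 t ω := (measurable_pi_apply u.2).comp h1
  (measurable_pi_apply t).comp h2

theorem continuous_noise (h : IsContinuousSystem P A G d S₀ w ν x z) (u : Fin N × Fin p) :
    Continuous fun s => familyL2 P (fun u : Fin N × Fin p => ν u.1 u.2) s u :=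
  continuous_toL2_brownian (h.noise_brownian u.1 u.2)

theorem continuous_rate (h : IsContinuousSystem P A G d S₀ w ν x z) (u : Fin N × Fin p) :
    Continuous fun r => matAct (sensorMatrix d)ᵀ (stateL2 P A G w x r) u :=
  continuous_matAct _ h.state.continuous_stateL2 u

theorem continuous_outputL2 (h : IsContinuousSystem P A G d S₀ w ν x z) (u : Fin N × Fin p) :
    Continuous fun s => outputL2 P A G d w ν x s u :=
  (intervalIntegral.continuous_primitive
    (fun _ _ => (h.continuous_rate u).intervalIntegrable _ _) 0).add (h.continuous_noise u)

theorem coeFn_outputL2 (h : IsContinuousSystem P A G d S₀ w ν x z) {s : ℝ} (hs : 0 ≤ s)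
    (u : Fin N × Fin p) :
    outputL2 P A G d w ν x s u =ᵐ[P] fun ω => z u.1 s.toNNReal ω u.2 := by
  -- The L² state is identified with x only at nonnegative times, whereas the comparison of
  -- integrals asks for all real times; truncation at 0 bridges the gap.
  have hx : Continuous fun r => matAct (sensorMatrix d)ᵀ (stateL2 P A G w x (max r 0)) u :=
    (h.continuous_rate u).comp (continuous_id.max continuous_const)
  have h1 : ((∫ r in (0 : ℝ)..s, matAct (sensorMatrix d)ᵀ (stateL2 P A G w x (max r 0)) u
      : Lp ℝ 2 P) : Ω → ℝ)
      =ᵐ[P] fun ω => ∫ r in (0 : ℝ)..s, ((sensorMatrix d)ᵀ *ᵥ x r.toNNReal ω) u := by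
    refine coeFn_intervalIntegral (fun r => coeFn_matAct _ (fun a => ?_) u) hx ?_ hs
    · have h0 : (max r 0).toNNReal = r.toNNReal := by
        ext
        simp only [Real.coe_toNNReal', max_assoc, max_self]
      have := h.state.coeFn_stateL2 (le_max_right r 0) a
      rwa [h0] at this
    · filter_upwards [h.state.path] with ω hω
      exact (continuous_apply u).comp (continuous_const.matrix_mulVec
        (hω.1.comp continuous_real_toNNReal))
  have h2 : ∫ r in (0 : ℝ)..s, matAct (sensorMatrix d)ᵀ (stateL2 P A G w x (max r 0)) u
      = ∫ r in (0 : ℝ)..s, matAct (sensorMatrix d)ᵀ (stateL2 P A G w x r) u :=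
    intervalIntegral.integral_congr fun r hr => by
      rw [Set.uIcc_of_le hs] at hr
      simp only [max_eq_left hr.1]
  rw [h2] at h1
  have h3 := (Lp.coeFn_add _ _).trans (h1.add
    (coeFn_toL2 (memLp_brownian (h.noise_brownian u.1 u.2) s.toNNReal)))
  refine EventuallyEq.trans h3 ?_
  filter_upwards [h.output] with ω hω
  have h4 := hω u.1 s.toNNReal u.2
  rw [Real.coe_toNNReal s hs] at h4
  rw [h4]
  rfl

theorem indep_input_noise (h : IsContinuousSystem P A G d S₀ w ν x z) :
    Indep (MeasurableSpace.comap (fun ω j t => w j t ω) inferInstance)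
      (MeasurableSpace.comap (fun ω i a t => ν i a t ω) inferInstance) P :=
  h.indep_noises

theorem indep_init_all (h : IsContinuousSystem P A G d S₀ w ν x z) :
    Indep (MeasurableSpace.comap (x 0) inferInstance)
      (MeasurableSpace.comap (fun ω j t => w j t ω) inferInstance
        ⊔ MeasurableSpace.comap (fun ω i a t => ν i a t ω) inferInstance) P := by
  have h1 := h.indep_init
  rw [IndepFun_iff_Indep, Prod.instMeasurableSpace, MeasurableSpace.comap_prodMk] at h1
  exact h1

theorem noiseL2_mem (h : IsContinuousSystem P A G d S₀ w ν x z) (s : ℝ) (u : Fin N × Fin p) :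
    familyL2 P (fun u : Fin N × Fin p => ν u.1 u.2) s u
      ∈ measurableL2 (MeasurableSpace.comap (fun ω i a t => ν i a t ω) inferInstance) P :=
  toL2_mem_measurableL2 (memLp_brownian (h.noise_brownian u.1 u.2) _) (measurable_noise ν u _)

theorem isHilbertSystem (h : IsContinuousSystem P A G d S₀ w ν x z) :
    IsHilbertSystem A S₀ G (sensorMatrix d) (stateL2 P A G w x) (familyL2 P w)
      (outputL2 P A G d w ν x) (familyL2 P fun u : Fin N × Fin p => ν u.1 u.2) (meanL2 P x)
      (deviationL2 P x) := by
  have hν1 : ∀ s u, ⟪familyL2 P (fun u : Fin N × Fin p => ν u.1 u.2) s u, oneLp P⟫ = 0 :=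
    fun s u => inner_toL2_brownian_oneLp (h.noise_brownian u.1 u.2) _
  have hxw := indep_of_indep_of_le_right h.indep_init_all
    (le_sup_left (a := MeasurableSpace.comap (fun ω j t => w j t ω) inferInstance))
  have hxν := indep_of_indep_of_le_right h.indep_init_all
    (le_sup_right (b := MeasurableSpace.comap (fun ω i a t => ν i a t ω) inferInstance))
  exact
  { continuous_state := h.state.continuous_stateL2
    continuous_input := h.state.continuous_input
    continuous_output := h.continuous_outputL2
    continuous_noise := h.continuous_noise
    state := fun t _ a => h.state.stateL2_eq t a
    output := fun t _ k => rfl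
    inner_input := fun s t hs ht i j => inner_familyL2 h.state.brownian h.state.indep hs ht i j
    inner_noise := fun s t hs ht i j =>
      inner_familyL2 (fun u => h.noise_brownian u.1 u.2) h.noise_indep hs ht i j
    inner_input_noise := fun s t _ _ i j => by
      rw [inner_of_indep h.indep_input_noise (h.state.familyL2_mem_measurableL2 s i)
        (h.noiseL2_mem t j), hν1, mul_zero]
    init := fun a => by rw [h.state.stateL2_zero, initL2_eq]
    inner_error := h.state.inner_deviationL2
    inner_error_known := h.state.inner_deviationL2_meanL2
    inner_error_input := fun t _ a j => by
      rw [inner_of_indep hxw (h.state.deviationL2_mem_measurableL2 a)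
        (h.state.familyL2_mem_measurableL2 t j), h.state.inner_familyL2_oneLp, mul_zero]
    inner_error_noise := fun t _ a k => by
      rw [inner_of_indep hxν (h.state.deviationL2_mem_measurableL2 a)
        (h.noiseL2_mem t k), hν1, mul_zero]
    inner_known_input := fun t _ a j =>
      IsStateProcess.inner_meanL2_eq_zero (h.state.inner_familyL2_oneLp t j) a
    inner_known_noise := fun t _ a k => IsStateProcess.inner_meanL2_eq_zero (hν1 t k) a }

/-- The Riccati flow is the error covariance of the continuous-time system. -/
theorem isErrorCov (h : IsContinuousSystem P A G d S₀ w ν x z) (hS : S₀.PosSemidef) (t : ℝ≥0) :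
    IsErrorCov (continuousInfo z t) P (x t) (flow A (∑ i, d i * (d i)ᵀ) (G * Gᵀ) S₀ t) := by
  have hsys := h.isHilbertSystem
  obtain ⟨e, hK, -, hez, he, hcov⟩ := hsys.exists_error hS t.coe_nonneg
  have hV := h.state.isGaussianSpace (U := fun u : Fin N × Fin p => ν u.1 u.2)
    (fun u => IsPreBrownianReal.isGaussianProcess
      (h.noise_brownian u.1 u.2).toIsPreBrownianReal) h.noise_indep
    (measurable_noise ν) h.indep_input_noise h.indep_init_all
  have hout : ∀ s, 0 ≤ s → ∀ u, outputL2 P A G d w ν x s u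
      ∈ systemSpace (Submodule.span ℝ (Set.range (initL2 P x))) (familySpan P w)
        (familySpan P fun u : Fin N × Fin p => ν u.1 u.2) := fun s hs u =>
    Submodule.add_mem _ (intervalIntegral_mem_of_isClosed isClosed_systemSpace
      (h.continuous_rate u) hs fun r hr => pairing_mem
        (fun a => h.state.stateL2_mem_systemSpace hr.1 a) _)
      (mem_systemSpace_two (toL2_mem_familySpan _ u _))
  refine hV.isErrorCov isClosed_systemSpace oneLp_mem_systemSpace
    (κ := Set.Iic t × Fin N × Fin p) (Y := fun k ω => z k.2.1 k.1 ω k.2.2)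
    (Y' := fun k => outputL2 P A G d w ν x (k.1 : ℝ≥0) k.2) (X' := stateL2 P A G w x t) (e := e)
    (fun k => (measurable_pi_apply k.2.2).comp (h.measurable k.2.1 k.1)) (fun k => ?_)
    (fun k => hout _ (NNReal.coe_nonneg _) _) (fun a => ?_)
    (fun a => h.state.stateL2_mem_systemSpace t.coe_nonneg a) (fun a K hKc h1 hY => ?_)
    (fun a => ?_) (fun a k => ?_) (fun a b => ?_) ?_
  · have := h.coeFn_outputL2 (NNReal.coe_nonneg (k.1 : ℝ≥0)) k.2
    rwa [Real.toNNReal_coe] at this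
  · have := h.state.coeFn_stateL2 t.coe_nonneg a
    rwa [Real.toNNReal_coe] at this
  -- The mean of x(0) is a constant, so the known part lies in any subspace containing 1.
  · refine hK K hKc (meanL2_mem h1) (fun s hs k => ?_) a
    have hs' : s.toNNReal ≤ t := Real.toNNReal_le_iff_le_coe.2 hs.2
    have := hY (⟨s.toNNReal, hs'⟩, k)
    simpa only [Real.coe_toNNReal s hs.1] using this
  · exact he _ h.state.inner_deviationL2_oneLp (fun s _ j => h.state.inner_familyL2_oneLp s j)
      (fun s _ k => inner_toL2_brownian_oneLp (h.noise_brownian k.1 k.2) _) a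
  · exact hez a _ ⟨NNReal.coe_nonneg _, NNReal.coe_le_coe.2 k.1.2⟩ k.2
  · rw [hcov, sensorMatrix_mul_transpose]
  · rw [continuousInfo, iSup_prod]
    refine iSup_congr fun s => ?_
    rw [iSup_prod]
    exact iSup_congr fun i => comap_eq_iSup_eval _

end IsContinuousSystem

end ContinuousSystem


/-! ### Prediction without observations -/

section Prediction

open Matrix NormedSpace

attribute [local instance] Matrix.linftyOpNormedRing Matrix.linftyOpNormedAlgebra

variable {n m : ℕ} {A : Matrix (Fin n) (Fin n) ℝ} {G : Matrix (Fin n) (Fin m) ℝ}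

theorem hasDerivAt_exp_conj (A Q : Matrix (Fin n) (Fin n) ℝ) (t : ℝ) :
    HasDerivAt (fun s : ℝ => exp (s • A) * Q * exp (s • Aᵀ))
      (A * (exp (t • A) * Q * exp (t • Aᵀ)) + exp (t • A) * Q * exp (t • Aᵀ) * Aᵀ) t := by
  refine (((hasDerivAt_matrix_exp A t).mul_const Q).mul
    (hasDerivAt_matrix_exp' Aᵀ t)).congr_deriv ?_
  noncomm_ring

theorem hasDerivAt_noiseGramian (A : Matrix (Fin n) (Fin n) ℝ) (G : Matrix (Fin n) (Fin m) ℝ)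
    (t : ℝ) : HasDerivAt (noiseGramian A G) (exp (t • A) * (G * Gᵀ) * exp (t • Aᵀ)) t := by
  have hc : Continuous fun s : ℝ => exp (s • A) * (G * Gᵀ) * exp (s • Aᵀ) :=
    continuous_iff_continuousAt.2 fun s => (hasDerivAt_exp_conj A (G * Gᵀ) s).continuousAt
  have h1 := (hc.integral_hasStrictDerivAt 0 t).hasDerivAt
  refine h1.congr_of_eventuallyEq (.of_forall fun h => ?_)
  rw [noiseGramian_eq]
  simp only [matrix_exp_smul_transpose, Matrix.transpose_transpose]

/-- The difference between the left side and the two terms linear in the Gramian has derivative 0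
and equals GGᵀ at time 0. -/
theorem exp_conj_eq_noiseGramian (A : Matrix (Fin n) (Fin n) ℝ) (G : Matrix (Fin n) (Fin m) ℝ)
    (t : ℝ) : exp (t • A) * (G * Gᵀ) * exp (t • Aᵀ)
      = A * noiseGramian A G t + noiseGramian A G t * Aᵀ + G * Gᵀ := by
  have h1 : ∀ s, HasDerivAt (fun s => exp (s • A) * (G * Gᵀ) * exp (s • Aᵀ)
      - (A * noiseGramian A G s + noiseGramian A G s * Aᵀ)) 0 s := fun s => by
    refine ((hasDerivAt_exp_conj A (G * Gᵀ) s).sub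
      (((hasDerivAt_noiseGramian A G s).const_mul A).add
        ((hasDerivAt_noiseGramian A G s).mul_const Aᵀ))).congr_deriv ?_
    simp
  have h2 := matrix_const_of_hasDerivAt_zero h1 t 0
  have h0 : noiseGramian A G 0 = 0 := by ext; simp [noiseGramian]
  simp only [h0, zero_smul, exp_zero, Matrix.one_mul, Matrix.mul_one, Matrix.mul_zero,
    Matrix.zero_mul, add_zero, sub_zero] at h2
  exact sub_eq_iff_eq_add'.1 h2

/-- Without observations the Riccati equation is the Lyapunov equation, solved by the prediction
formula. Prediction thus becomes a case of the Kalman-Bucy filter. -/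
theorem flow_zero_eq_predictCov {S : Matrix (Fin n) (Fin n) ℝ} (hS : S.PosSemidef) {t : ℝ}
    (ht : 0 ≤ t) : flow A 0 (G * Gᵀ) S t = predictCov A G t S := by
  refine (eq_flow_of_hasDerivWithinAt Matrix.PosSemidef.zero (posSemidef_mul_transpose G) hS
    (S := fun t => predictCov A G t S) ?_ (fun s _ => ?_) ht).symm
  · ext
    simp [predictCov, noiseGramian]
  · refine ((hasDerivAt_exp_conj A S s).add
      (hasDerivAt_noiseGramian A G s)).hasDerivWithinAt.congr_deriv ?_
    rw [exp_conj_eq_noiseGramian, ric, predictCov]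
    noncomm_ring

end Prediction

/-! ### The filter of a sampled system in a Hilbert space -/

section HilbertSampled

open Matrix
open scoped RealInnerProductSpace

set_option linter.unusedSectionVars false

variable {H : Type*} [NormedAddCommGroup H] [InnerProductSpace ℝ H] [CompleteSpace H]
variable {n m p : ℕ}

theorem inner_matAct_right {ι κ : Type*} [Fintype ι] (M : Matrix κ ι ℝ) (X : ι → H) (g : H)
    (k : κ) : ⟪g, matAct M X k⟫ = (M *ᵥ fun a => ⟪g, X a⟫) k := by
  simp [matAct, inner_sum, inner_smul_right, Matrix.mulVec, dotProduct]

theorem inner_matAct_left {ι κ : Type*} [Fintype ι] (M : Matrix κ ι ℝ) (X : ι → H) (g : H)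
    (k : κ) : ⟪matAct M X k, g⟫ = (M *ᵥ fun a => ⟪X a, g⟫) k := by
  simp [matAct, sum_inner, inner_smul_left, Matrix.mulVec, dotProduct]

theorem matAct_mem {ι κ : Type*} [Fintype ι] {K : Submodule ℝ H} {X : ι → H}
    (h : ∀ a, X a ∈ K) (M : Matrix κ ι ℝ) (k : κ) : matAct M X k ∈ K := pairing_mem h _

theorem mulVec_fun_eq_zero {ι κ : Type*} [Fintype ι] (M : Matrix κ ι ℝ) {f : ι → ℝ}
    (hf : ∀ a, f a = 0) (k : κ) : (M *ᵥ fun a => f a) k = 0 := by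
  simp [Matrix.mulVec, dotProduct, hf]

theorem inner_eq_zero_of_mem {g f : H}
    (h : ∀ K : Submodule ℝ H, IsClosed (K : Set H) → (∀ b, ⟪g, b⟫ = 0 → b ∈ K) → f ∈ K) :
    ⟪g, f⟫ = 0 :=
  Submodule.mem_orthogonal_singleton_iff_inner_right.1
    (h (ℝ ∙ g)ᗮ (Submodule.isClosed_orthogonal _)
      fun _ => Submodule.mem_orthogonal_singleton_iff_inner_right.2)

/-- The error covariance after `q` slots. -/
noncomputable def slotCov (A : Matrix (Fin n) (Fin n) ℝ) (G : Matrix (Fin n) (Fin m) ℝ)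
    (C : ℕ → Matrix (Fin n) (Fin p) ℝ) (h : ℝ) (S₀ : Matrix (Fin n) (Fin n) ℝ) :
    ℕ → Matrix (Fin n) (Fin n) ℝ
  | 0 => S₀
  | q + 1 => slotUpdate A G h (C q) (slotCov A G C h S₀ q)

/-- A linear system `dx = A x dt + G dw`, sampled at the times `(q + 1) h` with gain `C q`, as
curves in a Hilbert space. -/
structure IsHilbertSampled (A S₀ : Matrix (Fin n) (Fin n) ℝ) (G : Matrix (Fin n) (Fin m) ℝ)
    (C : ℕ → Matrix (Fin n) (Fin p) ℝ) (h : ℝ) (x : ℝ → Fin n → H) (w : ℝ → Fin m → H)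
    (y v : ℕ → Fin p → H) (m₀ e₀ : Fin n → H) : Prop where
  continuous_state : ∀ a, Continuous fun s => x s a
  continuous_input : ∀ j, Continuous fun s => w s j
  state : ∀ t a, x t a = x 0 a + (∫ s in (0 : ℝ)..t, matAct A (x s) a) + matAct G (w t) a
  state_mem : ∀ K : Submodule ℝ H, IsClosed (K : Set H) → (∀ a, x 0 a ∈ K) → ∀ t, 0 ≤ t →
    (∀ s ∈ Set.Icc 0 t, ∀ j, w s j ∈ K) → ∀ a, x t a ∈ K
  output : ∀ q k, y q k = matAct (C q)ᵀ (x ((q + 1) * h)) k + v q k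
  inner_input : ∀ s t, 0 ≤ s → 0 ≤ t → ∀ i j, ⟪w s i, w t j⟫ = if j = i then min t s else 0
  inner_noise : ∀ q i j, ⟪v q i, v q j⟫ = if j = i then 1 else 0
  inner_noise_of_ne : ∀ q l, q ≠ l → ∀ i j, ⟪v q i, v l j⟫ = 0
  inner_input_noise : ∀ s, 0 ≤ s → ∀ q i j, ⟪w s i, v q j⟫ = 0
  init : ∀ a, x 0 a = m₀ a + e₀ a
  inner_error : ∀ a b, ⟪e₀ a, e₀ b⟫ = S₀ a b
  inner_error_known : ∀ a b, ⟪e₀ a, m₀ b⟫ = 0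
  inner_error_input : ∀ t, 0 ≤ t → ∀ a j, ⟪e₀ a, w t j⟫ = 0
  inner_error_noise : ∀ q a k, ⟪e₀ a, v q k⟫ = 0
  inner_known_input : ∀ t, 0 ≤ t → ∀ a j, ⟪m₀ a, w t j⟫ = 0
  inner_known_noise : ∀ q a k, ⟪m₀ a, v q k⟫ = 0

variable {A S₀ : Matrix (Fin n) (Fin n) ℝ} {G : Matrix (Fin n) (Fin m) ℝ}
  {C : ℕ → Matrix (Fin n) (Fin p) ℝ} {h : ℝ} {x : ℝ → Fin n → H} {w : ℝ → Fin m → H}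
  {y v : ℕ → Fin p → H} {m₀ e₀ : Fin n → H}

/-- `e` is the error of the best linear estimate of the vector `ξ` after `q` slots. -/
structure IsSlotError (m₀ e₀ : Fin n → H) (w : ℝ → Fin m → H) (y v : ℕ → Fin p → H) (t : ℝ)
    (q : ℕ) (ξ e : Fin n → H) (S : Matrix (Fin n) (Fin n) ℝ) : Prop where
  estimate_mem : ∀ K : Submodule ℝ H, IsClosed (K : Set H) → (∀ b, m₀ b ∈ K) →
    (∀ l < q, ∀ k, y l k ∈ K) → ∀ a, ξ a - e a ∈ K
  inner_output : ∀ a, ∀ l < q, ∀ k, ⟪e a, y l k⟫ = 0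
  inner_eq_zero : ∀ g : H, (∀ a, ⟪e₀ a, g⟫ = 0) → (∀ s ∈ Set.Icc 0 t, ∀ j, ⟪w s j, g⟫ = 0) →
    (∀ l < q, ∀ k, ⟪v l k, g⟫ = 0) → ∀ a, ⟪e a, g⟫ = 0
  inner_eq : ∀ a b, ⟪e a, e b⟫ = S a b

namespace IsHilbertSampled

theorem inner_state_eq_zero (hs : IsHilbertSampled A S₀ G C h x w y v m₀ e₀) {t : ℝ} (ht : 0 ≤ t)
    {g : H} (hm : ∀ a, ⟪g, m₀ a⟫ = 0) (he : ∀ a, ⟪g, e₀ a⟫ = 0)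
    (hw : ∀ s ∈ Set.Icc 0 t, ∀ j, ⟪g, w s j⟫ = 0) (a : Fin n) : ⟪g, x t a⟫ = 0 :=
  inner_eq_zero_of_mem fun K hK hb => hs.state_mem K hK
    (fun b => by rw [hs.init]; exact K.add_mem (hb _ (hm b)) (hb _ (he b))) t ht
    (fun s hs' j => hb _ (hw s hs' j)) a

/-- The noise of a later sample is uncorrelated with the earlier samples. -/
theorem inner_noise_output (hs : IsHilbertSampled A S₀ G C h x w y v m₀ e₀) (hh : 0 ≤ h)
    {q l : ℕ} (hl : l < q) (i k : Fin p) : ⟪v q i, y l k⟫ = 0 := by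
  rw [hs.output, inner_add_right, hs.inner_noise_of_ne q l hl.ne', add_zero, inner_matAct_right]
  have h1 : (fun a => ⟪v q i, x ((l + 1) * h) a⟫) = 0 := funext fun a =>
    hs.inner_state_eq_zero (by positivity)
      (fun a => by rw [real_inner_comm]; exact hs.inner_known_noise q a i)
      (fun a => by rw [real_inner_comm]; exact hs.inner_error_noise q a i)
      (fun s hs' j => by rw [real_inner_comm]; exact hs.inner_input_noise s hs'.1 q j i) a
  rw [h1, Matrix.mulVec_zero, Pi.zero_apply]

theorem inner_input_increment (hs : IsHilbertSampled A S₀ G C h x w y v m₀ e₀) {s t u : ℝ}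
    (hs0 : 0 ≤ s) (hst : s ≤ t) (hu : 0 ≤ u) (i j : Fin m) :
    ⟪w s i, w (t + u) j - w t j⟫ = 0 := by
  rw [inner_sub_right, hs.inner_input _ _ hs0 (by linarith), hs.inner_input _ _ hs0 (by linarith),
    min_eq_right hst, min_eq_right (by linarith), sub_self]

/-- Later increments of the input are uncorrelated with the earlier samples. -/
theorem inner_output_increment (hs : IsHilbertSampled A S₀ G C h x w y v m₀ e₀) (hh : 0 ≤ h)
    {q l : ℕ} (hl : l < q) {u : ℝ} (hu : 0 ≤ u) (j : Fin m) (k : Fin p) :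
    ⟪w (q * h + u) j - w (q * h) j, y l k⟫ = 0 := by
  have hq : (0 : ℝ) ≤ q * h := by positivity
  have hlq : ((l : ℝ) + 1) * h ≤ q * h := by
    have : (l : ℝ) + 1 ≤ q := by exact_mod_cast hl
    nlinarith
  have h2 : ⟪w (q * h + u) j - w (q * h) j, v l k⟫ = 0 := by
    rw [inner_sub_left, hs.inner_input_noise _ (by linarith), hs.inner_input_noise _ hq, sub_self]
  rw [hs.output, inner_add_right, h2, add_zero, inner_matAct_right]
  have h1 : (fun a => ⟪w (q * h + u) j - w (q * h) j, x ((l + 1) * h) a⟫) = 0 :=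
    funext fun a => hs.inner_state_eq_zero (by positivity)
      (fun a => by
        rw [real_inner_comm, inner_sub_right, hs.inner_known_input _ (by linarith),
          hs.inner_known_input _ hq, sub_self])
      (fun a => by
        rw [real_inner_comm, inner_sub_right, hs.inner_error_input _ (by linarith),
          hs.inner_error_input _ hq, sub_self])
      (fun s hs' i => by
        rw [real_inner_comm]
        exact hs.inner_input_increment hs'.1 (hs'.2.trans hlq) hu i j) a
  rw [h1, Matrix.mulVec_zero, Pi.zero_apply]

theorem inner_slotError_known (hs : IsHilbertSampled A S₀ G C h x w y v m₀ e₀)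
    {t : ℝ} {q : ℕ} {ξ e : Fin n → H} {S : Matrix (Fin n) (Fin n) ℝ}
    (he : IsSlotError m₀ e₀ w y v t q ξ e S) (a b : Fin n) : ⟪e a, m₀ b⟫ = 0 :=
  he.inner_eq_zero _ (fun a => hs.inner_error_known a b)
    (fun s hs' j => by rw [real_inner_comm]; exact hs.inner_known_input s hs'.1 b j)
    (fun l _ k => by rw [real_inner_comm]; exact hs.inner_known_noise l b k) a

theorem inner_slotError_estimate (hs : IsHilbertSampled A S₀ G C h x w y v m₀ e₀)
    {t : ℝ} {q : ℕ} {ξ e : Fin n → H} {S : Matrix (Fin n) (Fin n) ℝ}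
    (he : IsSlotError m₀ e₀ w y v t q ξ e S) (a b : Fin n) : ⟪e a, ξ b - e b⟫ = 0 :=
  inner_eq_zero_of_mem fun K hK hb => he.estimate_mem K hK
    (fun c => hb _ (hs.inner_slotError_known he a c))
    (fun l hl k => hb _ (he.inner_output a l hl k)) b

/-- Prediction over one slot. -/
theorem exists_predict (hs : IsHilbertSampled A S₀ G C h x w y v m₀ e₀) (hh : 0 ≤ h) {q : ℕ}
    {e : Fin n → H} {S : Matrix (Fin n) (Fin n) ℝ} (hS : S.PosSemidef)
    (he : IsSlotError m₀ e₀ w y v (q * h) q (x (q * h)) e S) :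
    ∃ e' : Fin n → H, IsSlotError m₀ e₀ w y v ((q + 1) * h) q (x ((q + 1) * h)) e'
      (predictCov A G h S) := by
  have hq : (0 : ℝ) ≤ q * h := by positivity
  -- The system is restarted at time qh with the current estimate as known part, the current error
  -- as initial error, input increments as new input, and an empty set of outputs.
  have hsys : IsHilbertSystem (κ := Fin 0) A S G (0 : Matrix (Fin n) (Fin 0) ℝ)
      (fun s => x (q * h + s)) (fun s j => w (q * h + s) j - w (q * h) j)
      (fun _ _ => 0) (fun _ _ => 0) (fun a => x (q * h) a - e a) e :=
  { continuous_state := fun a => (hs.continuous_state a).comp (by fun_prop)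
    continuous_input := fun j =>
      ((hs.continuous_input j).comp (by fun_prop)).sub continuous_const
    continuous_output := fun k => k.elim0
    continuous_noise := fun k => k.elim0
    state := fun t ht a => by
      have hc := continuous_matAct A hs.continuous_state a
      have h1 : ∫ s in (0 : ℝ)..t, matAct A (x (q * h + s)) a
          = ∫ s in (q * h)..(q * h + t), matAct A (x s) a := by
        rw [intervalIntegral.integral_comp_add_left (fun s => matAct A (x s) a), add_zero]
      have h2 := intervalIntegral.integral_add_adjacent_intervals (μ := volume)
        (hc.intervalIntegrable 0 (q * h)) (hc.intervalIntegrable (q * h) (q * h + t))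
      have h3 : matAct G (fun j => w (q * h + t) j - w (q * h) j) a
          = matAct G (w (q * h + t)) a - matAct G (w (q * h)) a :=
        congrFun (matAct_sub G (w (q * h + t)) (w (q * h))) a
      rw [h1, h3, add_zero, hs.state (q * h + t), hs.state (q * h), ← h2]
      abel
    output := fun t _ k => k.elim0
    inner_input := fun s t hs0 ht i j => by
      rw [inner_sub_left, inner_sub_right, inner_sub_right, hs.inner_input _ _ (by linarith)
        (by linarith), hs.inner_input _ _ (by linarith) hq, hs.inner_input _ _ hq (by linarith),
        hs.inner_input _ _ hq hq]
      split_ifs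
      · rw [min_add_add_left, min_eq_left (by linarith : q * h ≤ q * h + s),
          min_eq_right (by linarith : q * h ≤ q * h + t), min_self]
        ring
      · ring
    inner_noise := fun s t _ _ i => i.elim0
    inner_input_noise := fun s t _ _ i j => j.elim0
    init := fun a => by simp
    inner_error := he.inner_eq
    inner_error_known := hs.inner_slotError_estimate he
    inner_error_input := fun t ht a j => he.inner_eq_zero _
      (fun b => by
        rw [inner_sub_right, hs.inner_error_input _ (by linarith), hs.inner_error_input _ hq,
          sub_self])
      (fun s hs' i => hs.inner_input_increment hs'.1 hs'.2 ht i j)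
      (fun l _ k => by
        rw [real_inner_comm, inner_sub_left, hs.inner_input_noise _ (by linarith),
          hs.inner_input_noise _ hq, sub_self]) a
    inner_error_noise := fun t _ a k => k.elim0
    inner_known_input := fun t ht a j => by
      rw [real_inner_comm]
      exact inner_eq_zero_of_mem fun K hK hb => he.estimate_mem K hK
        (fun b => hb _ (by
          rw [real_inner_comm, inner_sub_right, hs.inner_known_input _ (by linarith),
            hs.inner_known_input _ hq, sub_self]))
        (fun l hl k => hb _ (hs.inner_output_increment hh hl ht j k)) a
    inner_known_noise := fun t _ a k => k.elim0 }
  obtain ⟨e', hK, -, -, hg, hcov⟩ := hsys.exists_error hS hh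
  have hqh : (q : ℝ) * h + h = (q + 1) * h := by ring
  refine ⟨e', fun K hKc h0 hy a => ?_, fun a l hl k => ?_, fun g h0 hw hv a => ?_, fun a b => ?_⟩
  · rw [← hqh]
    exact hK K hKc (he.estimate_mem K hKc h0 hy) (fun _ _ k => k.elim0) a
  · exact hg _ (fun b => he.inner_output b l hl k)
      (fun s hs' j => hs.inner_output_increment hh hl hs'.1 j k) (fun _ _ k => k.elim0) a
  · refine hg g (he.inner_eq_zero g h0 (fun s hs' j => hw s ⟨hs'.1, ?_⟩ j) hv) (fun s hs' j => ?_)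
      (fun _ _ k => k.elim0) a
    · linarith [hs'.2]
    · rw [inner_sub_left, hw _ ⟨by linarith [hs'.1], by linarith [hs'.2]⟩,
        hw _ ⟨hq, by linarith⟩, sub_self]
  · rw [hcov, Matrix.zero_mul, flow_zero_eq_predictCov hS hh]

/-- Correction by a sample. -/
theorem exists_correct (hs : IsHilbertSampled A S₀ G C h x w y v m₀ e₀) (hh : 0 ≤ h) {q : ℕ}
    {e : Fin n → H} {M : Matrix (Fin n) (Fin n) ℝ} (hM : M.PosDef)
    (he : IsSlotError m₀ e₀ w y v ((q + 1) * h) q (x ((q + 1) * h)) e M) :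
    ∃ e' : Fin n → H, IsSlotError m₀ e₀ w y v ((q + 1) * h) (q + 1) (x ((q + 1) * h)) e'
      (M⁻¹ + C q * (C q)ᵀ)⁻¹ := by
  have hO := posSemidef_mul_transpose (C q)
  set T := (M⁻¹ + C q * (C q)ᵀ)⁻¹ with hT
  have hTadd : T + T * (C q * (C q)ᵀ) * M = M := infoUpdate_add_right hM hO
  -- I is the innovation, the new sample minus its prediction.
  obtain ⟨I, hI⟩ : ∃ I : Fin p → H, ∀ k, I k = matAct (C q)ᵀ e k + v q k := ⟨_, fun _ => rfl⟩
  have hev : ∀ a k, ⟪e a, v q k⟫ = 0 := fun a k => he.inner_eq_zero _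
    (fun a => hs.inner_error_noise q a k) (fun s hs' j => hs.inner_input_noise s hs'.1 q j k)
    (fun l hl i => hs.inner_noise_of_ne l q hl.ne i k) a
  have hvx : ∀ k b, ⟪v q k, x ((q + 1) * h) b - e b⟫ = 0 := fun k b =>
    inner_eq_zero_of_mem fun K hK hb => he.estimate_mem K hK
      (fun c => hb _ (by rw [real_inner_comm]; exact hs.inner_known_noise q c k))
      (fun l hl i => hb _ (hs.inner_noise_output hh hl k i)) b
  have hy : ∀ k, y q k = matAct (C q)ᵀ (x ((q + 1) * h) - e) k + I k := fun k => by
    rw [hs.output, hI, matAct_sub, Pi.sub_apply]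
    abel
  have heI : ∀ a k, ⟪e a, I k⟫ = (M * C q) a k := fun a k => by
    rw [hI, inner_add_right, hev, add_zero, inner_matAct_right]
    simp only [he.inner_eq, Matrix.mulVec, dotProduct, Matrix.mul_apply, Matrix.transpose_apply,
      mul_comm]
  have hvI : ∀ i k, ⟪v q i, I k⟫ = (1 : Matrix (Fin p) (Fin p) ℝ) i k := fun i k => by
    have h1 : (fun a => ⟪v q i, e a⟫) = 0 :=
      funext fun a => by rw [real_inner_comm]; exact hev a i
    rw [hI, inner_add_right, inner_matAct_right, h1, Matrix.mulVec_zero, Pi.zero_apply, zero_add,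
      hs.inner_noise, Matrix.one_apply]
    simp only [eq_comm]
  have hII : ∀ i k, ⟪I i, I k⟫ = ((C q)ᵀ * (M * C q) + 1 : Matrix (Fin p) (Fin p) ℝ) i k := fun i k => by
    conv_lhs => rw [hI i]
    rw [inner_add_left, hvI, inner_matAct_left, Matrix.add_apply]
    simp only [heI]
    rfl
  -- The Kalman gain in information form: TC = MC(CᵀMC + 1)⁻¹ by T + TCCᵀM = M, so e' is e minus its
  -- projection onto the innovation.
  obtain ⟨e', he'⟩ : ∃ e' : Fin n → H, ∀ a, e' a = e a - matAct (T * C q) I a :=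
    ⟨_, fun _ => rfl⟩
  have he'I : ∀ a k, ⟪e' a, I k⟫ = 0 := fun a k => by
    rw [he', inner_sub_left, heI, inner_matAct_left]
    simp only [hII]
    have h1 : M * C q = T * C q * ((C q)ᵀ * (M * C q) + 1) := by
      conv_lhs => rw [← hTadd]
      simp only [Matrix.add_mul, Matrix.mul_add, Matrix.mul_assoc, Matrix.mul_one]
      rw [add_comm]
    rw [sub_eq_zero]
    exact congrFun (congrFun h1 a) k
  have he'g : ∀ g : H, (∀ a, ⟪e a, g⟫ = 0) → (∀ k, ⟪v q k, g⟫ = 0) → ∀ a, ⟪e' a, g⟫ = 0 := by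
    intro g hg hvg a
    have h1 : (fun k => ⟪I k, g⟫) = 0 := funext fun k => by
      rw [hI, inner_add_left, inner_matAct_left, hvg, mulVec_fun_eq_zero _ hg, add_zero]
      rfl
    rw [he', inner_sub_left, hg, inner_matAct_left, h1, Matrix.mulVec_zero, Pi.zero_apply,
      sub_zero]
  have he'x : ∀ a b, ⟪e' a, (x ((q + 1) * h) - e) b⟫ = 0 := fun a b =>
    he'g _ (fun c => hs.inner_slotError_estimate he c b) (fun k => hvx k b) a
  refine ⟨e', fun K hK h0 hyK a => ?_, fun a l hl k => ?_, fun g h0 hw hv a => ?_, fun a b => ?_⟩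
  · have h1 : ∀ b, (x ((q + 1) * h) - e) b ∈ K :=
      he.estimate_mem K hK h0 fun l hl k => hyK l (hl.trans (Nat.lt_succ_self q)) k
    have h2 : ∀ k, I k ∈ K := fun k => by
      have := K.sub_mem (hyK q (Nat.lt_succ_self q) k) (matAct_mem h1 (C q)ᵀ k)
      rwa [hy, add_sub_cancel_left] at this
    have h3 := K.add_mem (h1 a) (matAct_mem h2 (T * C q) a)
    have h4 : x ((q + 1) * h) a - e' a
        = (x ((q + 1) * h) - e) a + matAct (T * C q) I a := by
      rw [he', Pi.sub_apply]
      abel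
    rw [h4]
    exact h3
  · rcases (Nat.lt_succ_iff_lt_or_eq.1 hl) with hl | rfl
    · exact he'g _ (fun b => he.inner_output b l hl k)
        (fun i => hs.inner_noise_output hh hl i k) a
    · rw [hy, inner_add_right, he'I, add_zero, inner_matAct_right, mulVec_fun_eq_zero _ (he'x a)]
  · exact he'g g (he.inner_eq_zero g h0 hw fun l hl k => hv l (hl.trans (Nat.lt_succ_self q)) k)
      (hv q (Nat.lt_succ_self q)) a
  -- As e' is orthogonal to the innovation, its covariance is M - TCCᵀM = T.
  · have h1 : ⟪e' a, e' b⟫ = ⟪e' a, e b⟫ := by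
      conv_lhs => rw [he' b]
      rw [inner_sub_right, inner_matAct_right, mulVec_fun_eq_zero _ (he'I a), sub_zero]
    have h2 : ∀ k, ⟪I k, e b⟫ = ((C q)ᵀ * M) k b := fun k => by
      rw [real_inner_comm, heI, ← Matrix.transpose_apply (M * C q), Matrix.transpose_mul,
        transpose_eq_of_posSemidef hM.posSemidef]
    rw [h1, he', inner_sub_left, he.inner_eq, inner_matAct_left]
    simp only [h2]
    have h3 : M - T * C q * ((C q)ᵀ * M) = T := by
      rw [sub_eq_iff_eq_add]
      conv_lhs => rw [← hTadd]
      simp only [Matrix.mul_assoc]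
    exact congrFun (congrFun h3 a) b

/-- The sampled Kalman filter. -/
theorem exists_slotError (hs : IsHilbertSampled A S₀ G C h x w y v m₀ e₀) (hh : 0 < h)
    (hctr : ObservablePair (G * Gᵀ) Aᵀ) (hS : S₀.PosSemidef) (q : ℕ) :
    (slotCov A G C h S₀ q).PosSemidef ∧ ∃ e : Fin n → H,
      IsSlotError m₀ e₀ w y v (q * h) q (x (q * h)) e (slotCov A G C h S₀ q) := by
  induction q with
  | zero =>
    refine ⟨hS, e₀, fun K _ h0 _ a => ?_, fun _ l hl => absurd hl (Nat.not_lt_zero l),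
      fun g h0 _ _ => h0, hs.inner_error⟩
    rw [Nat.cast_zero, zero_mul, hs.init, add_sub_cancel_right]
    exact h0 a
  | succ q ih =>
    obtain ⟨hq, e, he⟩ := ih
    obtain ⟨e1, he1⟩ := hs.exists_predict hh.le hq he
    -- Controllability makes the predicted covariance positive definite even when the initial one is
    -- singular, so its inverse in the correction is genuine.
    obtain ⟨e2, he2⟩ := hs.exists_correct hh.le (posDef_predictCov hctr hh hq) he1
    refine ⟨(posDef_slotUpdate hctr hh (C q) hq).posSemidef, e2, ?_⟩
    push_cast
    exact he2

end IsHilbertSampled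

end HilbertSampled


/-! ### The sampled system -/

section SampledSystem

open Matrix
open scoped RealInnerProductSpace ENNReal

set_option linter.unusedSectionVars false

variable {n m p N : ℕ}

theorem slotCov_add (A : Matrix (Fin n) (Fin n) ℝ) (G : Matrix (Fin n) (Fin m) ℝ)
    (C : ℕ → Matrix (Fin n) (Fin p) ℝ) (h : ℝ) (S₀ : Matrix (Fin n) (Fin n) ℝ) (a b : ℕ) :
    slotCov A G C h S₀ (a + b) = slotCov A G (fun q => C (a + q)) h (slotCov A G C h S₀ a) b := by
  induction b with
  | zero => rfl
  | succ b ih => rw [← Nat.add_assoc, slotCov, ih, slotCov]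

theorem slotCov_eq_foldl (A : Matrix (Fin n) (Fin n) ℝ) (G : Matrix (Fin n) (Fin m) ℝ)
    (cbar : Fin N → Matrix (Fin n) (Fin p) ℝ) (ρ : ℕ → Fin N) (h : ℝ)
    (S₀ : Matrix (Fin n) (Fin n) ℝ) (b : ℕ) :
    slotCov A G (fun q => cbar (ρ q)) h S₀ b
      = (List.ofFn fun l : Fin b => ρ l).foldl (fun T i => slotUpdate A G h (cbar i) T) S₀ := by
  induction b with
  | zero => rfl
  | succ b ih =>
    rw [slotCov, ih, List.ofFn_succ', List.concat_eq_append, List.foldl_append]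
    rfl

theorem slotCov_period {rtot : ℕ} [NeZero rtot] (A : Matrix (Fin n) (Fin n) ℝ)
    (G : Matrix (Fin n) (Fin m) ℝ) (cbar : Fin N → Matrix (Fin n) (Fin p) ℝ) (τ : ℝ)
    (R : Fin rtot → Fin N) (S₀ : Matrix (Fin n) (Fin n) ℝ) (k : ℕ) :
    slotCov A G (fun q => cbar (R (Fin.ofNat rtot q))) (τ / rtot) S₀ (k * rtot)
      = (periodUpdate A G cbar τ R)^[k] S₀ := by
  induction k with
  | zero => rw [zero_mul]; rfl
  | succ k ih =>
    rw [Nat.succ_mul, slotCov_add, ih, Function.iterate_succ_apply',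
      slotCov_eq_foldl A G cbar fun q => R (Fin.ofNat rtot (k * rtot + q)), periodUpdate]
    -- After k full periods the slot index is reduced modulo `rtot`, so the schedule restarts at the
    -- first slot.
    congr 2
    funext l
    congr 1
    ext
    rw [Fin.val_ofNat, Nat.mul_add_mod_self_right, Nat.mod_eq_of_lt l.2]

variable {Ω : Type*} {mΩ : MeasurableSpace Ω} {P : Measure Ω} [IsProbabilityMeasure P]
variable {A S₀ : Matrix (Fin n) (Fin n) ℝ} {G : Matrix (Fin n) (Fin m) ℝ}
  {cbar : Fin N → Matrix (Fin n) (Fin p) ℝ} {h : ℝ} {w : Fin m → ℝ≥0 → Ω → ℝ}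
  {v : Fin N → ℕ → Fin p → Ω → ℝ} {x : ℝ≥0 → Ω → Fin n → ℝ} {y : Fin N → ℕ → Ω → Fin p → ℝ}

/-- The sample of slot `q` in `L²`, when sensor `ρ q` is used in slot `q`. -/
noncomputable def sampleL2 (P : Measure Ω) (A : Matrix (Fin n) (Fin n) ℝ)
    (G : Matrix (Fin n) (Fin m) ℝ) (cbar : Fin N → Matrix (Fin n) (Fin p) ℝ) (h : ℝ)
    (w : Fin m → ℝ≥0 → Ω → ℝ) (v : Fin N → ℕ → Fin p → Ω → ℝ) (x : ℝ≥0 → Ω → Fin n → ℝ)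
    (ρ : ℕ → Fin N) (q : ℕ) (k : Fin p) : Lp ℝ 2 P :=
  matAct (cbar (ρ q))ᵀ (stateL2 P A G w x ((q + 1) * h)) k + toL2 P (v (ρ q) q k)

theorem isGaussianProcess_unit {X : Ω → ℝ} (hX : HasGaussianLaw X P) :
    IsGaussianProcess (fun _ : Unit => X) P :=
  ⟨fun I => hX.map_fun (ContinuousLinearMap.pi fun _ : I => ContinuousLinearMap.id ℝ ℝ)⟩

namespace IsSampledSystem

theorem measurable_noise (v : Fin N → ℕ → Fin p → Ω → ℝ) (i : Fin N) (q : ℕ) (a : Fin p) :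
    Measurable[MeasurableSpace.comap (fun ω i q a => v i q a ω) inferInstance] (v i q a) :=
  have h1 : Measurable[MeasurableSpace.comap (fun ω i q a => v i q a ω) inferInstance]
      fun ω q a => v i q a ω :=
    (measurable_pi_apply i).comp (comap_measurable fun ω i q a => v i q a ω)
  have h2 : Measurable[MeasurableSpace.comap (fun ω i q a => v i q a ω) inferInstance]
      fun ω a => v i q a ω := (measurable_pi_apply q).comp h1
  (measurable_pi_apply a).comp h2

theorem hasGaussianLaw_noise (hs : IsSampledSystem P A G cbar h S₀ w v x y) (i : Fin N) (q : ℕ)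
    (a : Fin p) : HasGaussianLaw (v i q a) P :=
  (hs.noise_law i q a).hasGaussianLaw

theorem memLp_noise (hs : IsSampledSystem P A G cbar h S₀ w v x y) (i : Fin N) (q : ℕ)
    (a : Fin p) : MemLp (v i q a) 2 P :=
  (hs.hasGaussianLaw_noise i q a).memLp_two

theorem integral_noise (hs : IsSampledSystem P A G cbar h S₀ w v x y) (i : Fin N) (q : ℕ)
    (a : Fin p) : ∫ ω, v i q a ω ∂P = 0 := by
  rw [(hs.noise_law i q a).integral_eq, integral_id_gaussianReal]

theorem inner_noise_oneLp (hs : IsSampledSystem P A G cbar h S₀ w v x y) (i : Fin N) (q : ℕ)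
    (a : Fin p) : ⟪toL2 P (v i q a), oneLp P⟫ = 0 := by
  rw [inner_toL2_oneLp (hs.memLp_noise i q a), hs.integral_noise]

theorem inner_noise_self (hs : IsSampledSystem P A G cbar h S₀ w v x y) (i : Fin N) (q : ℕ)
    (a : Fin p) : ⟪toL2 P (v i q a), toL2 P (v i q a)⟫ = 1 := by
  rw [inner_toL2 (hs.memLp_noise i q a) (hs.memLp_noise i q a), hs.integral_noise, zero_mul,
    add_zero, covariance_self (hs.memLp_noise i q a).aemeasurable,
    (hs.noise_law i q a).variance_eq, variance_id_gaussianReal]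
  rfl

theorem inner_noise_of_ne (hs : IsSampledSystem P A G cbar h S₀ w v x y)
    {u u' : Fin N × ℕ × Fin p} (hu : u ≠ u') :
    ⟪toL2 P (v u.1 u.2.1 u.2.2), toL2 P (v u'.1 u'.2.1 u'.2.2)⟫ = 0 := by
  have h1 := (hs.noise_indep.indepFun hu).covariance_eq_zero
    (hs.memLp_noise u.1 u.2.1 u.2.2) (hs.memLp_noise u'.1 u'.2.1 u'.2.2)
  rw [inner_toL2 (hs.memLp_noise _ _ _) (hs.memLp_noise _ _ _), hs.integral_noise, zero_mul,
    add_zero]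
  exact h1

theorem noiseL2_mem (hs : IsSampledSystem P A G cbar h S₀ w v x y) (i : Fin N) (q : ℕ)
    (a : Fin p) : toL2 P (v i q a)
      ∈ measurableL2 (MeasurableSpace.comap (fun ω i q a => v i q a ω) inferInstance) P :=
  toL2_mem_measurableL2 (hs.memLp_noise i q a) (measurable_noise v i q a)

theorem indep_input_noise (hs : IsSampledSystem P A G cbar h S₀ w v x y) :
    Indep (MeasurableSpace.comap (fun ω j t => w j t ω) inferInstance)
      (MeasurableSpace.comap (fun ω i q a => v i q a ω) inferInstance) P :=
  hs.indep_noises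

theorem indep_init_all (hs : IsSampledSystem P A G cbar h S₀ w v x y) :
    Indep (MeasurableSpace.comap (x 0) inferInstance)
      (MeasurableSpace.comap (fun ω j t => w j t ω) inferInstance
        ⊔ MeasurableSpace.comap (fun ω i q a => v i q a ω) inferInstance) P := by
  have h1 := hs.indep_init
  rw [IndepFun_iff_Indep, Prod.instMeasurableSpace, MeasurableSpace.comap_prodMk] at h1
  exact h1

theorem coeFn_sampleL2 (hs : IsSampledSystem P A G cbar h S₀ w v x y) (hh : 0 ≤ h) (ρ : ℕ → Fin N)
    (q : ℕ) (k : Fin p) :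
    sampleL2 P A G cbar h w v x ρ q k =ᵐ[P] fun ω => y (ρ q) q ω k := by
  have h0 : (0 : ℝ) ≤ (q + 1) * h := by positivity
  have h3 := (Lp.coeFn_add _ _).trans
    ((coeFn_matAct (cbar (ρ q))ᵀ (fun a => hs.state.coeFn_stateL2 h0 a) k).add
      (coeFn_toL2 (hs.memLp_noise (ρ q) q k)))
  refine EventuallyEq.trans h3 ?_
  filter_upwards [hs.output] with ω hω
  exact (congrFun (hω (ρ q) q) k).symm

theorem isHilbertSampled (hs : IsSampledSystem P A G cbar h S₀ w v x y) (ρ : ℕ → Fin N) :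
    IsHilbertSampled A S₀ G (fun q => cbar (ρ q)) h (stateL2 P A G w x) (familyL2 P w)
      (sampleL2 P A G cbar h w v x ρ) (fun q k => toL2 P (v (ρ q) q k)) (meanL2 P x)
      (deviationL2 P x) := by
  have hxw := indep_of_indep_of_le_right hs.indep_init_all
    (le_sup_left (a := MeasurableSpace.comap (fun ω j t => w j t ω) inferInstance))
  have hxv := indep_of_indep_of_le_right hs.indep_init_all
    (le_sup_right (b := MeasurableSpace.comap (fun ω i q a => v i q a ω) inferInstance))
  exact
  { continuous_state := hs.state.continuous_stateL2
    continuous_input := hs.state.continuous_input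
    state := hs.state.stateL2_eq
    state_mem := fun K hK h0 t ht hw a => hs.state.stateL2_mem hK ht
      (fun b => by rw [← hs.state.stateL2_zero (G := G)]; exact h0 b) hw a
    output := fun q k => rfl
    inner_input := fun s t hs0 ht i j =>
      inner_familyL2 hs.state.brownian hs.state.indep hs0 ht i j
    inner_noise := fun q i j => by
      split_ifs with hij
      · rw [hij, hs.inner_noise_self]
      · exact hs.inner_noise_of_ne (u := (ρ q, q, i)) (u' := (ρ q, q, j))
          fun hu => hij (congrArg (fun u => u.2.2) hu).symm
    inner_noise_of_ne := fun q l hql i j =>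
      hs.inner_noise_of_ne (u := (ρ q, q, i)) (u' := (ρ l, l, j))
        fun hu => hql (congrArg (fun u => u.2.1) hu)
    inner_input_noise := fun s _ q i j => by
      rw [inner_of_indep hs.indep_input_noise (hs.state.familyL2_mem_measurableL2 s i)
        (hs.noiseL2_mem (ρ q) q j), hs.inner_noise_oneLp, mul_zero]
    init := fun a => by rw [hs.state.stateL2_zero, initL2_eq]
    inner_error := hs.state.inner_deviationL2
    inner_error_known := hs.state.inner_deviationL2_meanL2
    inner_error_input := fun t _ a j => by
      rw [inner_of_indep hxw (hs.state.deviationL2_mem_measurableL2 a)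
        (hs.state.familyL2_mem_measurableL2 t j), hs.state.inner_familyL2_oneLp, mul_zero]
    inner_error_noise := fun q a k => by
      rw [inner_of_indep hxv (hs.state.deviationL2_mem_measurableL2 a)
        (hs.noiseL2_mem (ρ q) q k), hs.inner_noise_oneLp, mul_zero]
    inner_known_input := fun t _ a j =>
      IsStateProcess.inner_meanL2_eq_zero (hs.state.inner_familyL2_oneLp t j) a
    inner_known_noise := fun q a k =>
      IsStateProcess.inner_meanL2_eq_zero (hs.inner_noise_oneLp (ρ q) q k) a }

/-- The covariance recursion over the slots is the error covariance of the sampled system. -/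
theorem isErrorCov_slot (hs : IsSampledSystem P A G cbar h S₀ w v x y) (hh : 0 < h)
    (hctr : ObservablePair (G * Gᵀ) Aᵀ) (hS : S₀.PosSemidef) (ρ : ℕ → Fin N) (q : ℕ) :
    IsErrorCov (⨆ l : Fin q, MeasurableSpace.comap (y (ρ l) l) inferInstance) P
      (x (q * h).toNNReal) (slotCov A G (fun q => cbar (ρ q)) h S₀ q) := by
  have hsys := hs.isHilbertSampled ρ
  obtain ⟨-, e, he⟩ := hsys.exists_slotError hh hctr hS q
  -- Each scalar noise is regarded as a Gaussian process over a one-point index set, including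
  -- noises of sensors that are idle in the slot.
  have hV := hs.state.isGaussianSpace
    (U := fun (u : Fin N × ℕ × Fin p) (_ : Unit) => v u.1 u.2.1 u.2.2)
    (fun u => isGaussianProcess_unit (hs.hasGaussianLaw_noise u.1 u.2.1 u.2.2))
    (hs.noise_indep.comp (fun _ r _ => r) fun _ => measurable_pi_lambda _ fun _ => measurable_id)
    (fun u _ => measurable_noise v u.1 u.2.1 u.2.2) hs.indep_input_noise hs.indep_init_all
  have hqh : (0 : ℝ) ≤ q * h := by positivity
  refine hV.isErrorCov isClosed_systemSpace oneLp_mem_systemSpace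
    (κ := Fin q × Fin p) (Y := fun k ω => y (ρ k.1) k.1 ω k.2)
    (Y' := fun k => sampleL2 P A G cbar h w v x ρ k.1 k.2) (X' := stateL2 P A G w x (q * h))
    (e := e)
    (fun k => (measurable_pi_apply k.2).comp (hs.measurable (ρ k.1) k.1))
    (fun k => hs.coeFn_sampleL2 hh.le ρ k.1 k.2)
    (fun k => Submodule.add_mem _ (matAct_mem
      (fun a => hs.state.stateL2_mem_systemSpace (by positivity) a) _ _)
      (mem_systemSpace_two (toL2_mem_familySpan
        (fun (u : Fin N × ℕ × Fin p) (_ : Unit) => v u.1 u.2.1 u.2.2) (ρ k.1, k.1, k.2) ())))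
    (fun a => hs.state.coeFn_stateL2 hqh a)
    (fun a => hs.state.stateL2_mem_systemSpace hqh a) (fun a K hKc h1 hY => ?_)
    (fun a => ?_) (fun a k => he.inner_output a k.1 k.1.2 k.2) he.inner_eq ?_
  · exact he.estimate_mem K hKc (meanL2_mem h1) (fun l hl k => hY (⟨l, hl⟩, k)) a
  · exact he.inner_eq_zero _ hs.state.inner_deviationL2_oneLp
      (fun s _ j => hs.state.inner_familyL2_oneLp s j)
      (fun l _ k => hs.inner_noise_oneLp (ρ l) l k) a
  · rw [iSup_prod]
    exact iSup_congr fun l => comap_eq_iSup_eval _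

theorem isErrorCov_period {rtot : ℕ} [NeZero rtot] {τ : ℝ} (hτ : 0 < τ) (R : Fin rtot → Fin N)
    (hs : IsSampledSystem P A G cbar (τ / rtot) S₀ w v x y)
    (hctr : ObservablePair (G * Gᵀ) Aᵀ) (hS : S₀.PosSemidef) (k : ℕ) :
    IsErrorCov (sampledInfo R y k) P (x ((k : ℝ) * τ).toNNReal)
      ((periodUpdate A G cbar τ R)^[k] S₀) := by
  have hr : (0 : ℝ) < rtot := Nat.cast_pos.2 (NeZero.pos rtot)
  have h1 := hs.isErrorCov_slot (div_pos hτ hr) hctr hS (fun q => R (Fin.ofNat rtot q)) (k * rtot)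
  have h2 : ((k * rtot : ℕ) : ℝ) * (τ / rtot) = k * τ := by
    push_cast
    field_simp
  rwa [slotCov_period, h2] at h1

end IsSampledSystem

end SampledSystem


variable {n m p N : ℕ}

theorem sum_sqrt_gain (r : Fin N → ℕ) (c : Fin N → Matrix (Fin n) (Fin p) ℝ) :
    ∑ i, (Real.sqrt (r i) • c i) * (Real.sqrt (r i) • c i)ᵀ = ∑ i, (r i : ℝ) • (c i * (c i)ᵀ) := by
  refine Finset.sum_congr rfl fun i _ => ?_
  rw [Matrix.transpose_smul, Matrix.smul_mul, Matrix.mul_smul, smul_smul,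
    Real.mul_self_sqrt (Nat.cast_nonneg (r i))]

end KalmanSampling

theorem mainTheorem6 {n m p N : ℕ} (A : Matrix (Fin n) (Fin n) ℝ)
    (G : Matrix (Fin n) (Fin m) ℝ) (c : Fin N → Matrix (Fin n) (Fin p) ℝ) (r : Fin N → ℕ)
    (hr : ∀ i, 0 < r i)
    (hobs : KalmanSampling.IsObservable A c)
    (hctr : KalmanSampling.IsControllable A G) :
    ∃ Sinf : Matrix (Fin n) (Fin n) ℝ,
      -- `Sinf` is the unique positive semidefinite solution of the algebraic Riccati equation
      (Sinf.PosSemidef ∧ KalmanSampling.riccati A G (fun i => Real.sqrt (r i) • c i) Sinf = 0 ∧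
        ∀ S : Matrix (Fin n) (Fin n) ℝ, S.PosSemidef →
          KalmanSampling.riccati A G (fun i => Real.sqrt (r i) • c i) S = 0 → S = Sinf) ∧
      -- the continuous-time problem: the Riccati flow converges to `Sinf`, and it is the error
      -- covariance of the system with observation gains `√rᵢ cᵢ`
      (∀ S0 : Matrix (Fin n) (Fin n) ℝ, S0.PosSemidef →
        ∃ S : ℝ → Matrix (Fin n) (Fin n) ℝ,
          KalmanSampling.IsRiccatiSolution A G (fun i => Real.sqrt (r i) • c i) S0 S ∧
          (∀ S' : ℝ → Matrix (Fin n) (Fin n) ℝ,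
            KalmanSampling.IsRiccatiSolution A G (fun i => Real.sqrt (r i) • c i) S0 S' →
              Set.EqOn S' S (Set.Ici 0)) ∧
          Tendsto S atTop (𝓝 Sinf) ∧
          ∀ (Ω : Type*) [MeasurableSpace Ω] (P : Measure Ω) [IsProbabilityMeasure P]
            (w : Fin m → ℝ≥0 → Ω → ℝ) (ν : Fin N → Fin p → ℝ≥0 → Ω → ℝ)
            (x : ℝ≥0 → Ω → Fin n → ℝ) (z : Fin N → ℝ≥0 → Ω → Fin p → ℝ),
            KalmanSampling.IsContinuousSystem P A G (fun i => Real.sqrt (r i) • c i) S0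
              w ν x z →
            ∀ t : ℝ≥0,
              KalmanSampling.IsErrorCov (KalmanSampling.continuousInfo z t) P (x t) (S t)) ∧
      -- the sampled system, for every order of the slots with slot counts `r`
      ∀ (rtot : ℕ) [NeZero rtot] (R : Fin rtot → Fin N),
        (∀ i, KalmanSampling.slotCount R i = r i) →
        -- `Φ_R^k(S0)` is the error covariance after `k` periods
        (∀ τ : ℝ, 0 < τ → ∀ S0 : Matrix (Fin n) (Fin n) ℝ, S0.PosSemidef →
          ∀ (Ω : Type*) [MeasurableSpace Ω] (P : Measure Ω) [IsProbabilityMeasure P]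
            (w : Fin m → ℝ≥0 → Ω → ℝ) (v : Fin N → ℕ → Fin p → Ω → ℝ)
            (x : ℝ≥0 → Ω → Fin n → ℝ) (y : Fin N → ℕ → Ω → Fin p → ℝ),
            KalmanSampling.IsSampledSystem P A G (KalmanSampling.scaledGain c τ) (τ / rtot) S0
              w v x y →
            ∀ k : ℕ,
              KalmanSampling.IsErrorCov (KalmanSampling.sampledInfo R y k) P
                (x ((k : ℝ) * τ).toNNReal)
                ((KalmanSampling.periodUpdate A G (KalmanSampling.scaledGain c τ) τ R)^[k] S0)) ∧
        -- for small `τ` the steady state exists and does not depend on the initial covariance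
        (∀ᶠ τ in 𝓝[>] (0 : ℝ), ∀ S0 : Matrix (Fin n) (Fin n) ℝ, S0.PosSemidef →
          Tendsto
            (fun k : ℕ =>
              (KalmanSampling.periodUpdate A G (KalmanSampling.scaledGain c τ) τ R)^[k] S0)
            atTop (𝓝 (KalmanSampling.steadyCov A G (KalmanSampling.scaledGain c τ) τ R))) ∧
        Tendsto (fun τ => KalmanSampling.steadyError A G (KalmanSampling.scaledGain c τ) τ R)
          (𝓝[>] (0 : ℝ)) (𝓝 Sinf.trace) := by
  have hD : (∑ i, (r i : ℝ) • (c i * (c i)ᵀ)).PosSemidef :=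
    Matrix.posSemidef_sum _ fun i _ =>
      (KalmanSampling.posSemidef_mul_transpose (c i)).smul (Nat.cast_nonneg _)
  have hQ := KalmanSampling.posSemidef_mul_transpose G
  have ho := KalmanSampling.observablePair_of_isObservable hr hobs
  have hc := KalmanSampling.observablePair_of_isControllable hctr
  obtain ⟨F, hF, hF0, hFt⟩ := KalmanSampling.exists_tendsto_flow hD hQ ho hc
  have huniq : ∀ S : Matrix (Fin n) (Fin n) ℝ, S.PosSemidef →
      KalmanSampling.ric A (∑ i, (r i : ℝ) • (c i * (c i)ᵀ)) (G * Gᵀ) S = 0 → S = F := by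
    intro S hS h0
    -- A solution of the algebraic equation is a stationary orbit, and every orbit tends to F.
    refine tendsto_nhds_unique (tendsto_const_nhds.congr' ?_) (hFt S hS)
    filter_upwards [eventually_ge_atTop 0] with t ht
    exact (KalmanSampling.flow_of_ric_eq_zero hD hQ hS h0 ht).symm
  refine ⟨F, ⟨hF, by rw [KalmanSampling.riccati_eq_ric, hF0], fun S hS h0 => ?_⟩,
    fun S₀ hS₀ => ⟨KalmanSampling.flow A _ (G * Gᵀ) S₀, ⟨KalmanSampling.flow_zero, fun t ht => ?_⟩,
      fun S' hS' t ht => ?_, hFt S₀ hS₀, fun Ω _ P _ w ν x z hs t => ?_⟩,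
    fun rtot _ R hR => ⟨fun τ hτ S₀ hS₀ Ω _ P _ w v x y hs k => ?_, ?_⟩⟩
  · rw [KalmanSampling.riccati_eq_ric] at h0
    exact huniq S hS h0
  · rw [KalmanSampling.riccati_eq_ric]
    exact fun a b => (hasDerivAt_pi.1 (hasDerivAt_pi.1
      (KalmanSampling.hasDerivAt_flow hD hQ hS₀ ht) a) b).hasDerivWithinAt
  · refine KalmanSampling.eq_flow_of_hasDerivWithinAt hD hQ hS₀ hS'.1 (fun u hu => ?_) ht
    rw [← KalmanSampling.riccati_eq_ric]
    exact hasDerivWithinAt_pi.2 fun a => hasDerivWithinAt_pi.2 (hS'.2 u hu a)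
  · rw [← KalmanSampling.sum_sqrt_gain]
    exact hs.isErrorCov hS₀ t
  · exact hs.isErrorCov_period hτ R hc hS₀ k
  · obtain ⟨h1, h2⟩ := KalmanSampling.tendsto_steadyCov c ho hc huniq hR
    exact ⟨h1, (continuous_id.matrix_trace.tendsto F).comp h2⟩
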